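/- **Setting.** Let $n_x,n_y,n_z\ge 2$ and let $G$ be the nearest-neighbour graph of the box-shaped cubic lattice with vertex set $\mathbf V=\prod_{d\in\{x,y,z\}}\{0,\dots,n_d-1\}$; its faces are the unit squares and its cells the unit cubes of the lattice. Every edge is given an orientation ("$i$ points to $j$") whose restriction to each two-dimensional slice is that of the square-lattice compact encoding: each face is either *even* (its four oriented edges circulate around it) or *odd* (its edges touch head to head or tail to tail at each of its vertices), and in every slice the even and odd faces form a checkerboard. A cell is *odd* if all six of its faces are odd. An *isolated odd face* is an odd face on the boundary of the box that is not a face of an odd cell. For each isolated odd face one edge of that face is chosen. **The encoding.** Let $M_G$ be the group generated by central phases $\{\pm1,\pm \mathrm i\}$ (multiplying as complex numbers), the directed edges $e_{ij}$ and the vertices $v_j$ of $G$, subject to $e_{ij}^2=v_j^2=1$, $e_{ij}=-e_{ji}$, $[v_i,v_j]=[e_{ij},v_k]=[e_{ij},e_{kl}]=0$, $e_{ij}v_j=-v_je_{ij}$, $e_{ij}e_{jk}=-e_{jk}e_{ij}$ for distinct $i,j,k,l$ (where $[a,b]=0$ means $ab=ba$). Let $\mathcal C_G\le M_G$ be the subgroup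 of the elements $\mathrm i^{\ell}e_{i_0i_1}e_{i_1i_2}\cdots e_{i_{\ell-1}i_\ell}$, $i_\ell=i_0$, over closed walks with $\ell$ edges. Place one qubit on each vertex and one on each odd face. The cubic compact encoding is the representation $\sigma$ of $M_G$ on the Hilbert space of these qubits in which the phases act as scalars, $\sigma(v_j)=Z_j$, and, whenever $i$ points to $j$, $\sigma(e_{ij})=\pm X_iY_jP(i,j)$ and $\sigma(e_{ji})=-\sigma(e_{ij})$. Here $P(i,j)$ acts with $X$, $Y$ or $Z$, according as the edge is parallel to the $x$, $y$ or $z$ axis, on the qubit of every odd face containing the edge; the sign is $-$ if the edge was chosen for an isolated odd face and $+$ otherwise. With $N$ the number of qubits, $M=|\mathbf V|$, $S=\sigma(\mathcal C_G)$ and $D(S)$ the minimum size of a generating set of $S$, the *disparity* is $\Delta=N-M-D(S)$. **Theorem.** For every such lattice, orientation and choice of edges, the representation $\sigma$ exists and $-1\notin\sigma(\mathcal C_G)$. Let $OCV$ be the number of odd corner vertices, i.e. of corner vertices of the box for which the cell at that corner is odd. Then $$\Delta=\frac{OCV}{2}-1\in\{-1,0,1,3\}.$$ -/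

import Mathlib

namespace CompactEncoding

noncomputable section

/-! ### The group of a fermionic graph, its cycle group, and the disparity -/

section Graph

variable {V : Type*} (G : SimpleGraph V)

/-- Generators of `M_G`: the phases `i ^ k` (that is `1, i, -1, -i`), the directed edges `e_{ij}`
(a dart with `fst = i`, `snd = j`) and the vertices `v_j`. -/
inductive Gen where
  | phase (k : ZMod 4) : Gen
  | edge (e : G.Dart) : Gen
  | vert (v : V) : Gen

variable {G} in
/-- The letter of the free group that belongs to a generator. -/
def letter (g : Gen G) : FreeGroup (Gen G) := FreeGroup.of g

open Gen in
/-- The relators of `M_G`. The phases are central and multiply like complex numbers; a relation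
`x = y` is written as the relator `x * y⁻¹`, and `-1` is `phase 2`. -/
inductive IsRelator : FreeGroup (Gen G) → Prop where
  | phase_mul (k l : ZMod 4) :
      IsRelator (letter (phase k) * letter (phase l) * (letter (phase (k + l)))⁻¹)
  | phase_central (k : ZMod 4) (g : Gen G) :
      IsRelator (letter (phase k) * letter g * (letter g * letter (phase k))⁻¹)
  | edge_sq (e : G.Dart) : IsRelator (letter (edge e) * letter (edge e))
  | vert_sq (v : V) : IsRelator (letter (vert v) * letter (vert v))
  | edge_symm (e : G.Dart) :
      IsRelator (letter (edge e) * (letter (phase 2) * letter (edge e.symm))⁻¹)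
  | vert_comm_vert (u v : V) :
      IsRelator (letter (vert u) * letter (vert v) * (letter (vert v) * letter (vert u))⁻¹)
  | edge_comm_vert (e : G.Dart) (v : V) (h₁ : v ≠ e.fst) (h₂ : v ≠ e.snd) :
      IsRelator (letter (edge e) * letter (vert v) * (letter (vert v) * letter (edge e))⁻¹)
  | edge_comm_edge (e f : G.Dart) (h₁ : e.fst ≠ f.fst) (h₂ : e.fst ≠ f.snd)
      (h₃ : e.snd ≠ f.fst) (h₄ : e.snd ≠ f.snd) :
      IsRelator (letter (edge e) * letter (edge f) * (letter (edge f) * letter (edge e))⁻¹)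
  | edge_anticomm_vert (e : G.Dart) :
      IsRelator (letter (edge e) * letter (vert e.snd) *
        (letter (phase 2) * (letter (vert e.snd) * letter (edge e)))⁻¹)
  | edge_anticomm_edge (e f : G.Dart) (h₁ : e.snd = f.fst) (h₂ : e.fst ≠ f.snd) :
      IsRelator (letter (edge e) * letter (edge f) *
        (letter (phase 2) * (letter (edge f) * letter (edge e)))⁻¹)

/-- The finitely presented group `M_G` of the graph `G`. -/
abbrev MG : Type _ := PresentedGroup {w : FreeGroup (Gen G) | IsRelator G w}

variable {G}

/-- The class of a generator in `M_G`. -/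
def gen (g : Gen G) : MG G := PresentedGroup.of g

/-- The element `i ^ ℓ * e_{i₁ i₂} * e_{i₂ i₃} * ⋯` of `M_G` attached to a closed walk with
`ℓ` edges. -/
def cycleElement {v : V} (w : G.Walk v v) : MG G :=
  gen (Gen.phase (w.length : ZMod 4)) * (w.darts.map fun e => gen (Gen.edge e)).prod

variable (G) in
/-- The group `C_G` of directed cycles. -/
def cycleGroup : Subgroup (MG G) :=
  Subgroup.closure {x | ∃ (v : V) (w : G.Walk v v), x = cycleElement w}

/-- The least number of generators of a (finitely generated) group. -/
def minGenerators (X : Type*) [Group X] : ℕ :=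
  sInf {k | ∃ s : Finset X, Subgroup.closure (s : Set X) = ⊤ ∧ s.card = k}

/-- Operators on the Hilbert space of a finite system of qubits labelled by `Q`, as matrices in
the computational basis. -/
abbrev QubitOp (Q : Type*) : Type _ := Matrix (Q → Fin 2) (Q → Fin 2) ℂ

variable {Q : Type*} [Fintype Q] [DecidableEq Q]

/-- The group `S = σ(C_G)`. -/
def stabilizerGroup (σ : MG G →* QubitOp Q) : Subgroup (QubitOp Q)ˣ :=
  (cycleGroup G).map σ.toHomUnits

/-- The disparity `Δ = N - M - D(S)`: `N` qubits, `M` modes (the vertices of `G`), and `D(S)` the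
least number of generators of `S`. -/
def disparity [Fintype V] (σ : MG G →* QubitOp Q) : ℤ :=
  (Fintype.card Q : ℤ) - Fintype.card V - minGenerators (stabilizerGroup σ)

end Graph

/-! ### Pauli operators -/

def pauliX : Matrix (Fin 2) (Fin 2) ℂ := !![0, 1; 1, 0]
def pauliY : Matrix (Fin 2) (Fin 2) ℂ := !![0, -Complex.I; Complex.I, 0]
def pauliZ : Matrix (Fin 2) (Fin 2) ℂ := !![1, 0; 0, -1]

/-- The tensor product over all qubits `q` of the single-qubit operators `P q`. -/
def tensorOp {Q : Type*} [Fintype Q] (P : Q → Matrix (Fin 2) (Fin 2) ℂ) : QubitOp Q :=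
  Matrix.of fun a b => ∏ q, P q (a q) (b q)

/-! ### The box-shaped cubic lattice -/

/-- Vertices of the box with `n d` vertices along the axis `d`. -/
abbrev Vertex (n : Fin 3 → ℕ) : Type := (d : Fin 3) → Fin (n d)

section Lattice

variable {n : Fin 3 → ℕ}

/-- `v` is the next vertex after `u` in the positive direction of the axis `d`. -/
def IsStep (d : Fin 3) (u v : Vertex n) : Prop :=
  (u d).val + 1 = (v d).val ∧ ∀ k, k ≠ d → u k = v k

variable (n) in
/-- The graph of the lattice: nearest neighbours are adjacent. -/
def lattice : SimpleGraph (Vertex n) where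
  Adj u v := ∃ d, IsStep d u v ∨ IsStep d v u
  symm := ⟨fun _ _ ⟨d, h⟩ => ⟨d, h.symm⟩⟩
  loopless := ⟨fun _ ⟨_, h⟩ => by rcases h with h | h <;> exact absurd h.1 (by omega)⟩

/-- The axis along which an edge `{u, v}` is aligned. -/
def edgeAxis (u v : Vertex n) : Fin 3 :=
  if u 0 ≠ v 0 then 0 else if u 1 ≠ v 1 then 1 else 2

variable (n) in
/-- Unit square faces: a normal axis and the vertex with the least coordinates. -/
abbrev Face : Type :=
  {p : Fin 3 × Vertex n // ∀ d, d ≠ p.1 → (p.2 d).val + 1 < n d}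

/-- The axis normal to the face. -/
def Face.normal (f : Face n) : Fin 3 := f.1.1

/-- The vertex of the face with the least coordinates. -/
def Face.base (f : Face n) : Vertex n := f.1.2

/-- The four vertices of a face. -/
def Face.verts (f : Face n) : Set (Vertex n) :=
  {v | v f.normal = f.base f.normal ∧
    ∀ d, d ≠ f.normal → (v d).val = (f.base d).val ∨ (v d).val = (f.base d).val + 1}

variable (n) in
/-- Unit cubic cells, given by the vertex with the least coordinates. -/
abbrev Cell : Type := {p : Vertex n // ∀ d, (p d).val + 1 < n d}

/-- The eight vertices of a cell. -/
def Cell.verts (c : Cell n) : Set (Vertex n) :=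
  {v | ∀ d, (v d).val = (c.1 d).val ∨ (v d).val = (c.1 d).val + 1}

/-- `o u v` says that the edge between `u` and `v` points from `u` to `v`: every edge points in
exactly one direction. -/
structure IsOrientation (o : Vertex n → Vertex n → Prop) : Prop where
  adj : ∀ u v, o u v → (lattice n).Adj u v
  xor : ∀ u v, (lattice n).Adj u v → (o u v ↔ ¬ o v u)

/-- A face is even if its edges circulate around it. -/
def IsEvenFace (o : Vertex n → Vertex n → Prop) (f : Face n) : Prop :=
  ∀ u v w, u ∈ f.verts → v ∈ f.verts → w ∈ f.verts →
    (lattice n).Adj u v → (lattice n).Adj v w → u ≠ w → (o u v ↔ o v w)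

/-- A face is odd if its edges touch head to head or tail to tail. -/
def IsOddFace (o : Vertex n → Vertex n → Prop) (f : Face n) : Prop :=
  ∀ u v w, u ∈ f.verts → v ∈ f.verts → w ∈ f.verts →
    (lattice n).Adj u v → (lattice n).Adj v w → u ≠ w → (o u v ↔ o w v)

/-- Orientations whose restriction to every two-dimensional slice is that of the square-lattice
compact encoding: every face is even or odd, and the even and odd faces of each slice form a
checkerboard, i.e. of two faces of a slice that share an edge exactly one is odd. -/
structure IsCompactOrientation (o : Vertex n → Vertex n → Prop) : Prop extends
    IsOrientation o where
  even_or_odd : ∀ f : Face n, IsEvenFace o f ∨ IsOddFace o f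
  checkerboard : ∀ (f g : Face n) (d : Fin 3), f.normal = g.normal → d ≠ f.normal →
    IsStep d f.base g.base → (IsOddFace o f ↔ ¬ IsOddFace o g)

/-- A cell is odd if all six of its faces are odd. -/
def IsOddCell (o : Vertex n → Vertex n → Prop) (c : Cell n) : Prop :=
  ∀ f : Face n, f.verts ⊆ c.verts → IsOddFace o f

/-- Odd faces on the boundary of the box that are not faces of an odd cell. -/
structure IsIsolatedOddFace (o : Vertex n → Vertex n → Prop) (f : Face n) : Prop where
  odd : IsOddFace o f
  boundary : (f.base f.normal).val = 0 ∨ (f.base f.normal).val + 1 = n f.normal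
  isolated : ∀ c : Cell n, IsOddCell o c → ¬ f.verts ⊆ c.verts

/-- A choice, for every isolated odd face, of an edge `(i, j)` of that face with `i` pointing to
`j`. The values of `pick` at other faces are irrelevant. -/
def IsEdgeChoice (o : Vertex n → Vertex n → Prop) (pick : Face n → Vertex n × Vertex n) : Prop :=
  ∀ f, IsIsolatedOddFace o f →
    (pick f).1 ∈ f.verts ∧ (pick f).2 ∈ f.verts ∧ o (pick f).1 (pick f).2

/-- Corner vertices of the box. -/
def IsCorner (v : Vertex n) : Prop := ∀ d, (v d).val = 0 ∨ (v d).val + 1 = n d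

/-- Corner vertices for which the cell at that corner is odd. -/
def IsOddCorner (o : Vertex n → Vertex n → Prop) (v : Vertex n) : Prop :=
  IsCorner v ∧ ∃ c : Cell n, v ∈ c.verts ∧ IsOddCell o c

/-- The number `OCV` of odd corner vertices. -/
def oddCornerCount (o : Vertex n → Vertex n → Prop) : ℕ := Nat.card {v : Vertex n // IsOddCorner o v}

/-! ### The cubic compact encoding -/

/-- One qubit for each vertex and one for each odd face. -/
abbrev Qubit (o : Vertex n → Vertex n → Prop) : Type := Vertex n ⊕ {f : Face n // IsOddFace o f}

instance (o : Vertex n → Vertex n → Prop) : Fintype (Qubit o) := Fintype.ofFinite _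

instance (o : Vertex n → Vertex n → Prop) : DecidableEq (Qubit o) := Classical.decEq _

/-- `P = X, Y, Z` for edges along the axes `x, y, z`. -/
def axisPauli : Fin 3 → Matrix (Fin 2) (Fin 2) ℂ := ![pauliX, pauliY, pauliZ]

/-- The operator `Z_v`. -/
def vertexOp (o : Vertex n → Vertex n → Prop) (v : Vertex n) : QubitOp (Qubit o) :=
  tensorOp fun
    | Sum.inl u => if u = v then pauliZ else 1
    | Sum.inr _ => 1

open Classical in
/-- The operator `X_i Y_j P(i,j)`, where `P(i,j)` acts with `P` on the qubit of every odd face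
adjacent to the edge `(i,j)`. -/
def unsignedEdgeOp (o : Vertex n → Vertex n → Prop) (i j : Vertex n) : QubitOp (Qubit o) :=
  tensorOp fun
    | Sum.inl u => if u = i then pauliX else if u = j then pauliY else 1
    | Sum.inr f => if i ∈ f.1.verts ∧ j ∈ f.1.verts then axisPauli (edgeAxis i j) else 1

open Classical in
/-- The operator of the edge `(i,j)` for `i` pointing to `j`: `-X_i Y_j P(i,j)` if the edge was
chosen for some isolated odd face, and `X_i Y_j P(i,j)` otherwise. -/
def orientedEdgeOp (o : Vertex n → Vertex n → Prop) (pick : Face n → Vertex n × Vertex n)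
    (i j : Vertex n) : QubitOp (Qubit o) :=
  if ∃ f, IsIsolatedOddFace o f ∧ pick f = (i, j) then -unsignedEdgeOp o i j
  else unsignedEdgeOp o i j

open Classical in
/-- The operators prescribed for the generators of `M_G`. -/
def generatorOp (o : Vertex n → Vertex n → Prop) (pick : Face n → Vertex n × Vertex n) :
    Gen (lattice n) → QubitOp (Qubit o)
  | Gen.phase k => (Complex.I ^ k.val) • 1
  | Gen.vert v => vertexOp o v
  | Gen.edge e =>
      if o e.fst e.snd then orientedEdgeOp o pick e.fst e.snd
      else -orientedEdgeOp o pick e.snd e.fst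

/-- `σ` is the representation of `M_G` with the prescribed values on the generators. -/
def IsCubicEncoding (o : Vertex n → Vertex n → Prop) (pick : Face n → Vertex n × Vertex n)
    (σ : MG (lattice n) →* QubitOp (Qubit o)) : Prop :=
  ∀ g, σ (gen g) = generatorOp o pick g

end Lattice

end

end CompactEncoding

open CompactEncoding

/-! The orientation is rigid. Opposite edges of a face point in opposite directions and consecutive
edges on a line in the same direction, so an edge along the axis `d` whose lower end has coordinate
`x` can be given the type `(x + c d) % 2`, and an edge points away from an end exactly when its type
differs from the parity of that end (`IsCompactOrientation.exists_isTypedBy`). A face or cell is odd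
exactly when all its edges have the same type. Extended to the infinite lattice, the edges of one
type fall apart into disjoint cubes, the odd cells of that type; the box clips them to cubes,
squares (the isolated odd faces), single edges or points.

Existence of `σ`: two edges that meet head to tail have different types, lie in no common odd face,
and anticommute at the common vertex. Two distinct edges that meet head to head or tail to tail have
the same type, commute at the vertices and span exactly one odd face, whose qubit supplies the sign
(`unsignedEdgeOp_anticomm`).

The cycle group is the cycle space. Modulo phases `M_G` is abelian, so a cycle element with
vanishing edge vector over `ZMod 2` is a phase; the Majorana representation sends all cycles to `1`
and is faithful on phases, so this phase is `1`. Hence `edgeHom` is injective on the cycle group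
(`edgeHom_injOn`), with image of dimension `E - V + 1` (`finrank_ker_boundary`), where `E` and `V`
count edges and vertices.

Which cycles act as scalars? Commuting with a Pauli operator on one qubit is a linear condition on
the edge vector. A suitable operator at a vertex shows that the edges of one type there have sum
zero, and one on a face qubit shows that parallel edges of an odd face have equal values. A vector
with these properties (`balanced`) is determined on each clipped cube by its values at the lowest
vertex, which have sum zero: dimension 2 for a cube, 1 for a square, 0 otherwise. All these values
are realised by cycles acting as the identity (`exists_mem_cycleKernel`): the loops around opposite
faces of an odd cell have equal operators, and the loop around an isolated odd face acts trivially
thanks to the sign of its chosen edge. So a cycle acting as a scalar acts as `1`, which excludes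
`-1`, and the kernel has dimension `m`, the sum of these local dimensions.

Therefore `D(S) = E - V + 1 - m`. Counting vertices, edges, odd faces and clipped cubes by the
number of segments of each type along the axes turns `2 * (Δ + 1)` into the sum over the two types
of a product over the axes of the number of box ends of that type, which is the number of odd
corners (`two_mul_disparity_add_one`). -/

namespace CompactEncoding

noncomputable section

/-! ### Tensor products of one-qubit operators -/

section Tensor

variable {Q : Type*} [Fintype Q]

theorem tensorOp_mul [DecidableEq Q] (P R : Q → Matrix (Fin 2) (Fin 2) ℂ) :
    tensorOp P * tensorOp R = tensorOp fun q => P q * R q := by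
  ext a b
  simp only [tensorOp, Matrix.mul_apply, Matrix.of_apply]
  rw [Finset.prod_univ_sum, Fintype.piFinset_univ]
  simp [Finset.prod_mul_distrib]

theorem tensorOp_smul (ε : Q → ℂ) (P : Q → Matrix (Fin 2) (Fin 2) ℂ) :
    tensorOp (fun q => ε q • P q) = (∏ q, ε q) • tensorOp P := by
  ext a b
  simp [tensorOp, Finset.prod_mul_distrib]

theorem tensorOp_one : tensorOp (fun _ : Q => (1 : Matrix (Fin 2) (Fin 2) ℂ)) = 1 := by
  ext a b
  simp only [tensorOp, Matrix.of_apply, Matrix.one_apply]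
  by_cases h : a = b
  · simp [h]
  · obtain ⟨q, hq⟩ := Function.ne_iff.mp h
    rw [if_neg h]
    exact Finset.prod_eq_zero (Finset.mem_univ q) (by simp [hq])

theorem tensorOp_eq_one {P : Q → Matrix (Fin 2) (Fin 2) ℂ} (h : ∀ q, P q = 1) :
    tensorOp P = 1 := by
  rw [show P = fun _ => 1 from funext h, tensorOp_one]

/-- Operators that commute at every qubit commute. -/
theorem tensorOp_commute [DecidableEq Q] {P R : Q → Matrix (Fin 2) (Fin 2) ℂ}
    (h : ∀ q, P q * R q = R q * P q) :
    tensorOp P * tensorOp R = tensorOp R * tensorOp P := by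
  rw [tensorOp_mul, tensorOp_mul, funext h]

/-- Operators that differ by a sign at exactly one qubit differ by a sign. -/
theorem tensorOp_eq_neg {P R : Q → Matrix (Fin 2) (Fin 2) ℂ} (q₀ : Q) (h₀ : P q₀ = -R q₀)
    (h : ∀ q, q ≠ q₀ → P q = R q) : tensorOp P = -tensorOp R := by
  classical
  have : P = fun q => (if q = q₀ then (-1 : ℂ) else 1) • R q := by
    funext q
    by_cases hq : q = q₀
    · subst hq; simp [h₀]
    · simp [hq, h q hq]
  rw [this, tensorOp_smul]
  simp

/-- Operators that anticommute at exactly one qubit and commute at the others anticommute. -/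
theorem tensorOp_anticommute [DecidableEq Q] {P R : Q → Matrix (Fin 2) (Fin 2) ℂ} (q₀ : Q)
    (h₀ : P q₀ * R q₀ = -(R q₀ * P q₀)) (h : ∀ q, q ≠ q₀ → P q * R q = R q * P q) :
    tensorOp P * tensorOp R = -(tensorOp R * tensorOp P) := by
  rw [tensorOp_mul, tensorOp_mul]
  exact tensorOp_eq_neg q₀ h₀ h

end Tensor

/-! ### Products of Pauli matrices -/

theorem pauliX_sq : pauliX * pauliX = 1 := by
  ext i j; fin_cases i <;> fin_cases j <;> simp [pauliX, Matrix.mul_apply]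

theorem pauliY_sq : pauliY * pauliY = 1 := by
  ext i j; fin_cases i <;> fin_cases j <;> simp [pauliY, Matrix.mul_apply]

theorem pauliZ_sq : pauliZ * pauliZ = 1 := by
  ext i j; fin_cases i <;> fin_cases j <;> simp [pauliZ, Matrix.mul_apply]

theorem pauliX_mul_pauliY : pauliX * pauliY = -(pauliY * pauliX) := by
  ext i j; fin_cases i <;> fin_cases j <;> simp [pauliX, pauliY, Matrix.mul_apply]

theorem pauliX_mul_pauliZ : pauliX * pauliZ = -(pauliZ * pauliX) := by
  ext i j; fin_cases i <;> fin_cases j <;> simp [pauliX, pauliZ, Matrix.mul_apply]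

theorem pauliY_mul_pauliZ : pauliY * pauliZ = -(pauliZ * pauliY) := by
  ext i j; fin_cases i <;> fin_cases j <;> simp [pauliZ, pauliY, Matrix.mul_apply]

theorem axisPauli_sq (a : Fin 3) : axisPauli a * axisPauli a = 1 := by
  fin_cases a <;> simp [axisPauli, pauliX_sq, pauliY_sq, pauliZ_sq]

theorem axisPauli_anticomm {a b : Fin 3} (h : a ≠ b) :
    axisPauli a * axisPauli b = -(axisPauli b * axisPauli a) := by
  fin_cases a <;> fin_cases b <;>
    simp_all [axisPauli, pauliX_mul_pauliY, pauliX_mul_pauliZ, pauliY_mul_pauliZ]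

section GraphGroup

variable {V : Type*} {G : SimpleGraph V}

/-! ### Relations of `M_G` and homomorphisms out of it -/

/-- A function on the generators that respects the defining relations extends to `M_G`. -/
theorem exists_hom_of_relations {R : Type*} [Monoid R] (F : Gen G → R)
    (phase_zero : F (.phase 0) = 1)
    (phase_mul : ∀ k l, F (.phase k) * F (.phase l) = F (.phase (k + l)))
    (phase_central : ∀ k g, F (.phase k) * F g = F g * F (.phase k))
    (edge_sq : ∀ e, F (.edge e) * F (.edge e) = 1)
    (vert_sq : ∀ v, F (.vert v) * F (.vert v) = 1)
    (edge_symm : ∀ e, F (.edge e) = F (.phase 2) * F (.edge e.symm))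
    (vert_comm_vert : ∀ u v, F (.vert u) * F (.vert v) = F (.vert v) * F (.vert u))
    (edge_comm_vert : ∀ (e : G.Dart) (v : V), v ≠ e.fst → v ≠ e.snd →
      F (.edge e) * F (.vert v) = F (.vert v) * F (.edge e))
    (edge_comm_edge : ∀ e f : G.Dart, e.fst ≠ f.fst → e.fst ≠ f.snd → e.snd ≠ f.fst →
      e.snd ≠ f.snd → F (.edge e) * F (.edge f) = F (.edge f) * F (.edge e))
    (edge_anticomm_vert : ∀ e : G.Dart,
      F (.edge e) * F (.vert e.snd) = F (.phase 2) * (F (.vert e.snd) * F (.edge e)))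
    (edge_anticomm_edge : ∀ e f : G.Dart, e.snd = f.fst → e.fst ≠ f.snd →
      F (.edge e) * F (.edge f) = F (.phase 2) * (F (.edge f) * F (.edge e))) :
    ∃ σ : MG G →* R, ∀ g, σ (gen g) = F g := by
  let U : Gen G → Rˣ := fun g => match g with
    | .phase k => ⟨F (.phase k), F (.phase (-k)), by rw [phase_mul, add_neg_cancel, phase_zero],
        by rw [phase_mul, neg_add_cancel, phase_zero]⟩
    | .edge e => ⟨F (.edge e), F (.edge e), edge_sq e, edge_sq e⟩
    | .vert v => ⟨F (.vert v), F (.vert v), vert_sq v, vert_sq v⟩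
  have hU : ∀ g, ((U g : Rˣ) : R) = F g := by rintro (k | e | v) <;> rfl
  have h : ∀ r ∈ {w : FreeGroup (Gen G) | IsRelator G w}, FreeGroup.lift U r = 1 := by
    rintro r hr
    cases hr with
    | edge_sq e => simpa [letter, Units.ext_iff, hU] using edge_sq e
    | vert_sq v => simpa [letter, Units.ext_iff, hU] using vert_sq v
    | phase_mul k l =>
      simp only [letter, map_mul, map_inv, FreeGroup.lift_apply_of, mul_inv_eq_one, Units.ext_iff,
        Units.val_mul, hU, phase_mul]
    | phase_central k g =>
      simp only [letter, map_mul, map_inv, FreeGroup.lift_apply_of, mul_inv_eq_one, Units.ext_iff,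
        Units.val_mul, hU]
      exact phase_central k g
    | edge_symm e =>
      simp only [letter, map_mul, map_inv, FreeGroup.lift_apply_of, mul_inv_eq_one, Units.ext_iff,
        Units.val_mul, hU]
      exact edge_symm e
    | vert_comm_vert u v =>
      simp only [letter, map_mul, map_inv, FreeGroup.lift_apply_of, mul_inv_eq_one, Units.ext_iff,
        Units.val_mul, hU]
      exact vert_comm_vert u v
    | edge_comm_vert e v h₁ h₂ =>
      simp only [letter, map_mul, map_inv, FreeGroup.lift_apply_of, mul_inv_eq_one, Units.ext_iff,
        Units.val_mul, hU]
      exact edge_comm_vert e v h₁ h₂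
    | edge_comm_edge e f h₁ h₂ h₃ h₄ =>
      simp only [letter, map_mul, map_inv, FreeGroup.lift_apply_of, mul_inv_eq_one, Units.ext_iff,
        Units.val_mul, hU]
      exact edge_comm_edge e f h₁ h₂ h₃ h₄
    | edge_anticomm_vert e =>
      simp only [letter, map_mul, map_inv, FreeGroup.lift_apply_of, mul_inv_eq_one, Units.ext_iff,
        Units.val_mul, hU]
      exact edge_anticomm_vert e
    | edge_anticomm_edge e f h₁ h₂ =>
      simp only [letter, map_mul, map_inv, FreeGroup.lift_apply_of, mul_inv_eq_one, Units.ext_iff,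
        Units.val_mul, hU]
      exact edge_anticomm_edge e f h₁ h₂
  refine ⟨(Units.coeHom R).comp (PresentedGroup.toGroup h), fun g => ?_⟩
  rw [← hU g]
  exact congrArg Units.val (PresentedGroup.toGroup.of h)

/-! ### Relations in `M_G` and commutativity modulo phases -/

theorem mk_letter (g : Gen G) :
    PresentedGroup.mk {w : FreeGroup (Gen G) | IsRelator G w} (letter g) = gen g := rfl

theorem mk_eq_mk_of_isRelator {x y : FreeGroup (Gen G)} (h : IsRelator G (x * y⁻¹)) :
    PresentedGroup.mk {w : FreeGroup (Gen G) | IsRelator G w} x = PresentedGroup.mk _ y :=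
  PresentedGroup.mk_eq_mk_of_mul_inv_mem h

theorem gen_phase_mul (k l : ZMod 4) :
    (gen (.phase k) * gen (.phase l) : MG G) = gen (.phase (k + l)) := by
  simpa only [map_mul, mk_letter] using
    mk_eq_mk_of_isRelator (IsRelator.phase_mul (G := G) k l)

theorem gen_phase_zero : (gen (.phase 0) : MG G) = 1 := by
  have := gen_phase_mul (G := G) 0 0
  rwa [add_zero, mul_eq_left] at this

theorem gen_phase_comm_gen (k : ZMod 4) (g : Gen G) :
    gen (.phase k) * gen g = gen g * gen (.phase k) := by
  simpa only [map_mul, mk_letter] using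
    mk_eq_mk_of_isRelator (IsRelator.phase_central (G := G) k g)

theorem gen_edge_sq (e : G.Dart) : gen (.edge e) * gen (.edge e) = 1 := by
  simpa only [map_mul, mk_letter] using
    (PresentedGroup.one_of_mem (IsRelator.edge_sq e) :
      PresentedGroup.mk {w : FreeGroup (Gen G) | IsRelator G w} _ = 1)

theorem gen_edge_symm (e : G.Dart) :
    gen (.edge e) = gen (.phase 2) * gen (.edge e.symm) := by
  simpa only [map_mul, mk_letter] using
    mk_eq_mk_of_isRelator (IsRelator.edge_symm (G := G) e)

theorem gen_phase_comm (k : ZMod 4) (g : MG G) : gen (.phase k) * g = g * gen (.phase k) := by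
  have h : g ∈ Subgroup.centralizer {(gen (.phase k) : MG G)} :=
    PresentedGroup.generated_by _ _ (fun j => by
      rw [Subgroup.mem_centralizer_singleton_iff]
      exact (gen_phase_comm_gen k j).symm) g
  exact (Subgroup.mem_centralizer_singleton_iff.mp h).symm

variable (G) in
/-- The central subgroup of phases of `M_G`. -/
def phaseSubgroup : Subgroup (MG G) where
  carrier := {g | ∃ k, g = gen (.phase k)}
  mul_mem' := by
    rintro _ _ ⟨k, rfl⟩ ⟨l, rfl⟩
    exact ⟨k + l, gen_phase_mul k l⟩
  one_mem' := ⟨0, gen_phase_zero.symm⟩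
  inv_mem' := by
    rintro _ ⟨k, rfl⟩
    refine ⟨-k, inv_eq_of_mul_eq_one_right ?_⟩
    rw [gen_phase_mul, add_neg_cancel, gen_phase_zero]

instance : (phaseSubgroup G).Normal where
  conj_mem := by
    rintro _ ⟨k, rfl⟩ g
    exact ⟨k, by rw [← gen_phase_comm, mul_inv_cancel_right]⟩

variable (G) in
/-- The quotient of `M_G` by the phases. -/
abbrev PhaseQuotient : Type _ := MG G ⧸ phaseSubgroup G

theorem mk_eq_of_eq_phase_mul {g h : MG G} {k : ZMod 4} (e : g = gen (.phase k) * h) :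
    (g : PhaseQuotient G) = h := by
  have hk : gen (.phase k) ∈ phaseSubgroup G := ⟨k, rfl⟩
  rw [e, QuotientGroup.mk_mul, (QuotientGroup.eq_one_iff _).mpr hk, one_mul]

theorem mk_edge_symm (e : G.Dart) :
    ((gen (.edge e.symm) : MG G) : PhaseQuotient G) = (gen (.edge e) : MG G) :=
  (mk_eq_of_eq_phase_mul (gen_edge_symm e)).symm

/-- The relators only treat the head of a directed edge; the tail is handled by reversing the edge,
which changes it by a phase. -/
theorem mk_edge_comm_vert (e : G.Dart) (v : V) :
    ((gen (.edge e) * gen (.vert v) : MG G) : PhaseQuotient G) =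
      (gen (.vert v) * gen (.edge e) : MG G) := by
  have key : ∀ e : G.Dart, ((gen (.edge e) * gen (.vert e.snd) : MG G) : PhaseQuotient G) =
      (gen (.vert e.snd) * gen (.edge e) : MG G) := fun e =>
    mk_eq_of_eq_phase_mul (k := 2) (by
      simpa only [map_mul, mk_letter] using
        mk_eq_mk_of_isRelator (IsRelator.edge_anticomm_vert (G := G) e))
  by_cases h₂ : v = e.snd
  · subst h₂; exact key e
  by_cases h₁ : v = e.fst
  · have := key e.symm
    rw [QuotientGroup.mk_mul, QuotientGroup.mk_mul, mk_edge_symm] at this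
    rw [h₁]
    exact this
  · exact congrArg _ (by
      simpa only [map_mul, mk_letter] using
        mk_eq_mk_of_isRelator (IsRelator.edge_comm_vert (G := G) e v h₁ h₂))

/-- Reversing edges, which is invisible modulo phases, makes any common vertex a head-to-tail one.
There the relator applies, except for a pair of mutually reversed edges, which are equal modulo
phases. -/
theorem mk_edge_comm_edge (e f : G.Dart) :
    ((gen (.edge e) * gen (.edge f) : MG G) : PhaseQuotient G) =
      (gen (.edge f) * gen (.edge e) : MG G) := by
  have key : ∀ e f : G.Dart, e.snd = f.fst →
      ((gen (.edge e) * gen (.edge f) : MG G) : PhaseQuotient G) =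
        (gen (.edge f) * gen (.edge e) : MG G) := by
    intro e f h
    by_cases h' : e.fst = f.snd
    · have : e.symm = f := by ext <;> simp [h, h']
      rw [← this, QuotientGroup.mk_mul, QuotientGroup.mk_mul, mk_edge_symm]
    · exact mk_eq_of_eq_phase_mul (k := 2) (by
        simpa only [map_mul, mk_letter] using
          mk_eq_mk_of_isRelator (IsRelator.edge_anticomm_edge (G := G) e f h h'))
  by_cases h₁ : e.snd = f.fst
  · exact key e f h₁
  by_cases h₂ : e.snd = f.snd
  · simpa only [QuotientGroup.mk_mul, mk_edge_symm] using key e f.symm h₂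
  by_cases h₃ : e.fst = f.fst
  · simpa only [QuotientGroup.mk_mul, mk_edge_symm] using key e.symm f h₃
  by_cases h₄ : e.fst = f.snd
  · simpa only [QuotientGroup.mk_mul, mk_edge_symm] using key e.symm f.symm h₄
  · exact congrArg _ (by
      simpa only [map_mul, mk_letter] using
        mk_eq_mk_of_isRelator
          (IsRelator.edge_comm_edge (G := G) e f h₃ h₄ h₁ h₂))

theorem mk_gen_comm (g h : Gen G) :
    ((gen g * gen h : MG G) : PhaseQuotient G) = (gen h * gen g : MG G) := by
  rcases g with k | e | u
  · rw [gen_phase_comm]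
  · rcases h with l | f | v
    · rw [gen_phase_comm]
    · exact mk_edge_comm_edge e f
    · exact mk_edge_comm_vert e v
  · rcases h with l | f | v
    · rw [gen_phase_comm]
    · exact (mk_edge_comm_vert f u).symm
    · exact congrArg _ (by
        simpa only [map_mul, mk_letter] using
          mk_eq_mk_of_isRelator (IsRelator.vert_comm_vert (G := G) u v))

theorem mk_comm (g h : MG G) : (g : PhaseQuotient G) * h = h * g := by
  have key : ∀ (j : Gen G) (g : MG G),
      (g : PhaseQuotient G) * (gen j : MG G) = (gen j : MG G) * g := by
    intro j g
    have : g ∈ (Subgroup.centralizer {((gen j : MG G) : PhaseQuotient G)}).comap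
        (QuotientGroup.mk' _) :=
      PresentedGroup.generated_by _ _ (fun i => by
        rw [Subgroup.mem_comap, Subgroup.mem_centralizer_singleton_iff]
        exact mk_gen_comm i j) g
    exact Subgroup.mem_centralizer_singleton_iff.mp this
  have : h ∈ (Subgroup.centralizer {(g : PhaseQuotient G)}).comap (QuotientGroup.mk' _) :=
    PresentedGroup.generated_by _ _ (fun i => by
      rw [Subgroup.mem_comap, Subgroup.mem_centralizer_singleton_iff]
      exact (key i g).symm) h
  exact (Subgroup.mem_centralizer_singleton_iff.mp this).symm

instance : CommGroup (PhaseQuotient G) where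
  mul_comm a b := by
    induction a using QuotientGroup.induction_on
    induction b using QuotientGroup.induction_on
    exact mk_comm _ _

end GraphGroup

/-! ### A representation of `M_G` in which every cycle is trivial -/

section Majorana

/-- The Jordan–Wigner Majorana operators. -/
def majorana {N : ℕ} (j : Fin N) : QubitOp (Fin N) :=
  tensorOp fun k => if k < j then pauliZ else if k = j then pauliX else 1

/-- The operator `Z_j`. -/
def parityOp {N : ℕ} (j : Fin N) : QubitOp (Fin N) :=
  tensorOp fun k => if k = j then pauliZ else 1

variable {N : ℕ} {i j : Fin N}

theorem majorana_sq (j : Fin N) : majorana j * majorana j = 1 := by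
  rw [majorana, tensorOp_mul]
  refine tensorOp_eq_one fun q => ?_
  split_ifs <;> simp [pauliZ_sq, pauliX_sq]

theorem majorana_anticomm (h : i ≠ j) : majorana i * majorana j = -(majorana j * majorana i) := by
  have key : ∀ {i j : Fin N}, i < j → majorana i * majorana j = -(majorana j * majorana i) := by
    intro i j h
    refine tensorOp_anticommute i ?_ fun q hq => ?_
    · simp [h, pauliX_mul_pauliZ]
    · rcases lt_or_gt_of_ne hq with h' | h'
      · simp [h', h'.trans h]
      · simp [hq, not_lt_of_gt h']
  rcases lt_or_gt_of_ne h with h | h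
  · exact key h
  · rw [key h, neg_neg]

theorem parityOp_sq (j : Fin N) : parityOp j * parityOp j = 1 := by
  rw [parityOp, tensorOp_mul]
  refine tensorOp_eq_one fun q => ?_
  split_ifs <;> simp [pauliZ_sq]

theorem parityOp_comm (i j : Fin N) : parityOp i * parityOp j = parityOp j * parityOp i := by
  refine tensorOp_commute fun q => ?_
  split_ifs <;> simp

theorem majorana_comm_parityOp (h : i ≠ j) : majorana i * parityOp j = parityOp j * majorana i := by
  refine tensorOp_commute fun q => ?_
  by_cases h₁ : q = j
  · subst h₁
    by_cases h₂ : q < i <;> simp [h₂, h.symm]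
  · simp [h₁]

theorem majorana_anticomm_parityOp (j : Fin N) :
    majorana j * parityOp j = -(parityOp j * majorana j) := by
  refine tensorOp_anticommute j ?_ fun q hq => ?_
  · simp [pauliX_mul_pauliZ]
  · simp [hq]

end Majorana

/-! ### Sign rules for products of anticommuting elements and powers of the imaginary unit -/

theorem mul_mul_mul_comm_of_anticomm {R : Type*} [Ring R] {a b c d : R} (hac : a * c = -(c * a))
    (had : a * d = -(d * a)) (hbc : b * c = -(c * b)) (hbd : b * d = -(d * b)) :
    a * b * (c * d) = c * d * (a * b) := by
  calc a * b * (c * d) = a * (b * c) * d := by noncomm_ring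
    _ = -(a * c * (b * d)) := by rw [hbc]; noncomm_ring
    _ = -(c * (a * d) * b) := by rw [hac, hbd]; noncomm_ring
    _ = c * d * (a * b) := by rw [had]; noncomm_ring

theorem mul_mul_mul_anticomm {R : Type*} [Ring R] {a b c : R} (hab : a * b = -(b * a))
    (hac : a * c = -(c * a)) (hbc : b * c = -(c * b)) :
    a * b * (b * c) = -(b * c * (a * b)) := by
  calc a * b * (b * c) = -(b * (a * (b * c))) := by rw [hab]; noncomm_ring
    _ = b * (a * c) * b := by rw [hbc]; noncomm_ring
    _ = -(b * c * (a * b)) := by rw [hac]; noncomm_ring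

theorem I_pow_val_add (k l : ZMod 4) :
    Complex.I ^ k.val * Complex.I ^ l.val = Complex.I ^ (k + l).val := by
  rw [← pow_add, ZMod.val_add, ← Complex.I_pow_eq_pow_mod]

theorem I_pow_val_natCast (m : ℕ) : Complex.I ^ (m : ZMod 4).val = Complex.I ^ m := by
  rw [ZMod.val_natCast, ← Complex.I_pow_eq_pow_mod]

theorem I_pow_val_two : Complex.I ^ (2 : ZMod 4).val = -1 := by
  rw [show (2 : ZMod 4).val = 2 from rfl, Complex.I_sq]

theorem eq_zero_of_I_pow_val_eq_one {k : ZMod 4} (h : Complex.I ^ k.val = 1) : k = 0 := by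
  fin_cases k
  · rfl
  · have : Complex.I ^ 1 = 1 := h
    simp [Complex.ext_iff] at this
  · have : Complex.I ^ 2 = 1 := h
    norm_num [Complex.ext_iff] at this
  · have : Complex.I ^ 3 = 1 := h
    simp [Complex.ext_iff, Complex.I_pow_three] at this

section Cycles

variable {V : Type*} {G : SimpleGraph V}

/-- The assignment `e_{ij} ↦ -i γ_i γ_j`, `v_j ↦ Z_j` with Jordan–Wigner Majoranas `γ_j` satisfies
the relations. It keeps phases as scalars and trivialises cycles, so it detects that no nontrivial
phase is a product of cycles. -/
theorem exists_majorana_representation [Fintype V] :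
    ∃ (N : ℕ) (ρ : MG G →* QubitOp (Fin N)),
      (∀ k, ρ (gen (.phase k)) = (Complex.I ^ k.val) • 1) ∧
      ∀ (v : V) (w : G.Walk v v), ρ (cycleElement w) = 1 := by
  classical
  let φ := Fintype.equivFin V
  let F : Gen G → QubitOp (Fin (Fintype.card V)) := fun g => match g with
    | .phase k => (Complex.I ^ k.val) • 1
    | .edge e => (-Complex.I) • (majorana (φ e.fst) * majorana (φ e.snd))
    | .vert v => parityOp (φ v)
  have hφ : ∀ {u v : V}, u ≠ v → φ u ≠ φ v := fun h => φ.injective.ne h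
  have two : F (.phase 2) = -1 := by
    change Complex.I ^ (2 : ZMod 4).val • (1 : QubitOp _) = -1
    rw [I_pow_val_two]; simp
  have hII : (-Complex.I) * (-Complex.I) = -1 := by simp
  obtain ⟨ρ, hρ⟩ := exists_hom_of_relations F
    (by simp [F])
    (by intro k l; simp [F, smul_smul, mul_comm, ← I_pow_val_add])
    (by intro k g; simp [F])
    (by
      intro e
      have h := majorana_anticomm (hφ e.adj.ne')
      change ((-Complex.I) • (majorana (φ e.fst) * majorana (φ e.snd))) *
        ((-Complex.I) • (majorana (φ e.fst) * majorana (φ e.snd))) = 1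
      rw [smul_mul_smul_comm, hII, mul_assoc, ← mul_assoc (majorana (φ e.snd)), h]
      rw [neg_mul, mul_assoc, majorana_sq, mul_one, mul_neg, majorana_sq]
      simp)
    (fun v => parityOp_sq _)
    (by
      intro e
      rw [two]
      change (-Complex.I) • (majorana (φ e.fst) * majorana (φ e.snd)) =
        -1 * ((-Complex.I) • (majorana (φ e.snd) * majorana (φ e.fst)))
      rw [majorana_anticomm (hφ e.adj.ne)]
      simp)
    (fun u v => parityOp_comm _ _)
    (by
      intro e v h₁ h₂
      change ((-Complex.I) • (majorana (φ e.fst) * majorana (φ e.snd))) * parityOp (φ v) =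
        parityOp (φ v) * ((-Complex.I) • (majorana (φ e.fst) * majorana (φ e.snd)))
      rw [smul_mul_assoc, mul_smul_comm, mul_assoc, majorana_comm_parityOp (hφ h₂.symm),
        ← mul_assoc, majorana_comm_parityOp (hφ h₁.symm), mul_assoc])
    (by
      intro e f h₁ h₂ h₃ h₄
      change ((-Complex.I) • (majorana (φ e.fst) * majorana (φ e.snd))) *
        ((-Complex.I) • (majorana (φ f.fst) * majorana (φ f.snd))) =
        ((-Complex.I) • (majorana (φ f.fst) * majorana (φ f.snd))) *
        ((-Complex.I) • (majorana (φ e.fst) * majorana (φ e.snd)))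
      rw [smul_mul_smul_comm, smul_mul_smul_comm, mul_mul_mul_comm_of_anticomm
        (majorana_anticomm (hφ h₁)) (majorana_anticomm (hφ h₂)) (majorana_anticomm (hφ h₃))
        (majorana_anticomm (hφ h₄))])
    (by
      intro e
      rw [two]
      change ((-Complex.I) • (majorana (φ e.fst) * majorana (φ e.snd))) * parityOp (φ e.snd) =
        -1 * (parityOp (φ e.snd) * ((-Complex.I) • (majorana (φ e.fst) * majorana (φ e.snd))))
      rw [smul_mul_assoc, mul_smul_comm, mul_assoc, majorana_anticomm_parityOp, mul_neg,
        ← mul_assoc, majorana_comm_parityOp (hφ e.adj.ne), mul_assoc]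
      simp)
    (by
      intro e f h₁ h₂
      rw [two]
      change ((-Complex.I) • (majorana (φ e.fst) * majorana (φ e.snd))) *
        ((-Complex.I) • (majorana (φ f.fst) * majorana (φ f.snd))) =
        -1 * (((-Complex.I) • (majorana (φ f.fst) * majorana (φ f.snd))) *
        ((-Complex.I) • (majorana (φ e.fst) * majorana (φ e.snd))))
      have h₃ : e.fst ≠ f.fst := by rw [← h₁]; exact e.adj.ne
      rw [smul_mul_smul_comm, smul_mul_smul_comm, h₁, mul_mul_mul_anticomm
        (majorana_anticomm (hφ h₃)) (majorana_anticomm (hφ h₂)) (majorana_anticomm (hφ f.adj.ne))]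
      simp)
  refine ⟨_, ρ, fun k => hρ _, fun v w => ?_⟩
  -- The product along a walk telescopes by `γ_b ^ 2 = 1`. For a closed walk the two remaining
  -- Majoranas cancel and `(-i) ^ ℓ` is absorbed by the phase `i ^ ℓ` in `cycleElement`.
  have key : ∀ {u v : V} (w : G.Walk u v),
      (w.darts.map fun e => ρ (gen (.edge e))).prod =
        (-Complex.I) ^ w.length • (majorana (φ u) * majorana (φ v)) := by
    intro u v w
    induction w with
    | nil => simp [majorana_sq]
    | cons h p ih =>
      rename_i a b c
      rw [SimpleGraph.Walk.darts_cons, List.map_cons, List.prod_cons, ih, hρ]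
      change ((-Complex.I) • (majorana (φ a) * majorana (φ b))) * _ = _
      rw [smul_mul_smul_comm, mul_assoc, ← mul_assoc (majorana (φ b)), majorana_sq, one_mul,
        SimpleGraph.Walk.length_cons, pow_succ']
  rw [cycleElement, map_mul, map_list_prod, List.map_map]
  change _ * (w.darts.map fun e => ρ (gen (.edge e))).prod = 1
  rw [key, hρ, majorana_sq]
  change (Complex.I ^ (w.length : ZMod 4).val • (1 : QubitOp _)) * _ = 1
  rw [I_pow_val_natCast, smul_mul_smul_comm, one_mul, ← mul_pow]
  simp

/-! ### Edge vectors modulo two determine the elements of the cycle group -/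

variable {E : Type*}

variable (G E) in
/-- A labelling of the undirected edges of `G` by the elements of `E`. -/
structure EdgeLabelling where
  label : G.Dart → E
  surjective : Function.Surjective label
  eq_iff : ∀ e f, label e = label f ↔ f = e ∨ f = e.symm

theorem EdgeLabelling.label_symm (L : EdgeLabelling G E) (e : G.Dart) :
    L.label e.symm = L.label e :=
  ((L.eq_iff _ _).mpr (Or.inr rfl)).symm

theorem ofAdd_mul_self (z : E → ZMod 2) :
    Multiplicative.ofAdd z * Multiplicative.ofAdd z = 1 := by
  rw [← ofAdd_add, ← ofAdd_zero]
  congr 1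
  funext x
  exact CharTwo.add_self_eq_zero _

variable [DecidableEq E] (L : EdgeLabelling G E)

/-- With phases and vertices sent to `1`, every relator becomes trivial because the target is
abelian of exponent two. -/
theorem exists_edgeHom : ∃ π : MG G →* Multiplicative (E → ZMod 2),
    (∀ k, π (gen (.phase k)) = 1) ∧
      ∀ e, π (gen (.edge e)) = Multiplicative.ofAdd (Pi.single (L.label e) 1) := by
  let F : Gen G → Multiplicative (E → ZMod 2) := fun g => match g with
    | .phase _ => 1
    | .edge e => Multiplicative.ofAdd (Pi.single (L.label e) 1)
    | .vert _ => 1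
  obtain ⟨π, hπ⟩ := exists_hom_of_relations F rfl (fun _ _ => mul_one 1) (fun _ _ => mul_comm _ _)
    (fun _ => ofAdd_mul_self _) (fun _ => mul_one 1)
    (fun e => by simp [F, L.label_symm]) (fun _ _ => rfl) (fun _ _ _ _ => mul_comm _ _)
    (fun _ _ _ _ _ _ => mul_comm _ _) (fun _ => by simp [F])
    (fun _ _ _ _ => by simp only [F, one_mul]; exact mul_comm _ _)
  exact ⟨π, fun k => hπ _, fun e => hπ _⟩

/-- The homomorphism that counts, modulo two, how often each edge occurs. -/
def edgeHom : MG G →* Multiplicative (E → ZMod 2) := (exists_edgeHom L).choose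

theorem edgeHom_phase (k : ZMod 4) : edgeHom L (gen (.phase k)) = 1 :=
  (exists_edgeHom L).choose_spec.1 k

theorem edgeHom_edge (e : G.Dart) :
    edgeHom L (gen (.edge e)) = Multiplicative.ofAdd (Pi.single (L.label e) 1) :=
  (exists_edgeHom L).choose_spec.2 e

/-- Homomorphisms that agree on phases and edges agree on the cycle group. -/
theorem hom_eq_on_cycleGroup {R : Type*} [Group R] {α β : MG G →* R}
    (hp : ∀ k, α (gen (.phase k)) = β (gen (.phase k)))
    (he : ∀ e, α (gen (.edge e)) = β (gen (.edge e))) {c : MG G} (hc : c ∈ cycleGroup G) :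
    α c = β c := by
  have : cycleGroup G ≤ α.eqLocus β := by
    rw [cycleGroup, Subgroup.closure_le]
    rintro _ ⟨v, w, rfl⟩
    change α (cycleElement w) = β (cycleElement w)
    rw [cycleElement, map_mul, map_mul, hp, map_list_prod, map_list_prod, List.map_map,
      List.map_map]
    simp only [Function.comp_def, he]
  exact this hc

variable [Fintype E]

/-- A section of `edgeHom` modulo phases. -/
def edgeSection : Multiplicative (E → ZMod 2) →* PhaseQuotient G where
  toFun z := ∏ x, ((gen (.edge (Function.surjInv L.surjective x)) : MG G) : PhaseQuotient G) ^
    (Multiplicative.toAdd z x).val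
  map_one' := by simp
  map_mul' z z' := by
    rw [← Finset.prod_mul_distrib]
    refine Finset.prod_congr rfl fun x _ => ?_
    -- The exponents are the representatives `0, 1` of residues; additivity holds because an edge
    -- squares to `1`.
    have h2 : ((gen (.edge (Function.surjInv L.surjective x)) : MG G) : PhaseQuotient G) ^ 2 =
        1 := by
      rw [sq, ← QuotientGroup.mk_mul, gen_edge_sq, QuotientGroup.mk_one]
    rw [← pow_add, toAdd_mul, Pi.add_apply, ZMod.val_add, ← pow_mod_orderOf,
      ← pow_mod_orderOf _ (_ + _), Nat.mod_mod_of_dvd _ (orderOf_dvd_of_pow_eq_one h2)]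

theorem edgeSection_edge (e : G.Dart) :
    edgeSection L (Multiplicative.ofAdd (Pi.single (L.label e) 1)) = (gen (.edge e) : MG G) := by
  change ∏ x, _ ^ (Pi.single (M := fun _ => ZMod 2) (L.label e) 1 x).val = _
  rw [Finset.prod_eq_single (L.label e)]
  · rw [Pi.single_eq_same, show (1 : ZMod 2).val = 1 from rfl, pow_one]
    rcases (L.eq_iff e _).mp (Function.surjInv_eq L.surjective (L.label e)).symm with h | h
    · rw [h]
    · rw [h, mk_edge_symm]
  · intro x _ hx
    rw [Pi.single_eq_of_ne hx]
    simp
  · simp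

/-- A cycle element is determined by the edges that occur an odd number of times. -/
theorem eq_one_of_edgeHom_eq_one [Fintype V] {c : MG G} (hc : c ∈ cycleGroup G)
    (h : edgeHom L c = 1) : c = 1 := by
  -- Cycle elements are words in phases and edges only, and on those the section recovers the class
  -- modulo phases. A trivial edge vector thus makes `c` a phase.
  have hs : (edgeSection L).comp (edgeHom L) c = QuotientGroup.mk' (phaseSubgroup G) c := by
    refine hom_eq_on_cycleGroup (fun k => ?_) (fun e => ?_) hc
    · rw [MonoidHom.comp_apply, edgeHom_phase, map_one]
      have hk : gen (.phase k) ∈ phaseSubgroup G := ⟨k, rfl⟩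
      exact ((QuotientGroup.eq_one_iff _).mpr hk).symm
    · rw [MonoidHom.comp_apply, edgeHom_edge, edgeSection_edge]; rfl
  rw [MonoidHom.comp_apply, h, map_one] at hs
  obtain ⟨k, rfl⟩ := (QuotientGroup.eq_one_iff _).mp hs.symm
  obtain ⟨N, ρ, hρ, hcyc⟩ := exists_majorana_representation (G := G)
  -- The Majorana representation maps `c` to `1` as a product of cycles, and to the scalar `i ^ k`
  -- as a phase; so `k = 0`.
  have hker : cycleGroup G ≤ ρ.toHomUnits.ker := by
    rw [cycleGroup, Subgroup.closure_le]
    rintro _ ⟨v, w, rfl⟩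
    exact Units.ext (hcyc v w)
  have h1 : ρ (gen (.phase k)) = 1 := congrArg Units.val (MonoidHom.mem_ker.mp (hker hc))
  rw [hρ] at h1
  have h2 := congrFun (congrFun h1 0) 0
  rw [Matrix.smul_apply, Matrix.one_apply_eq, smul_eq_mul, mul_one] at h2
  rw [eq_zero_of_I_pow_val_eq_one h2, gen_phase_zero]

/-- This turns questions about subgroups of the cycle group into linear algebra over `ZMod 2`. -/
theorem edgeHom_injOn [Fintype V] : Set.InjOn (edgeHom L) (cycleGroup G) := by
  intro c hc d hd h
  have := eq_one_of_edgeHom_eq_one L (mul_mem hc (inv_mem hd))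
    (by rw [map_mul, map_inv, h, mul_inv_cancel])
  exact mul_inv_eq_one.mp this

end Cycles

/-! ### The cycle space -/

section CycleSpace

variable {V : Type*} {G : SimpleGraph V} {E : Type*} [DecidableEq E] (L : EdgeLabelling G E)

/-- The edges of a walk, counted modulo two. -/
def edgeVec {u v : V} (w : G.Walk u v) : E → ZMod 2 :=
  (w.darts.map fun e => Pi.single (M := fun _ => ZMod 2) (L.label e) 1).sum

theorem fun_add_self {X : Type*} (f : X → ZMod 2) : f + f = 0 :=
  funext fun _ => CharTwo.add_self_eq_zero _

theorem edgeVec_cons {u v w : V} (h : G.Adj u v) (p : G.Walk v w) :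
    edgeVec L (SimpleGraph.Walk.cons h p) =
      Pi.single (L.label ⟨(u, v), h⟩) 1 + edgeVec L p := by
  simp [edgeVec]

theorem edgeVec_append {u v w : V} (p : G.Walk u v) (q : G.Walk v w) :
    edgeVec L (p.append q) = edgeVec L p + edgeVec L q := by
  simp [edgeVec, SimpleGraph.Walk.darts_append]

theorem edgeVec_reverse {u v : V} (p : G.Walk u v) : edgeVec L p.reverse = edgeVec L p := by
  simp [edgeVec, SimpleGraph.Walk.darts_reverse, Function.comp_def, L.label_symm, List.sum_reverse]

theorem edgeHom_cycleElement {v : V} (w : G.Walk v v) :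
    edgeHom L (cycleElement w) = Multiplicative.ofAdd (edgeVec L w) := by
  rw [cycleElement, map_mul, edgeHom_phase, one_mul, map_list_prod, edgeVec, ofAdd_list_prod,
    List.map_map, List.map_map]
  simp only [Function.comp_def, edgeHom_edge]

/-- The subspace of `E → ZMod 2` that corresponds to a subgroup of `M_G`. -/
def edgeSpace (H : Subgroup (MG G)) : Submodule (ZMod 2) (E → ZMod 2) :=
  AddSubgroup.toZModSubmodule 2 (Subgroup.toAddSubgroup' (H.map (edgeHom L)))

theorem mem_edgeSpace {H : Subgroup (MG G)} {z : E → ZMod 2} :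
    z ∈ edgeSpace L H ↔ ∃ c ∈ H, edgeHom L c = Multiplicative.ofAdd z := Iff.rfl

/-- The linear map that sends a vertex `v` to the walk `p v` from the root to `v`. -/
def spread [Fintype V] {r : V} (p : ∀ v, G.Walk r v) : (V → ZMod 2) →ₗ[ZMod 2] (E → ZMod 2) :=
  Fintype.linearCombination (ZMod 2) fun v => edgeVec L (p v)

theorem spread_single [Fintype V] [DecidableEq V] {r : V} (p : ∀ v, G.Walk r v) (v : V) :
    spread L p (Pi.single v 1) = edgeVec L (p v) := by
  rw [spread, Fintype.linearCombination_apply_single, one_smul]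

variable [Fintype E]

theorem card_subgroup_eq_card_edgeSpace [Fintype V] {H : Subgroup (MG G)} (hH : H ≤ cycleGroup G) :
    Nat.card H = Nat.card (edgeSpace L H) := by
  refine Nat.card_congr (Equiv.ofBijective
    (fun c => ⟨Multiplicative.toAdd (edgeHom L c.1), c.1, c.2, rfl⟩) ⟨?_, ?_⟩)
  · intro c d h
    exact Subtype.ext (edgeHom_injOn L (hH c.2) (hH d.2) (congrArg Subtype.val h))
  · rintro ⟨z, c, hc, h⟩
    exact ⟨⟨c, hc⟩, Subtype.ext h⟩

theorem mul_self_eq_one_of_mem_cycleGroup [Fintype V] (L : EdgeLabelling G E) {c : MG G}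
    (hc : c ∈ cycleGroup G) :
    c * c = 1 :=
  eq_one_of_edgeHom_eq_one L (mul_mem hc hc) (by
    rw [map_mul]; exact ofAdd_mul_self (Multiplicative.toAdd (edgeHom L c)))

variable [DecidableEq V]

/-- The boundary map modulo two. -/
def boundary : (E → ZMod 2) →ₗ[ZMod 2] (V → ZMod 2) :=
  Fintype.linearCombination (ZMod 2) fun x =>
    Pi.single (Function.surjInv L.surjective x).fst 1 +
      Pi.single (Function.surjInv L.surjective x).snd 1

theorem boundary_single (e : G.Dart) :
    boundary L (Pi.single (L.label e) 1) = Pi.single e.fst 1 + Pi.single e.snd 1 := by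
  rw [boundary, Fintype.linearCombination_apply_single, one_smul]
  rcases (L.eq_iff e _).mp (Function.surjInv_eq L.surjective (L.label e)).symm with h | h
  · rw [h]
  · rw [h, add_comm]; rfl

theorem boundary_edgeVec {u v : V} (w : G.Walk u v) :
    boundary L (edgeVec L w) = Pi.single u 1 + Pi.single v 1 := by
  induction w with
  | nil => simp [edgeVec, fun_add_self]
  | cons h p ih =>
    rename_i a b c
    rw [edgeVec_cons, map_add, boundary_single, ih]
    change Pi.single a 1 + Pi.single b 1 + _ = _
    rw [add_assoc, ← add_assoc (Pi.single b 1), fun_add_self, zero_add]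

variable [Fintype V]

/-- Fix walks from a root to all vertices. Each edge closes up along them to a loop whose vector is
the edge plus the `spread` of its boundary. By linearity `z + spread (∂z)` comes from a cycle
element for every `z`, and this is `z` itself when `∂z = 0`. -/
theorem edgeSpace_cycleGroup (hG : G.Connected) :
    edgeSpace L (cycleGroup G) = LinearMap.ker (boundary L) := by
  apply le_antisymm
  · rintro z ⟨c, hc, hz⟩
    have : cycleGroup G ≤ (Subgroup.comap (edgeHom L)
        (AddSubgroup.toSubgroup (LinearMap.ker (boundary L)).toAddSubgroup)) := by
      rw [cycleGroup, Subgroup.closure_le]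
      rintro _ ⟨v, w, rfl⟩
      rw [SetLike.mem_coe, Subgroup.mem_comap, edgeHom_cycleElement]
      change boundary L (edgeVec L w) = 0
      rw [boundary_edgeVec, fun_add_self]
    have h := this hc
    rw [Subgroup.mem_comap, hz] at h
    exact h
  · intro z hz
    obtain ⟨r⟩ := hG.nonempty
    let p : ∀ v, G.Walk r v := fun v => (hG.preconnected r v).some
    have key : ∀ z, z + spread L p (boundary L z) ∈ edgeSpace L (cycleGroup G) := by
      intro z
      have : z + spread L p (boundary L z) =
          ∑ x, z x • (Pi.single (M := fun _ => ZMod 2) x 1 +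
            spread L p (boundary L (Pi.single x 1))) := by
        simp only [smul_add, Finset.sum_add_distrib, ← map_smul, ← map_sum]
        have hz : ∑ x, z x • Pi.single (M := fun _ => ZMod 2) x 1 = z := by
          simpa using (pi_eq_sum_univ' z).symm
        rw [hz]
      rw [this]
      refine Submodule.sum_mem _ fun x _ => Submodule.smul_mem _ _ ?_
      obtain ⟨e, rfl⟩ := L.surjective x
      rw [boundary_single, map_add, spread_single, spread_single]
      refine (mem_edgeSpace L).mpr ⟨cycleElement ((p e.fst).append
        (SimpleGraph.Walk.cons e.adj (p e.snd).reverse)), Subgroup.subset_closure ⟨_, _, rfl⟩, ?_⟩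
      rw [edgeHom_cycleElement, edgeVec_append, edgeVec_cons, edgeVec_reverse, add_left_comm]
    have := key z
    rwa [LinearMap.mem_ker.mp hz, map_zero, add_zero] at this

/-- The walk from the root `r` to `v` has boundary `r + v`, so the boundary of `spread f` is `f`
plus `(∑ f) r`, that is `f` when the coefficients sum to zero. -/
theorem range_boundary (hG : G.Connected) :
    LinearMap.range (boundary L) =
      LinearMap.ker (Fintype.linearCombination (ZMod 2) fun _ : V => (1 : ZMod 2)) := by
  apply le_antisymm
  · rintro _ ⟨z, rfl⟩
    rw [LinearMap.mem_ker, ← LinearMap.comp_apply]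
    have : (Fintype.linearCombination (ZMod 2) fun _ : V => (1 : ZMod 2)).comp (boundary L) =
        0 := by
      refine LinearMap.pi_ext' fun x => LinearMap.ext_ring ?_
      obtain ⟨e, rfl⟩ := L.surjective x
      simp only [LinearMap.comp_apply, LinearMap.single_apply, boundary_single, map_add,
        Fintype.linearCombination_apply_single, LinearMap.zero_apply]
      exact CharTwo.add_self_eq_zero _
    rw [this, LinearMap.zero_apply]
  · intro f hf
    obtain ⟨r⟩ := hG.nonempty
    let p : ∀ v, G.Walk r v := fun v => (hG.preconnected r v).some
    refine ⟨spread L p f, ?_⟩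
    rw [spread, Fintype.linearCombination_apply, map_sum]
    simp only [map_smul, boundary_edgeVec, smul_add, Finset.sum_add_distrib, ← Finset.sum_smul]
    have hf' : ∑ v, f v = 0 := by
      simpa [Fintype.linearCombination_apply] using hf
    rw [hf', zero_smul, zero_add]
    simpa using (pi_eq_sum_univ' f).symm

theorem finrank_ker_boundary (hG : G.Connected) :
    Module.finrank (ZMod 2) (LinearMap.ker (boundary L)) + Fintype.card V = Fintype.card E + 1 := by
  have h₁ := LinearMap.finrank_range_add_finrank_ker (boundary L)
  have h₂ := LinearMap.finrank_range_add_finrank_ker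
    (Fintype.linearCombination (ZMod 2) fun _ : V => (1 : ZMod 2))
  have h₃ : LinearMap.range (Fintype.linearCombination (ZMod 2) fun _ : V => (1 : ZMod 2)) = ⊤ := by
    rw [LinearMap.range_eq_top]
    obtain ⟨r⟩ := hG.nonempty
    intro a
    exact ⟨Pi.single r a, by simp [Fintype.linearCombination_apply_single]⟩
  rw [h₃, ← range_boundary L hG, finrank_top, Module.finrank_self,
    Module.finrank_fintype_fun_eq_card] at h₂
  rw [Module.finrank_fintype_fun_eq_card] at h₁
  omega

theorem card_cycleGroup (L : EdgeLabelling G E) (hG : G.Connected) :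
    ∃ k, Nat.card (cycleGroup G) = 2 ^ k ∧ k + Fintype.card V = Fintype.card E + 1 := by
  refine ⟨_, ?_, finrank_ker_boundary L hG⟩
  rw [card_subgroup_eq_card_edgeSpace L le_rfl, edgeSpace_cycleGroup L hG,
    Module.natCard_eq_pow_finrank (K := ZMod 2), Nat.card_zmod]

end CycleSpace

/-! ### Generators of elementary abelian 2-groups -/

/-- A group of exponent two is a vector space over `ZMod 2` in which generating sets are spanning
sets, so the least number of generators is the dimension. -/
theorem minGenerators_of_card_eq {X : Type*} [Group X] (h : ∀ x : X, x * x = 1) {k : ℕ}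
    (hk : Nat.card X = 2 ^ k) : minGenerators X = k := by
  classical
  let _ : CommGroup X :=
    { (inferInstance : Group X) with
      mul_comm := fun a b => by
        have ha : a⁻¹ = a := inv_eq_of_mul_eq_one_right (h a)
        have hb : b⁻¹ = b := inv_eq_of_mul_eq_one_right (h b)
        have hab : (a * b)⁻¹ = a * b := inv_eq_of_mul_eq_one_right (h _)
        rw [← hab, mul_inv_rev, ha, hb] }
  have : Finite X := Nat.finite_of_card_ne_zero (by rw [hk]; positivity)
  let _ : Module (ZMod 2) (Additive X) := AddCommGroup.zmodModule (n := 2) fun x => by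
    rw [two_nsmul]; exact h (Additive.toMul x)
  have : Module.Finite (ZMod 2) (Additive X) := Module.Finite.of_finite
  have hfin : Module.finrank (ZMod 2) (Additive X) = k := by
    have h1 := Module.natCard_eq_pow_finrank (K := ZMod 2) (V := Additive X)
    rw [Nat.card_zmod] at h1
    exact Nat.pow_right_injective le_rfl (h1.symm.trans hk)
  apply le_antisymm
  · apply Nat.sInf_le
    let b := Module.finBasis (ZMod 2) (Additive X)
    let s : Finset X := Finset.univ.image fun i => Additive.toMul (b i)
    refine ⟨s, ?_, ?_⟩
    · have hle : Submodule.span (ZMod 2) (Set.range b) ≤ AddSubgroup.toZModSubmodule 2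
          (Subgroup.toAddSubgroup (Subgroup.closure (s : Set X))) := by
        rw [Submodule.span_le]
        rintro _ ⟨i, rfl⟩
        have hi : Additive.toMul (b i) ∈ (s : Set X) := by simp [s]
        exact (Subgroup.subset_closure hi : Additive.toMul (b i) ∈ Subgroup.closure (s : Set X))
      rw [b.span_eq] at hle
      exact eq_top_iff.mpr fun x _ => hle (Submodule.mem_top (x := Additive.ofMul x))
    · change (Finset.univ.image (Additive.toMul ∘ b)).card = k
      rw [Finset.card_image_of_injective _ (Additive.toMul.injective.comp b.injective),
        Finset.card_univ, Fintype.card_fin, hfin]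
  -- The lower bound on the infimum needs some finite generating set; the whole group serves.
  · refine le_csInf ⟨_, (Set.toFinite (Set.univ : Set X)).toFinset, ?_, rfl⟩ ?_
    · simp
    · rintro m ⟨s, hs, rfl⟩
      let t : Finset (Additive X) := s.image Additive.ofMul
      have hle : Subgroup.closure (s : Set X) ≤
          AddSubgroup.toSubgroup'
            (Submodule.span (ZMod 2) (t : Set (Additive X))).toAddSubgroup := by
        rw [Subgroup.closure_le]
        intro x hx
        have hi : Additive.ofMul x ∈ (t : Set (Additive X)) := by simpa [t] using hx
        exact (Submodule.subset_span hi : Additive.ofMul x ∈ Submodule.span (ZMod 2) _)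
      rw [hs] at hle
      have htop : Submodule.span (ZMod 2) (t : Set (Additive X)) = ⊤ :=
        eq_top_iff.mpr fun x _ => hle (Subgroup.mem_top (Additive.toMul x))
      have hcard := finrank_span_finset_le_card (R := ZMod 2) t
      rw [Set.finrank, htop, finrank_top, hfin] at hcard
      exact hcard.trans Finset.card_image_le

/-! ### Geometry of the box -/

section Box

variable {n : Fin 3 → ℕ} {o : Vertex n → Vertex n → Prop} {d a b : Fin 3} {u v w : Vertex n}

theorem exists_third_axis : ∀ {a b : Fin 3}, a ≠ b →
    ∃ k, k ≠ a ∧ k ≠ b ∧ ∀ d, d = a ∨ d = b ∨ d = k := by decide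

theorem exists_other_axes : ∀ k : Fin 3, ∃ a b, a ≠ b ∧ k ≠ a ∧ k ≠ b ∧
    ∀ d, d = a ∨ d = b ∨ d = k := by decide

/-- The sum of the coordinates of a vertex. -/
def coordSum (v : Vertex n) : ℕ := ∑ d, (v d).val

theorem vertex_ext (h : ∀ d, (u d).val = (v d).val) : u = v := funext fun d => Fin.ext (h d)

theorem IsStep.val_eq (h : IsStep d u v) {k : Fin 3} (hk : k ≠ d) : (v k).val = (u k).val := by
  rw [h.2 k hk]

theorem IsStep.val_add_one (h : IsStep d u v) : (v d).val = (u d).val + 1 := h.1.symm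

theorem IsStep.lt (h : IsStep d u v) : (u d).val + 1 < n d := by
  rw [h.1]; exact (v d).isLt

theorem coordSum_eq_of_axes {k : Fin 3} (hab : a ≠ b) (ha : k ≠ a) (hb : k ≠ b) (v : Vertex n) :
    coordSum v = (v a).val + (v b).val + (v k).val := by
  rw [coordSum, Fin.sum_univ_three]
  fin_cases a <;> fin_cases b <;> fin_cases k <;> simp_all <;> omega

theorem IsStep.coordSum_eq (h : IsStep d u v) : coordSum v = coordSum u + 1 := by
  obtain ⟨a, b, hab, ha, hb, -⟩ := exists_other_axes d
  rw [coordSum_eq_of_axes hab ha hb, coordSum_eq_of_axes hab ha hb, h.val_add_one,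
    h.val_eq ha.symm, h.val_eq hb.symm]
  omega

theorem IsStep.adj (h : IsStep d u v) : (lattice n).Adj u v := ⟨d, Or.inl h⟩

/-- The neighbour of `u` in the positive direction of the axis `d`. -/
def shift (u : Vertex n) (d : Fin 3) (h : (u d).val + 1 < n d) : Vertex n :=
  Function.update u d ⟨(u d).val + 1, h⟩

theorem isStep_shift (u : Vertex n) (d : Fin 3) (h : (u d).val + 1 < n d) :
    IsStep d u (shift u d h) :=
  ⟨by simp [shift], fun k hk => by simp [shift, hk]⟩

theorem exists_isStep (h : (u d).val + 1 < n d) : ∃ v, IsStep d u v := ⟨_, isStep_shift u d h⟩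

theorem exists_isStep_of_pos (h : 0 < (v d).val) : ∃ u, IsStep d u v := by
  refine ⟨Function.update v d ⟨(v d).val - 1, by omega⟩, ?_, fun k hk => by simp [hk]⟩
  simp; omega

theorem IsStep.eq_of_left {v' : Vertex n} (h : IsStep d u v) (h' : IsStep d u v') : v = v' :=
  vertex_ext fun k => by
    by_cases hk : k = d
    · subst hk; rw [h.val_add_one, h'.val_add_one]
    · rw [h.val_eq hk, h'.val_eq hk]

theorem IsStep.axis_eq {d' : Fin 3} (h : IsStep d u v) (h' : IsStep d' u v) : d = d' := by
  by_contra hne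
  have := h.val_add_one
  have := h'.val_eq hne
  omega

theorem edgeAxis_comm (u v : Vertex n) : edgeAxis u v = edgeAxis v u := by
  simp only [edgeAxis, ne_comm]

theorem IsStep.edgeAxis_eq (h : IsStep d u v) : edgeAxis u v = d := by
  have h1 : u d ≠ v d := fun e => by have := h.1; rw [e] at this; omega
  have h2 := h.2
  fin_cases d
  · simp_all [edgeAxis]
  · simp_all [edgeAxis, h2 0 (by decide)]
  · simp_all [edgeAxis, h2 0 (by decide), h2 1 (by decide)]

/-- Opposite steps of a square. -/
theorem IsStep.of_square {u' v' : Vertex n} (h : IsStep a u v) (hu : IsStep b u u')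
    (hv : IsStep b v v') (hab : a ≠ b) : IsStep a u' v' := by
  refine ⟨?_, fun k hk => Fin.ext ?_⟩
  · have := h.val_add_one
    have := hu.val_eq hab
    have := hv.val_eq hab
    omega
  · have := h.val_eq hk
    by_cases hkb : k = b
    · subst hkb
      have := hu.val_add_one
      have := hv.val_add_one
      omega
    · have := hu.val_eq hkb
      have := hv.val_eq hkb
      omega

theorem IsStep.of_square_back {u' v' : Vertex n} (h : IsStep a u v) (hu : IsStep b u' u)
    (hv : IsStep b v' v) (hab : a ≠ b) : IsStep a u' v' := by
  refine ⟨?_, fun k hk => Fin.ext ?_⟩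
  · have := h.val_add_one
    have := hu.val_eq hab
    have := hv.val_eq hab
    omega
  · have := h.val_eq hk
    by_cases hkb : k = b
    · subst hkb
      have := hu.val_add_one
      have := hv.val_add_one
      omega
    · have := hu.val_eq hkb
      have := hv.val_eq hkb
      omega

theorem IsStep.exists_square {u' : Vertex n} (h : IsStep a u v) (hu : IsStep b u u')
    (hab : a ≠ b) : ∃ v', IsStep b v v' ∧ IsStep a u' v' := by
  obtain ⟨v', hv'⟩ := exists_isStep (n := n) (u := v) (d := b)
    (by rw [h.val_eq hab.symm]; exact hu.lt)
  exact ⟨v', hv', h.of_square hu hv' hab⟩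

theorem Face.base_mem_verts (f : Face n) : f.base ∈ f.verts :=
  ⟨rfl, fun _ _ => Or.inl rfl⟩

theorem Face.lt (f : Face n) (h : d ≠ f.normal) : (f.base d).val + 1 < n d := f.2 d h

theorem Face.mem_verts_of_isStep {f : Face n} (h : IsStep d u v) (hd : d ≠ f.normal)
    (hu : u ∈ f.verts) (hb : (u d).val = (f.base d).val) : v ∈ f.verts := by
  refine ⟨Fin.ext ?_, fun k hk => ?_⟩
  · rw [h.val_eq hd.symm, hu.1]
  · by_cases hkd : k = d
    · subst hkd
      right; rw [h.val_add_one, hb]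
    · rw [h.val_eq hkd]; exact hu.2 k hk

/-! ### The orientation is determined by the types of the edges -/

theorem IsOrientation.not_iff (ho : IsOrientation o) (h : (lattice n).Adj u v) :
    ¬ o u v ↔ o v u := by
  have := ho.xor u v h
  tauto

/-- Opposite edges of a face point in opposite directions. -/
theorem IsCompactOrientation.flip (ho : IsCompactOrientation o) (hab : a ≠ b) {u' v' : Vertex n}
    (h : IsStep a u v) (hu : IsStep b u u') (hv : IsStep b v v') : o u v ↔ ¬ o u' v' := by
  have h' := h.of_square hu hv hab
  obtain ⟨k, hka, hkb, hk⟩ := exists_third_axis hab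
  let f : Face n := ⟨(k, u), fun d hd => by
    rcases hk d with rfl | rfl | rfl
    · exact h.lt
    · exact hu.lt
    · exact absurd rfl hd⟩
  have mu : u ∈ f.verts := f.base_mem_verts
  have mv : v ∈ f.verts := Face.mem_verts_of_isStep h hka.symm mu rfl
  have mu' : u' ∈ f.verts := Face.mem_verts_of_isStep hu hkb.symm mu rfl
  have mv' : v' ∈ f.verts := Face.mem_verts_of_isStep hv hkb.symm mv (h.val_eq hab.symm)
  have ne₁ : u ≠ v' := by
    rintro rfl
    have := h'.val_add_one
    have := hu.val_eq hab
    omega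
  have ne₂ : u' ≠ v := by
    rintro rfl
    have := h.val_add_one
    have := hu.val_eq hab
    omega
  -- Go around the square `u, v, v', u'`. An even face keeps the sense of circulation at the corners
  -- `v` and `v'`, an odd face reverses it at both; either way `o u v` is equivalent to `o v' u'`.
  rcases ho.even_or_odd f with hf | hf
  · have e₁ := hf u v v' mu mv mv' h.adj hv.adj ne₁
    have e₂ := hf v v' u' mv mv' mu' hv.adj h'.adj.symm ne₂.symm
    rw [ho.not_iff h'.adj, e₁, e₂]
  · have e₁ := hf u v v' mu mv mv' h.adj hv.adj ne₁
    have e₂ := hf v v' u' mv mv' mu' hv.adj h'.adj.symm ne₂.symm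
    rw [e₁, ← e₂, ho.not_iff hv.adj]

/-- Whether a face is odd can be read off at its base vertex. -/
theorem IsCompactOrientation.isOddFace_iff_base (ho : IsCompactOrientation o) (f : Face n)
    {a b : Fin 3} (hab : a ≠ b) (ha : a ≠ f.normal) (hb : b ≠ f.normal) {v w : Vertex n}
    (hv : IsStep a f.base v) (hw : IsStep b f.base w) :
    IsOddFace o f ↔ (o f.base v ↔ o f.base w) := by
  have mu := f.base_mem_verts
  have mv : v ∈ f.verts := Face.mem_verts_of_isStep hv ha mu rfl
  have mw : w ∈ f.verts := Face.mem_verts_of_isStep hw hb mu rfl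
  have ne : v ≠ w := by
    rintro rfl
    exact hab (hv.axis_eq hw)
  have xv := ho.xor _ _ hv.adj
  have xw := ho.xor _ _ hw.adj
  constructor
  · intro hf
    have := hf v f.base w mv mu mw hv.adj.symm hw.adj ne
    tauto
  · intro h
    refine (ho.even_or_odd f).resolve_left fun hf => ?_
    have := hf v f.base w mv mu mw hv.adj.symm hw.adj ne
    tauto

/-- Consecutive edges on a line point in the same direction. -/
theorem IsCompactOrientation.straight (ho : IsCompactOrientation o) (hn : ∀ d, 2 ≤ n d)
    (huv : IsStep d u v) (hvw : IsStep d v w) : o u v ↔ o v w := by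
  obtain ⟨b, k, hbk, hdb, hdk, hk⟩ := exists_other_axes d
  -- The neighbouring faces based at `u` and `v` have different parities by the checkerboard
  -- condition, and the edges `u u'` and `v v'` are opposite; both reversals cancel.
  have key : ∀ {u v w u' : Vertex n}, IsStep d u v → IsStep d v w → IsStep b u u' →
      (o u v ↔ o v w) := by
    intro u v w u' huv hvw huu'
    obtain ⟨v', hvv', huv'⟩ := huv.exists_square huu' hdb
    obtain ⟨w', hww', hvw'⟩ := hvw.exists_square hvv' hdb
    let f : Face n := ⟨(k, u), fun x hx => by
      rcases hk x with rfl | rfl | rfl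
      · exact huu'.lt
      · exact absurd rfl hx
      · exact huv.lt⟩
    let g : Face n := ⟨(k, v), fun x hx => by
      rcases hk x with rfl | rfl | rfl
      · exact hvv'.lt
      · exact absurd rfl hx
      · exact hvw.lt⟩
    have h₁ := ho.isOddFace_iff_base f hdb hdk hbk huv huu'
    have h₂ := ho.isOddFace_iff_base g hdb hdk hbk hvw hvv'
    have h₃ := ho.checkerboard f g d rfl hdk huv
    have h₄ := ho.flip hdb.symm huu' huv huv'
    change IsOddFace o f ↔ (o u v ↔ o u u') at h₁
    change IsOddFace o g ↔ (o v w ↔ o v v') at h₂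
    tauto
  by_cases hb : (u b).val + 1 < n b
  · obtain ⟨u', hu'⟩ := exists_isStep hb
    exact key huv hvw hu'
  -- At the upper boundary of the axis `b` the line is moved one step down, which reverses both
  -- edges by `flip`.
  · have := hn b
    have hlt := (u b).isLt
    obtain ⟨u', hu'⟩ := exists_isStep_of_pos (n := n) (v := u) (d := b) (by omega)
    obtain ⟨v', hv'⟩ := exists_isStep_of_pos (n := n) (v := v) (d := b)
      (by rw [huv.val_eq hdb.symm]; omega)
    obtain ⟨w', hw'⟩ := exists_isStep_of_pos (n := n) (v := w) (d := b)
      (by rw [hvw.val_eq hdb.symm, huv.val_eq hdb.symm]; omega)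
    have huv' := huv.of_square_back hu' hv' hdb
    have hvw' := hvw.of_square_back hv' hw' hdb
    have h₁ := key huv' hvw' hu'
    have h₂ := ho.flip hdb huv' hu' hv'
    have h₃ := ho.flip hdb hvw' hv' hw'
    tauto

/-- The types of the edges: an edge along the axis `d` whose lower end has the coordinate `x` on
that axis has the type `(x + c d) % 2`. -/
def edgeType (c : Fin 3 → ℕ) (d : Fin 3) (x : ℕ) : ℕ := (x + c d) % 2

/-- The orientation `o` is given by the types of the edges: at a vertex `v`, the edges of one type
point away from `v`, and those of the other type point to `v`. -/
def IsTypedBy (o : Vertex n → Vertex n → Prop) (c : Fin 3 → ℕ) : Prop :=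
  ∀ d u v, IsStep d u v → (o u v ↔ edgeType c d (u d).val ≠ coordSum u % 2)

/-- The constants `c d` are read off the three edges at the lowest corner of the box. Induction on
the coordinate sum propagates the formula: a step along the edge's own axis changes both type and
parity and keeps the direction, a step across it changes only the parity and reverses the direction.
-/
theorem IsCompactOrientation.exists_isTypedBy (ho : IsCompactOrientation o)
    (hn : ∀ d, 2 ≤ n d) : ∃ c, IsTypedBy o c := by
  classical
  let z : Vertex n := fun d => ⟨0, by have := hn d; omega⟩
  have hz : ∀ d, (z d).val + 1 < n d := fun d => by have := hn d; simp [z]; omega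
  refine ⟨fun d => if o z (shift z d (hz d)) then 1 else 0, ?_⟩
  intro d u v h
  induction hs : coordSum u generalizing u v with
  | zero =>
    have hu : u = z := vertex_ext fun k => by
      have : (u k).val ≤ coordSum u :=
        Finset.single_le_sum (f := fun k => (u k).val) (fun _ _ => Nat.zero_le _)
          (Finset.mem_univ k)
      simp [z]; omega
    subst hu
    rw [h.eq_of_left (isStep_shift z d (hz d)), edgeType]
    split_ifs with h' <;> simp [h', z]
  | succ m ih =>
    obtain ⟨k, hk⟩ : ∃ k, 0 < (u k).val := by
      by_contra hcon
      have : coordSum u = 0 := Finset.sum_eq_zero fun k _ => by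
        by_contra h0
        exact hcon ⟨k, Nat.pos_of_ne_zero h0⟩
      omega
    obtain ⟨u', hu'⟩ := exists_isStep_of_pos hk
    have hsum := hu'.coordSum_eq
    by_cases hkd : k = d
    · subst hkd
      have hi := ih u' u hu' (by omega)
      rw [← ho.straight hn hu' h, hi, edgeType, edgeType, hu'.val_add_one]
      omega
    · obtain ⟨v', hv'⟩ := exists_isStep_of_pos (n := n) (v := v) (d := k)
        (by rw [h.val_eq hkd]; exact hk)
      have huv' := h.of_square_back hu' hv' (Ne.symm hkd)
      have hi := ih u' v' huv' (by omega)
      have hf := ho.flip (Ne.symm hkd) huv' hu' hv'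
      rw [hi] at hf
      have hval := hu'.val_eq (Ne.symm hkd)
      rw [hval]
      unfold edgeType at hf ⊢
      by_cases hc : o u v <;>
        simp only [hc, not_true, not_false_eq_true, iff_true, iff_false, true_iff,
          false_iff] at hf ⊢ <;>
        omega

end Box

section Typed

variable {n : Fin 3 → ℕ} {o : Vertex n → Vertex n → Prop} {c : Fin 3 → ℕ}
variable {i j k l : Vertex n}

/-! ### Edges, faces and their types -/

/-- The coordinate, along the axis of the edge, of the lower end of an edge. -/
def edgeLow (i j : Vertex n) : ℕ :=
  min (i (edgeAxis i j)).val (j (edgeAxis i j)).val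

/-- The type of the edge between `i` and `j`. -/
def dartType (c : Fin 3 → ℕ) (i j : Vertex n) : ℕ := edgeType c (edgeAxis i j) (edgeLow i j)

theorem edgeLow_comm (i j : Vertex n) : edgeLow i j = edgeLow j i := by
  rw [edgeLow, edgeLow, edgeAxis_comm, min_comm]

theorem dartType_comm (c : Fin 3 → ℕ) (i j : Vertex n) : dartType c i j = dartType c j i := by
  rw [dartType, dartType, edgeAxis_comm, edgeLow_comm]

theorem edgeType_lt (c : Fin 3 → ℕ) (d : Fin 3) (x : ℕ) : edgeType c d x < 2 :=
  Nat.mod_lt _ (by norm_num)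

theorem dartType_lt (c : Fin 3 → ℕ) (i j : Vertex n) : dartType c i j < 2 := edgeType_lt _ _ _

theorem isStep_or_isStep (h : (lattice n).Adj i j) :
    IsStep (edgeAxis i j) i j ∨ IsStep (edgeAxis i j) j i := by
  obtain ⟨d, h | h⟩ := h
  · left; rwa [h.edgeAxis_eq]
  · right; rwa [edgeAxis_comm, h.edgeAxis_eq]

theorem IsStep.edgeLow_eq {d : Fin 3} (h : IsStep d i j) : edgeLow i j = (i d).val := by
  rw [edgeLow, h.edgeAxis_eq, h.val_add_one]; omega

theorem val_eq_of_adj (h : (lattice n).Adj i j) {d : Fin 3} (hd : d ≠ edgeAxis i j) :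
    (i d).val = (j d).val := by
  rcases isStep_or_isStep h with h | h
  · exact (h.val_eq hd).symm
  · exact h.val_eq hd

theorem val_axis_of_adj (h : (lattice n).Adj i j) :
    ((i (edgeAxis i j)).val = edgeLow i j ∧ (j (edgeAxis i j)).val = edgeLow i j + 1) ∨
    ((j (edgeAxis i j)).val = edgeLow i j ∧ (i (edgeAxis i j)).val = edgeLow i j + 1) := by
  rw [edgeLow]
  rcases isStep_or_isStep h with h | h
  · have := h.val_add_one; omega
  · have := h.val_add_one; omega

theorem coordSum_of_adj (h : (lattice n).Adj i j) : coordSum i % 2 ≠ coordSum j % 2 := by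
  rcases isStep_or_isStep h with h | h
  · have := h.coordSum_eq; omega
  · have := h.coordSum_eq; omega

/-- An edge points away from `i` if and only if its type is not the parity of `i`. -/
theorem IsTypedBy.iff_dartType (ho : IsOrientation o) (hc : IsTypedBy o c)
    (h : (lattice n).Adj i j) : o i j ↔ dartType c i j ≠ coordSum i % 2 := by
  rcases isStep_or_isStep h with hs | hs
  · rw [hc _ _ _ hs, dartType, hs.edgeLow_eq]
  · rw [ho.xor _ _ h, hc _ _ _ hs, dartType_comm, dartType, hs.edgeAxis_eq, hs.edgeLow_eq]
    have h₁ := coordSum_of_adj h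
    have h₂ := edgeType_lt c (edgeAxis i j) (j (edgeAxis i j)).val
    omega

theorem Face.axis_ne_normal {f : Face n} (h : (lattice n).Adj i j) (hi : i ∈ f.verts)
    (hj : j ∈ f.verts) : edgeAxis i j ≠ f.normal := by
  intro e
  have := val_axis_of_adj h
  rw [e, hi.1, hj.1] at this
  omega

theorem Face.edgeLow_eq {f : Face n} (h : (lattice n).Adj i j) (hi : i ∈ f.verts)
    (hj : j ∈ f.verts) : edgeLow i j = (f.base (edgeAxis i j)).val := by
  have h₀ := Face.axis_ne_normal h hi hj
  have h₁ := val_axis_of_adj h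
  have h₂ := hi.2 _ h₀
  have h₃ := hj.2 _ h₀
  omega

theorem face_ext {f g : Face n} (h : f.normal = g.normal)
    (hb : ∀ d, (f.base d).val = (g.base d).val) : f = g :=
  Subtype.ext (Prod.ext h (vertex_ext hb))

/-- A face is determined by two perpendicular edges. -/
theorem Face.eq_of_perpendicular {f g : Face n} (h : (lattice n).Adj i j)
    (h' : (lattice n).Adj k l) (hne : edgeAxis i j ≠ edgeAxis k l)
    (fi : i ∈ f.verts) (fj : j ∈ f.verts) (fk : k ∈ f.verts) (fl : l ∈ f.verts)
    (gi : i ∈ g.verts) (gj : j ∈ g.verts) (gk : k ∈ g.verts) (gl : l ∈ g.verts) : f = g := by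
  obtain ⟨m, -, -, hm⟩ := exists_third_axis hne
  have hf : f.normal = m := by
    rcases hm f.normal with e | e | e
    · exact absurd e.symm (Face.axis_ne_normal h fi fj)
    · exact absurd e.symm (Face.axis_ne_normal h' fk fl)
    · exact e
  have hg : g.normal = m := by
    rcases hm g.normal with e | e | e
    · exact absurd e.symm (Face.axis_ne_normal h gi gj)
    · exact absurd e.symm (Face.axis_ne_normal h' gk gl)
    · exact e
  refine face_ext (hf.trans hg.symm) fun d => ?_
  rcases hm d with rfl | rfl | rfl
  · rw [← Face.edgeLow_eq h fi fj, ← Face.edgeLow_eq h gi gj]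
  · rw [← Face.edgeLow_eq h' fk fl, ← Face.edgeLow_eq h' gk gl]
  · have h₁ := fi.1
    have h₂ := gi.1
    rw [hf] at h₁
    rw [hg] at h₂
    rw [← h₁, ← h₂]

/-- Perpendicular edges of a face have a common vertex. -/
theorem Face.exists_common_vertex {f : Face n} (h : (lattice n).Adj i j)
    (h' : (lattice n).Adj k l) (hne : edgeAxis i j ≠ edgeAxis k l)
    (fi : i ∈ f.verts) (fj : j ∈ f.verts) (fk : k ∈ f.verts) (fl : l ∈ f.verts) :
    i = k ∨ i = l ∨ j = k ∨ j = l := by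
  obtain ⟨m, -, -, hm⟩ := exists_third_axis hne
  have hf : f.normal = m := by
    rcases hm f.normal with e | e | e
    · exact absurd e.symm (Face.axis_ne_normal h fi fj)
    · exact absurd e.symm (Face.axis_ne_normal h' fk fl)
    · exact e
  have a₁ := Face.edgeLow_eq h fi fj
  have b₁ := Face.edgeLow_eq h' fk fl
  have a₂ := val_axis_of_adj h
  have b₂ := val_axis_of_adj h'
  have a₃ := val_eq_of_adj h hne.symm
  have b₃ := val_eq_of_adj h' hne
  have a₄ := fi.2 _ (Face.axis_ne_normal h' fk fl)
  have b₄ := fk.2 _ (Face.axis_ne_normal h fi fj)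
  have key : ∀ {x y : Vertex n}, x ∈ f.verts → y ∈ f.verts →
      (x (edgeAxis i j)).val = (y (edgeAxis i j)).val →
      (x (edgeAxis k l)).val = (y (edgeAxis k l)).val → x = y := by
    intro x y hx hy h₁ h₂
    refine vertex_ext fun d => ?_
    rcases hm d with rfl | rfl | rfl
    · exact h₁
    · exact h₂
    · rw [← hf, hx.1, hy.1]
  by_cases e₁ : (i (edgeAxis i j)).val = (k (edgeAxis i j)).val
  · by_cases e₂ : (k (edgeAxis k l)).val = (i (edgeAxis k l)).val
    · exact Or.inl (key fi fk e₁ e₂.symm)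
    · exact Or.inr (Or.inl (key fi fl (by omega) (by omega)))
  · by_cases e₂ : (k (edgeAxis k l)).val = (i (edgeAxis k l)).val
    · exact Or.inr (Or.inr (Or.inl (key fj fk (by omega) (by omega))))
    · exact Or.inr (Or.inr (Or.inr (key fj fl (by omega) (by omega))))

/-- The two edges of the face at its base vertex both leave it or both enter it exactly when their
types agree. -/
theorem isOddFace_iff (ho : IsCompactOrientation o) (hc : IsTypedBy o c) (f : Face n) :
    IsOddFace o f ↔ ∀ a b, a ≠ f.normal → b ≠ f.normal →
      edgeType c a (f.base a).val = edgeType c b (f.base b).val := by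
  have key : ∀ a b, a ≠ b → a ≠ f.normal → b ≠ f.normal → (IsOddFace o f ↔
      edgeType c a (f.base a).val = edgeType c b (f.base b).val) := by
    intro a b hab ha hb
    have hv := isStep_shift f.base a (f.lt ha)
    have hw := isStep_shift f.base b (f.lt hb)
    rw [ho.isOddFace_iff_base f hab ha hb hv hw, hc _ _ _ hv, hc _ _ _ hw]
    have := edgeType_lt c a (f.base a).val
    have := edgeType_lt c b (f.base b).val
    omega
  constructor
  · intro h a b ha hb
    by_cases hab : a = b
    · rw [hab]
    · exact (key a b hab ha hb).mp h
  · intro h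
    obtain ⟨a, b, hab, ha, hb, -⟩ := exists_other_axes f.normal
    exact (key a b hab ha.symm hb.symm).mpr (h a b ha.symm hb.symm)

/-- All edges of an odd face have the same type. -/
theorem dartType_eq_of_isOddFace (ho : IsCompactOrientation o) (hc : IsTypedBy o c) {f : Face n}
    (hf : IsOddFace o f) (h : (lattice n).Adj i j) (h' : (lattice n).Adj k l)
    (fi : i ∈ f.verts) (fj : j ∈ f.verts) (fk : k ∈ f.verts) (fl : l ∈ f.verts) :
    dartType c i j = dartType c k l := by
  rw [dartType, dartType, Face.edgeLow_eq h fi fj, Face.edgeLow_eq h' fk fl]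
  exact (isOddFace_iff ho hc f).mp hf _ _ (Face.axis_ne_normal h fi fj)
    (Face.axis_ne_normal h' fk fl)

/-- Two edges of the same type at a vertex span an odd face. -/
theorem exists_isOddFace_of_dartType_eq (ho : IsCompactOrientation o) (hc : IsTypedBy o c)
    (hj : (lattice n).Adj i j) (hk : (lattice n).Adj i k) (hjk : j ≠ k)
    (ht : dartType c i j = dartType c i k) :
    edgeAxis i j ≠ edgeAxis i k ∧
      ∃ f : Face n, IsOddFace o f ∧ i ∈ f.verts ∧ j ∈ f.verts ∧ k ∈ f.verts := by
  have a₁ := val_axis_of_adj hj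
  have b₁ := val_axis_of_adj hk
  -- Two different edges at `i` along one axis are consecutive on a line and have different types.
  have hne : edgeAxis i j ≠ edgeAxis i k := by
    intro e
    have hlow : edgeLow i j = edgeLow i k := by
      rw [dartType, dartType, edgeType, edgeType, ← e] at ht
      rw [← e] at b₁
      omega
    refine hjk (vertex_ext fun d => ?_)
    by_cases hd : d = edgeAxis i j
    · subst hd
      rw [← e, ← hlow] at b₁
      omega
    · rw [← val_eq_of_adj hj hd, ← val_eq_of_adj hk (e ▸ hd)]
  refine ⟨hne, ?_⟩
  obtain ⟨m, hma, hmb, hm⟩ := exists_third_axis hne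
  have a₂ := val_eq_of_adj hj hne.symm
  have b₂ := val_eq_of_adj hk hne
  have a₃ := val_eq_of_adj hj hma
  have b₃ := val_eq_of_adj hk hmb
  have ba : ((i ⊓ j ⊓ k : Vertex n) (edgeAxis i j)).val = edgeLow i j := by
    simp only [Pi.inf_apply, Fin.coe_min]; omega
  have bb : ((i ⊓ j ⊓ k : Vertex n) (edgeAxis i k)).val = edgeLow i k := by
    simp only [Pi.inf_apply, Fin.coe_min]; omega
  have bm : ((i ⊓ j ⊓ k : Vertex n) m).val = (i m).val := by
    simp only [Pi.inf_apply, Fin.coe_min]; omega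
  have li := (i (edgeAxis i j)).isLt
  have lj := (j (edgeAxis i j)).isLt
  have li' := (i (edgeAxis i k)).isLt
  have lk := (k (edgeAxis i k)).isLt
  let f : Face n := ⟨(m, i ⊓ j ⊓ k), fun d hd => by
    rcases hm d with rfl | rfl | rfl
    · rw [ba]; omega
    · rw [bb]; omega
    · exact absurd rfl hd⟩
  refine ⟨f, ?_, ⟨Fin.ext bm.symm, ?_⟩, ⟨Fin.ext (a₃.symm.trans bm.symm), ?_⟩,
    ⟨Fin.ext (b₃.symm.trans bm.symm), ?_⟩⟩
  · rw [isOddFace_iff ho hc]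
    have key : ∀ d, d ≠ m → edgeType c d (f.base d).val = dartType c i j := by
      intro d hd
      rcases hm d with rfl | rfl | rfl
      · exact congrArg _ ba
      · exact (congrArg _ bb).trans ht.symm
      · exact absurd rfl hd
    intro a b ha hb
    rw [key a ha, key b hb]
  all_goals
    intro d hd
    change _ = ((i ⊓ j ⊓ k : Vertex n) d).val ∨ _ = ((i ⊓ j ⊓ k : Vertex n) d).val + 1
    rcases hm d with rfl | rfl | rfl
    · rw [ba]; omega
    · rw [bb]; omega
    · exact absurd rfl hd

/-! ### The cubic compact encoding is a representation -/

open Classical in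
/-- The one-qubit factors of the operator of the edge `(i,j)`. -/
def edgePauli (o : Vertex n → Vertex n → Prop) (i j : Vertex n) :
    Qubit o → Matrix (Fin 2) (Fin 2) ℂ
  | Sum.inl u => if u = i then pauliX else if u = j then pauliY else 1
  | Sum.inr f => if i ∈ f.1.verts ∧ j ∈ f.1.verts then axisPauli (edgeAxis i j) else 1

open Classical in
theorem unsignedEdgeOp_eq (i j : Vertex n) :
    unsignedEdgeOp o i j = tensorOp (edgePauli o i j) := by
  rw [unsignedEdgeOp]
  congr 1

theorem unsignedEdgeOp_sq (i j : Vertex n) : unsignedEdgeOp o i j * unsignedEdgeOp o i j = 1 := by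
  rw [unsignedEdgeOp_eq, tensorOp_mul]
  refine tensorOp_eq_one fun q => ?_
  rcases q with u | f <;> simp only [edgePauli] <;> split_ifs <;>
    simp [pauliX_sq, pauliY_sq, axisPauli_sq]

/-- Operators of edges without a common vertex commute. -/
theorem unsignedEdgeOp_comm (h : (lattice n).Adj i j) (h' : (lattice n).Adj k l)
    (h₁ : i ≠ k) (h₂ : i ≠ l) (h₃ : j ≠ k) (h₄ : j ≠ l) :
    unsignedEdgeOp o i j * unsignedEdgeOp o k l = unsignedEdgeOp o k l * unsignedEdgeOp o i j := by
  rw [unsignedEdgeOp_eq, unsignedEdgeOp_eq]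
  refine tensorOp_commute fun q => ?_
  rcases q with u | f
  · simp only [edgePauli]
    split_ifs <;> simp_all
  · simp only [edgePauli]
    split_ifs with hf hf' <;> try simp
    by_cases hne : edgeAxis i j = edgeAxis k l
    · rw [hne]
    · rcases Face.exists_common_vertex h h' hne hf.1 hf.2 hf'.1 hf'.2 with e | e | e | e
      · exact absurd e h₁
      · exact absurd e h₂
      · exact absurd e h₃
      · exact absurd e h₄

/-- Operators of edges of different types with one common vertex anticommute. -/
theorem unsignedEdgeOp_anticomm_of_head_tail (ho : IsCompactOrientation o) (hc : IsTypedBy o c)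
    (hij : o i j) (hjl : o j l) (hil : i ≠ l) :
    unsignedEdgeOp o i j * unsignedEdgeOp o j l =
      -(unsignedEdgeOp o j l * unsignedEdgeOp o i j) := by
  have h := ho.adj _ _ hij
  have h' := ho.adj _ _ hjl
  have t := (hc.iff_dartType ho.toIsOrientation h).mp hij
  have t' := (hc.iff_dartType ho.toIsOrientation h').mp hjl
  have hs := coordSum_of_adj h
  have := dartType_lt c i j
  have := dartType_lt c j l
  rw [unsignedEdgeOp_eq, unsignedEdgeOp_eq]
  refine tensorOp_anticommute (Sum.inl j) ?_ fun q hq => ?_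
  · simp [edgePauli, h.ne', pauliX_mul_pauliY]
  · rcases q with u | f
    · have : u ≠ j := fun e => hq (by rw [e])
      simp only [edgePauli]
      split_ifs <;> simp_all
    · simp only [edgePauli]
      split_ifs with hf hf' <;> try simp
      have := dartType_eq_of_isOddFace ho hc f.2 h h' hf.1 hf.2 hf'.1 hf'.2
      omega

/-- Operators of perpendicular edges of an odd face that commute at all vertices anticommute. -/
theorem unsignedEdgeOp_anticomm_of_face (h : (lattice n).Adj i j) (h' : (lattice n).Adj k l)
    (hne : edgeAxis i j ≠ edgeAxis k l) {f : Face n} (hf : IsOddFace o f)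
    (fi : i ∈ f.verts) (fj : j ∈ f.verts) (fk : k ∈ f.verts) (fl : l ∈ f.verts)
    (hv : ∀ u, edgePauli o i j (Sum.inl u) * edgePauli o k l (Sum.inl u) =
      edgePauli o k l (Sum.inl u) * edgePauli o i j (Sum.inl u)) :
    unsignedEdgeOp o i j * unsignedEdgeOp o k l =
      -(unsignedEdgeOp o k l * unsignedEdgeOp o i j) := by
  rw [unsignedEdgeOp_eq, unsignedEdgeOp_eq]
  refine tensorOp_anticommute (Sum.inr ⟨f, hf⟩) ?_ fun q hq => ?_
  · simp [edgePauli, fi, fj, fk, fl, axisPauli_anticomm hne]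
  · rcases q with u | g
    · exact hv u
    · simp only [edgePauli]
      split_ifs with hg hg' <;> try simp
      exact absurd (congrArg Sum.inr (Subtype.ext (Face.eq_of_perpendicular h h' hne hg.1 hg.2
        hg'.1 hg'.2 fi fj fk fl))) hq

/-- Operators of edges with exactly one common vertex anticommute. -/
theorem unsignedEdgeOp_anticomm (ho : IsCompactOrientation o) (hc : IsTypedBy o c)
    (hij : o i j) (hkl : o k l) (h : (i = k ∧ j ≠ l) ∨ (j = l ∧ i ≠ k) ∨ (j = k ∧ i ≠ l) ∨
      (i = l ∧ j ≠ k)) :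
    unsignedEdgeOp o i j * unsignedEdgeOp o k l =
      -(unsignedEdgeOp o k l * unsignedEdgeOp o i j) := by
  have h₁ := ho.adj _ _ hij
  have h₂ := ho.adj _ _ hkl
  have t₁ := (hc.iff_dartType ho.toIsOrientation h₁).mp hij
  have t₂ := (hc.iff_dartType ho.toIsOrientation h₂).mp hkl
  have s₁ := coordSum_of_adj h₁
  have s₂ := coordSum_of_adj h₂
  have l₁ := dartType_lt c i j
  have l₂ := dartType_lt c k l
  -- A common tail (`X` against `X`) or a common head (`Y` against `Y`) gives no sign at the
  -- vertices, but there the types agree and the edges span an odd face, whose qubit gives the sign.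
  -- The last two cases are head to tail.
  rcases h with ⟨rfl, hne⟩ | ⟨rfl, hne⟩ | ⟨rfl, hne⟩ | ⟨rfl, hne⟩
  · obtain ⟨hax, f, hf, fi, fj, fl⟩ := exists_isOddFace_of_dartType_eq ho hc h₁ h₂ hne (by omega)
    refine unsignedEdgeOp_anticomm_of_face h₁ h₂ hax hf fi fj fi fl fun u => ?_
    simp only [edgePauli]
    split_ifs <;> simp_all
  · rw [dartType_comm] at t₁ l₁
    rw [dartType_comm] at t₂ l₂
    obtain ⟨hax, f, hf, fj, fi, fk⟩ :=
      exists_isOddFace_of_dartType_eq ho hc h₁.symm h₂.symm hne (by omega)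
    rw [edgeAxis_comm, edgeAxis_comm j] at hax
    refine unsignedEdgeOp_anticomm_of_face h₁ h₂ hax hf fi fj fk fj fun u => ?_
    simp only [edgePauli]
    have := h₁.ne
    have := h₂.ne
    split_ifs <;> simp_all
  · exact unsignedEdgeOp_anticomm_of_head_tail ho hc hij hkl hne
  · rw [unsignedEdgeOp_anticomm_of_head_tail ho hc hkl hij hne.symm, neg_neg]

theorem vertexOp_sq (v : Vertex n) : vertexOp o v * vertexOp o v = 1 := by
  rw [vertexOp, tensorOp_mul]
  refine tensorOp_eq_one fun q => ?_
  rcases q with u | f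
  · simp only
    split_ifs <;> simp [pauliZ_sq]
  · simp

theorem vertexOp_comm (u v : Vertex n) :
    vertexOp o u * vertexOp o v = vertexOp o v * vertexOp o u := by
  refine tensorOp_commute fun q => ?_
  rcases q with u | f
  · simp only
    split_ifs <;> simp
  · simp

theorem unsignedEdgeOp_comm_vertexOp {v : Vertex n} (h₁ : v ≠ i) (h₂ : v ≠ j) :
    unsignedEdgeOp o i j * vertexOp o v = vertexOp o v * unsignedEdgeOp o i j := by
  rw [unsignedEdgeOp_eq]
  refine tensorOp_commute fun q => ?_
  rcases q with u | f
  · simp only [edgePauli]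
    split_ifs <;> simp_all
  · simp

theorem unsignedEdgeOp_anticomm_vertexOp {v : Vertex n} (hij : i ≠ j) (h : v = i ∨ v = j) :
    unsignedEdgeOp o i j * vertexOp o v = -(vertexOp o v * unsignedEdgeOp o i j) := by
  rw [unsignedEdgeOp_eq]
  refine tensorOp_anticommute (Sum.inl v) ?_ fun q hq => ?_
  · rcases h with rfl | rfl
    · simp [edgePauli, pauliX_mul_pauliZ]
    · simp [edgePauli, hij.symm, pauliY_mul_pauliZ]
  · rcases q with u | f
    · have : u ≠ v := fun e => hq (by rw [e])
      simp [this]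
    · simp

open Classical in
/-- The sign of the operator of an edge: `-1` if it was chosen for an isolated odd face. -/
def pickSign (o : Vertex n → Vertex n → Prop) (pick : Face n → Vertex n × Vertex n)
    (i j : Vertex n) : ℂ :=
  if ∃ f, IsIsolatedOddFace o f ∧ pick f = (i, j) then -1 else 1

theorem orientedEdgeOp_eq (pick : Face n → Vertex n × Vertex n) (i j : Vertex n) :
    orientedEdgeOp o pick i j = pickSign o pick i j • unsignedEdgeOp o i j := by
  rw [orientedEdgeOp, pickSign]
  split_ifs <;> simp

theorem pickSign_mul_self (pick : Face n → Vertex n × Vertex n) (i j : Vertex n) :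
    pickSign o pick i j * pickSign o pick i j = 1 := by
  rw [pickSign]
  split_ifs <;> simp

/-- Every edge operator is, up to a sign, the operator of an oriented edge. -/
theorem exists_generatorOp_edge (ho : IsOrientation o) (pick : Face n → Vertex n × Vertex n)
    (e : (lattice n).Dart) : ∃ (s : ℂ) (i j : Vertex n), s * s = 1 ∧ o i j ∧
      ((i = e.fst ∧ j = e.snd) ∨ (i = e.snd ∧ j = e.fst)) ∧
      generatorOp o pick (.edge e) = s • unsignedEdgeOp o i j := by
  by_cases h : o e.fst e.snd
  · refine ⟨pickSign o pick e.fst e.snd, e.fst, e.snd, pickSign_mul_self _ _ _, h,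
      Or.inl ⟨rfl, rfl⟩, ?_⟩
    simp [generatorOp, h, orientedEdgeOp_eq]
  · refine ⟨-pickSign o pick e.snd e.fst, e.snd, e.fst, ?_, (ho.not_iff e.adj).mp h,
      Or.inr ⟨rfl, rfl⟩, ?_⟩
    · rw [neg_mul_neg, pickSign_mul_self]
    · simp [generatorOp, h, orientedEdgeOp_eq]

theorem generatorOp_phase_two (pick : Face n → Vertex n × Vertex n) :
    generatorOp o pick (.phase 2) = -1 := by
  rw [generatorOp, I_pow_val_two, neg_one_smul]

/-- The cubic compact encoding exists. -/
theorem exists_isCubicEncoding (ho : IsCompactOrientation o) (hc : IsTypedBy o c)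
    (pick : Face n → Vertex n × Vertex n) :
    ∃ σ : MG (lattice n) →* QubitOp (Qubit o), IsCubicEncoding o pick σ := by
  have ho' := ho.toIsOrientation
  refine exists_hom_of_relations (generatorOp o pick) ?_ ?_ ?_ ?_ ?_ ?_ ?_ ?_ ?_ ?_ ?_
  · simp [generatorOp]
  · intro k l
    simp [generatorOp, smul_smul, mul_comm, ← I_pow_val_add]
  · intro k g
    simp [generatorOp]
  · intro e
    obtain ⟨s, i, j, hs, -, -, h⟩ := exists_generatorOp_edge ho' pick e
    rw [h, smul_mul_smul_comm, hs, unsignedEdgeOp_sq, one_smul]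
  · exact fun v => vertexOp_sq v
  · intro e
    rw [generatorOp_phase_two]
    by_cases h : o e.fst e.snd
    · have h' : ¬ o e.snd e.fst := (ho'.xor _ _ e.adj).mp h
      simp [generatorOp, h, h']
    · have h' := (ho'.not_iff e.adj).mp h
      simp [generatorOp, h, h']
  · exact fun u v => vertexOp_comm u v
  · intro e v h₁ h₂
    obtain ⟨s, i, j, hs, -, hij, h⟩ := exists_generatorOp_edge ho' pick e
    rw [h, generatorOp, smul_mul_assoc, mul_smul_comm, unsignedEdgeOp_comm_vertexOp]
    · rcases hij with ⟨rfl, rfl⟩ | ⟨rfl, rfl⟩ <;> assumption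
    · rcases hij with ⟨rfl, rfl⟩ | ⟨rfl, rfl⟩ <;> assumption
  · intro e f h₁ h₂ h₃ h₄
    obtain ⟨s, i, j, hs, oij, hij, h⟩ := exists_generatorOp_edge ho' pick e
    obtain ⟨t, k, l, ht, okl, hkl, h'⟩ := exists_generatorOp_edge ho' pick f
    rw [h, h', smul_mul_smul_comm, smul_mul_smul_comm, mul_comm s t,
      unsignedEdgeOp_comm (ho'.adj _ _ oij) (ho'.adj _ _ okl)] <;>
    rcases hij with ⟨rfl, rfl⟩ | ⟨rfl, rfl⟩ <;> rcases hkl with ⟨rfl, rfl⟩ | ⟨rfl, rfl⟩ <;>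
      assumption
  · intro e
    obtain ⟨s, i, j, hs, oij, hij, h⟩ := exists_generatorOp_edge ho' pick e
    rw [h, generatorOp_phase_two, generatorOp, smul_mul_assoc, mul_smul_comm,
      unsignedEdgeOp_anticomm_vertexOp (ho'.adj _ _ oij).ne (by tauto)]
    simp
  · intro e f h₁ h₂
    obtain ⟨s, i, j, hs, oij, hij, h⟩ := exists_generatorOp_edge ho' pick e
    obtain ⟨t, k, l, ht, okl, hkl, h'⟩ := exists_generatorOp_edge ho' pick f
    rw [h, h', generatorOp_phase_two, smul_mul_smul_comm, smul_mul_smul_comm, mul_comm s t,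
      unsignedEdgeOp_anticomm ho hc oij okl]
    · simp
    · rcases hij with ⟨rfl, rfl⟩ | ⟨rfl, rfl⟩ <;> rcases hkl with ⟨rfl, rfl⟩ | ⟨rfl, rfl⟩ <;> tauto

end Typed

section LatticeEdges

variable {n : Fin 3 → ℕ} {o : Vertex n → Vertex n → Prop} {c : Fin 3 → ℕ}
variable {i j k l u v : Vertex n} {d : Fin 3}

/-! ### The edges of the box -/

variable (n) in
/-- Undirected edges: an axis and the lower end. -/
abbrev LatticeEdge : Type :=
  {p : Fin 3 × Vertex n // (p.2 p.1).val + 1 < n p.1}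

theorem IsStep.inf_eq (h : IsStep d u v) : u ⊓ v = u :=
  vertex_ext fun k => by
    simp only [Pi.inf_apply, Fin.coe_min]
    by_cases hk : k = d
    · subst hk; have := h.val_add_one; omega
    · have := h.val_eq hk; omega

/-- The undirected edge between two adjacent vertices. -/
def edgeOfAdj (h : (lattice n).Adj i j) : LatticeEdge n :=
  ⟨(edgeAxis i j, i ⊓ j), by
    rcases isStep_or_isStep h with h | h
    · change ((i ⊓ j) (edgeAxis i j)).val + 1 < _
      rw [h.inf_eq]; exact h.lt
    · change ((i ⊓ j) (edgeAxis i j)).val + 1 < _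
      rw [inf_comm, h.inf_eq]; exact h.lt⟩

theorem edgeOfAdj_comm (h : (lattice n).Adj i j) : edgeOfAdj h.symm = edgeOfAdj h :=
  Subtype.ext (Prod.ext (edgeAxis_comm j i) (inf_comm j i))

theorem IsStep.edgeOfAdj_eq (h : IsStep d u v) : edgeOfAdj h.adj = ⟨(d, u), h.lt⟩ :=
  Subtype.ext (Prod.ext h.edgeAxis_eq h.inf_eq)

theorem edgeOfAdj_eq_iff (h : (lattice n).Adj i j) (h' : (lattice n).Adj k l) :
    edgeOfAdj h = edgeOfAdj h' ↔ (i = k ∧ j = l) ∨ (i = l ∧ j = k) := by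
  have key : ∀ {a b : Fin 3} {i j k l : Vertex n} (h : IsStep a i j) (h' : IsStep b k l),
      edgeOfAdj h.adj = edgeOfAdj h'.adj → i = k ∧ j = l := by
    intro a b i j k l h h' e
    rw [h.edgeOfAdj_eq, h'.edgeOfAdj_eq] at e
    obtain ⟨rfl, rfl⟩ := Prod.ext_iff.mp (Subtype.ext_iff.mp e)
    exact ⟨rfl, h.eq_of_left h'⟩
  constructor
  · intro e
    rcases isStep_or_isStep h with hs | hs <;> rcases isStep_or_isStep h' with hs' | hs'
    · exact Or.inl (key hs hs' e)
    · exact Or.inr (key hs hs' (e.trans (edgeOfAdj_comm h').symm))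
    · exact Or.inr (key hs hs' ((edgeOfAdj_comm h).trans e)).symm
    · exact Or.inl (key hs hs' ((edgeOfAdj_comm h).trans (e.trans (edgeOfAdj_comm h').symm))).symm
  · rintro (⟨rfl, rfl⟩ | ⟨rfl, rfl⟩)
    · rfl
    · exact (edgeOfAdj_comm h').symm ▸ rfl

variable (n) in
/-- The labelling of the edges of the box by axis and lower end. -/
def latticeLabelling : EdgeLabelling (lattice n) (LatticeEdge n) where
  label e := edgeOfAdj e.adj
  surjective := by
    rintro ⟨⟨d, u⟩, h⟩
    exact ⟨⟨(u, shift u d h), (isStep_shift u d h).adj⟩, (isStep_shift u d h).edgeOfAdj_eq⟩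
  eq_iff e f := by
    rw [edgeOfAdj_eq_iff]
    constructor
    · rintro (⟨h, h'⟩ | ⟨h, h'⟩)
      · left; ext <;> simp [h, h']
      · right; ext <;> simp [h, h']
    · rintro (rfl | rfl)
      · exact Or.inl ⟨rfl, rfl⟩
      · exact Or.inr ⟨rfl, rfl⟩

theorem lattice_connected (hn : ∀ d, 2 ≤ n d) : (lattice n).Connected := by
  let z : Vertex n := fun d => ⟨0, by have := hn d; omega⟩
  have key : ∀ m (u : Vertex n), coordSum u = m → (lattice n).Reachable z u := by
    intro m
    induction m with
    | zero =>
      intro u hu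
      have : u = z := vertex_ext fun k => by
        have : (u k).val ≤ coordSum u := Finset.single_le_sum (f := fun k => (u k).val)
          (fun _ _ => Nat.zero_le _) (Finset.mem_univ k)
        simp [z]; omega
      rw [this]
    | succ m ih =>
      intro u hu
      obtain ⟨k, hk⟩ : ∃ k, 0 < (u k).val := by
        by_contra hcon
        have : coordSum u = 0 := Finset.sum_eq_zero fun k _ => by
          by_contra h0
          exact hcon ⟨k, Nat.pos_of_ne_zero h0⟩
        omega
      obtain ⟨u', hu'⟩ := exists_isStep_of_pos hk
      have := hu'.coordSum_eq
      exact (ih u' (by omega)).trans hu'.adj.reachable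
  have : Nonempty (Vertex n) := ⟨z⟩
  exact ⟨fun u v => (key _ u rfl).symm.trans (key _ v rfl)⟩

/-! ### Test operators -/

/-- The sign character of `ZMod 2`. -/
def signChar : Multiplicative (ZMod 2) →* ℂ where
  toFun a := if Multiplicative.toAdd a = 0 then 1 else -1
  map_one' := by simp
  map_mul' a b := by
    have key : ∀ a b : ZMod 2, (if a + b = 0 then (1 : ℂ) else -1) =
        (if a = 0 then 1 else -1) * (if b = 0 then 1 else -1) := by
      intro a b
      have h : ∀ a b : ZMod 2, a + b = 0 ↔ (a = 0 ↔ b = 0) := by decide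
      by_cases ha : a = 0 <;> by_cases hb : b = 0 <;> simp [h, ha, hb]
    exact key _ _

/-- The sign with which an operator `T` commutes past an element of the cycle group is determined
by the signs with which it commutes past the edges. -/
theorem mul_test_eq {Q : Type*} [Fintype Q] [DecidableEq Q] {σ : MG (lattice n) →* QubitOp Q}
    {T : QubitOp Q} {f : (LatticeEdge n → ZMod 2) →ₗ[ZMod 2] ZMod 2}
    (hphase : ∀ k, σ (gen (.phase k)) * T = T * σ (gen (.phase k)))
    (hedge : ∀ e : (lattice n).Dart, σ (gen (.edge e)) * T =
      signChar (Multiplicative.ofAdd (f (Pi.single (edgeOfAdj e.adj) 1))) •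
        (T * σ (gen (.edge e))))
    {x : MG (lattice n)} (hx : x ∈ cycleGroup (lattice n)) :
    σ x * T = signChar (Multiplicative.ofAdd
      (f (Multiplicative.toAdd (edgeHom (latticeLabelling n) x)))) • (T * σ x) := by
  let χ : MG (lattice n) →* ℂ := signChar.comp
    ((AddMonoidHom.toMultiplicative f.toAddMonoidHom).comp (edgeHom (latticeLabelling n)))
  have mul : ∀ {g h : MG (lattice n)}, σ g * T = χ g • (T * σ g) → σ h * T = χ h • (T * σ h) →
      σ (g * h) * T = χ (g * h) • (T * σ (g * h)) := by
    intro g h hg hh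
    rw [map_mul, map_mul, mul_assoc, hh, mul_smul_comm, ← mul_assoc, hg, smul_mul_assoc, smul_smul,
      mul_comm (χ h), mul_assoc]
  -- Since `χ` is multiplicative, the elements obeying the sign rule form a subgroup. Phases and
  -- edges suffice for it to contain all cycles; vertex generators need not be tested.
  let H : Subgroup (MG (lattice n)) :=
    { carrier := {g | σ g * T = χ g • (T * σ g)}
      mul_mem' := mul
      one_mem' := by simp
      inv_mem' := by
        intro g hg
        have h₁ : σ g * σ g⁻¹ = 1 := by rw [← map_mul, mul_inv_cancel, map_one]
        have h₂ : σ g⁻¹ * σ g = 1 := by rw [← map_mul, inv_mul_cancel, map_one]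
        have h₃ : χ g⁻¹ * χ g = 1 := by rw [← map_mul, inv_mul_cancel, map_one]
        change σ g⁻¹ * T = χ g⁻¹ • (T * σ g⁻¹)
        have : σ g⁻¹ * (σ g * T) * σ g⁻¹ = T * σ g⁻¹ := by
          rw [← mul_assoc, h₂, one_mul]
        rw [← this, hg, mul_smul_comm, smul_mul_assoc, smul_smul, h₃, one_smul, mul_assoc,
          mul_assoc, h₁, mul_one] }
  have hH : cycleGroup (lattice n) ≤ H := by
    rw [cycleGroup, Subgroup.closure_le]
    rintro _ ⟨v, w, rfl⟩
    refine H.mul_mem ?_ (H.list_prod_mem ?_)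
    · change σ _ * T = χ _ • _
      have : χ (gen (.phase (w.length : ZMod 4))) = 1 := by
        simp only [χ, MonoidHom.comp_apply, edgeHom_phase, map_one]
      rw [this, one_smul, hphase]
    · intro y hy
      obtain ⟨e, -, rfl⟩ := List.mem_map.mp hy
      change σ _ * T = χ _ • _
      have : χ (gen (.edge e)) = signChar (Multiplicative.ofAdd
          (f (Pi.single (edgeOfAdj e.adj) 1))) := by
        simp only [χ, MonoidHom.comp_apply, edgeHom_edge]
        rfl
      rw [this, hedge]
  exact hH hx

/-- An element of the cycle group that commutes with an invertible test operator satisfies the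
corresponding linear condition. -/
theorem functional_eq_zero_of_commute (ho : IsOrientation o) {pick : Face n → Vertex n × Vertex n}
    {σ : MG (lattice n) →* QubitOp (Qubit o)} (hσ : IsCubicEncoding o pick σ)
    {T : QubitOp (Qubit o)} (hT : T * T = 1) (f : (LatticeEdge n → ZMod 2) →ₗ[ZMod 2] ZMod 2)
    (hedge : ∀ i j (h : o i j), unsignedEdgeOp o i j * T =
      signChar (Multiplicative.ofAdd (f (Pi.single (edgeOfAdj (ho.adj i j h)) 1))) •
        (T * unsignedEdgeOp o i j))
    {x : MG (lattice n)} (hx : x ∈ cycleGroup (lattice n)) (hcomm : σ x * T = T * σ x) :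
    f (Multiplicative.toAdd (edgeHom (latticeLabelling n) x)) = 0 := by
  have key := mul_test_eq (σ := σ) (T := T) (f := f) (fun k => by
      rw [hσ, generatorOp]; simp) (fun e => by
      obtain ⟨s, i, j, -, oij, hij, he⟩ := exists_generatorOp_edge ho pick e
      rw [hσ, he, smul_mul_assoc, hedge i j oij, mul_smul_comm, smul_comm]
      rcases hij with ⟨rfl, rfl⟩ | ⟨rfl, rfl⟩
      · rfl
      · rw [← edgeOfAdj_comm e.adj]) hx
  rw [hcomm] at key
  -- A sign `-1` would make `T * σ x` equal to its own negative, which is impossible because both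
  -- factors are invertible.
  by_contra hne
  have hs : signChar (Multiplicative.ofAdd
      (f (Multiplicative.toAdd (edgeHom (latticeLabelling n) x)))) = -1 := if_neg hne
  rw [hs] at key
  have hinv : σ x * σ x⁻¹ = 1 := by rw [← map_mul, mul_inv_cancel, map_one]
  have h1 : T * σ x * σ x⁻¹ * T = -1 := by
    rw [key]
    rw [smul_mul_assoc, smul_mul_assoc, mul_assoc T, hinv, mul_one, hT, neg_one_smul]
  rw [mul_assoc T, hinv, mul_one, hT] at h1
  have h2 := congrFun (congrFun h1 0) 0
  rw [Matrix.one_apply_eq, Matrix.neg_apply, Matrix.one_apply_eq] at h2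
  norm_num at h2

end LatticeEdges

section Balanced

variable {n : Fin 3 → ℕ} {o : Vertex n → Vertex n → Prop} {c : Fin 3 → ℕ}

/-! ### Cycles whose operators are scalars -/

/-- The vertex `O` is the lowest vertex of the box in an odd cell of type `τ` of the infinite
lattice, and this cell has edges in the box along the axis `d`. -/
structure IsCellEdge (c : Fin 3 → ℕ) (τ : Fin 2) (O : Vertex n) (d : Fin 3) : Prop where
  low : ∀ k, (O k).val = 0 ∨ edgeType c k (O k).val = τ.val
  type_eq : edgeType c d (O d).val = τ.val
  lt : (O d).val + 1 < n d

open Classical in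
/-- The values of `z` on the edges at the lowest vertices of the odd cells. -/
def cellValues (c : Fin 3 → ℕ) :
    (LatticeEdge n → ZMod 2) →ₗ[ZMod 2] (Fin 2 × Vertex n → Fin 3 → ZMod 2) :=
  LinearMap.pi fun p => LinearMap.pi fun d =>
    if h : IsCellEdge c p.1 p.2 d then LinearMap.proj ⟨(d, p.2), h.lt⟩ else 0

theorem cellValues_of_isCellEdge {τ : Fin 2} {O : Vertex n} {d : Fin 3} (h : IsCellEdge c τ O d)
    (z : LatticeEdge n → ZMod 2) : cellValues c z (τ, O) d = z ⟨(d, O), h.lt⟩ := by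
  simp [cellValues, h]

theorem cellValues_of_not_isCellEdge {τ : Fin 2} {O : Vertex n} {d : Fin 3}
    (h : ¬ IsCellEdge c τ O d) (z : LatticeEdge n → ZMod 2) : cellValues c z (τ, O) d = 0 := by
  simp [cellValues, h]

/-- The conditions on the edges of a cycle under which its operator is a scalar. -/
def balanced (c : Fin 3 → ℕ) : Submodule (ZMod 2) (LatticeEdge n → ZMod 2) where
  carrier := {z | (∀ p, ∑ d, cellValues c z p d = 0) ∧
    ∀ (d k : Fin 3) (u u' : Vertex n) (h : IsStep k u u') (hkd : d ≠ k)
      (hd : (u d).val + 1 < n d), edgeType c d (u d).val = edgeType c k (u k).val →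
      z ⟨(d, u), hd⟩ = z ⟨(d, u'), by change (u' d).val + 1 < n d; rwa [h.val_eq hkd]⟩}
  zero_mem' := by simp
  add_mem' := by
    rintro z z' ⟨h₁, h₂⟩ ⟨h₁', h₂'⟩
    refine ⟨fun p => ?_, fun d k u u' h hkd hd ht => ?_⟩
    · simp only [map_add, Pi.add_apply, Finset.sum_add_distrib, h₁, h₁', add_zero]
    · rw [Pi.add_apply, Pi.add_apply, h₂ d k u u' h hkd hd ht, h₂' d k u u' h hkd hd ht]
  smul_mem' := by
    rintro a z ⟨h₁, h₂⟩
    refine ⟨fun p => ?_, fun d k u u' h hkd hd ht => ?_⟩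
    · simp only [map_smul, Pi.smul_apply, ← Finset.smul_sum, h₁, smul_zero]
    · rw [Pi.smul_apply, Pi.smul_apply, h₂ d k u u' h hkd hd ht]

/-- The lower end of the segment of type `τ` that contains the coordinate `x`. -/
def lowCoord (c : Fin 3 → ℕ) (τ : ℕ) (d : Fin 3) (x : Fin (n d)) : Fin (n d) :=
  if x.val ≠ 0 ∧ edgeType c d x.val ≠ τ then ⟨x.val - 1, by omega⟩ else x

/-- A balanced vector is determined by its values at the lowest vertices of the odd cells. -/
theorem eq_zero_of_cellValues_eq_zero {z : LatticeEdge n → ZMod 2} (hz : z ∈ balanced c)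
    (h : cellValues c z = 0) : z = 0 := by
  funext ⟨⟨d, u⟩, hu⟩
  change (u d).val + 1 < n d at hu
  set τ := edgeType c d (u d).val with hτ
  have hτ2 : τ < 2 := edgeType_lt _ _ _
  -- Lowering a coordinate across the axis `d` to the lower end of its segment of type `τ` moves the
  -- edge to the opposite side of an odd face, where a balanced vector has the same value.
  have move : ∀ (k : Fin 3) (w : Vertex n) (hw : (w d).val + 1 < n d)
      (hw' : (Function.update w k (lowCoord c τ k (w k)) d).val + 1 < n d), k ≠ d →
      edgeType c d (w d).val = τ → z ⟨(d, w), hw⟩ =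
        z ⟨(d, Function.update w k (lowCoord c τ k (w k))), hw'⟩ := by
    intro k w hw hw' hkd ht
    by_cases hk : (w k).val ≠ 0 ∧ edgeType c k (w k).val ≠ τ
    · have hval : (Function.update w k (lowCoord c τ k (w k)) k).val = (w k).val - 1 := by
        simp [lowCoord, hk]
      have hstep : IsStep k (Function.update w k (lowCoord c τ k (w k))) w :=
        ⟨by rw [hval]; omega, fun x hx => by simp [hx]⟩
      have hd : (Function.update w k (lowCoord c τ k (w k)) d).val = (w d).val := by
        simp [hkd.symm]
      refine (hz.2 d k _ w hstep hkd.symm hw' ?_).symm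
      rw [hd, ht, hval]
      have h₁ := hk.1
      have h₂ := hk.2
      rw [edgeType] at h₂ ⊢
      omega
    · have : Function.update w k (lowCoord c τ k (w k)) = w := by
        rw [lowCoord, if_neg hk, Function.update_eq_self]
      congr 2
      rw [this]
  obtain ⟨a, b, hab, hda, hdb, hall⟩ := exists_other_axes d
  -- Lowering both transverse coordinates moves the edge to the lowest vertex of its clipped cube;
  -- the coordinate along `d` already starts a segment of type `τ`.
  let O : Vertex n := fun k => lowCoord c τ k (u k)
  have hOd : O d = u d := by
    change lowCoord c τ d (u d) = u d
    rw [lowCoord, if_neg (fun h => h.2 rfl)]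
  have hO : O = Function.update (Function.update u a (lowCoord c τ a (u a))) b
      (lowCoord c τ b (Function.update u a (lowCoord c τ a (u a)) b)) := by
    funext k
    rcases hall k with rfl | rfl | rfl
    · simp [hab, O]
    · simp [hab.symm, O]
    · rw [hOd]; simp [hda, hdb]
  have hOlt : (O d).val + 1 < n d := by rw [hOd]; exact hu
  have hz1 : z ⟨(d, u), hu⟩ = z ⟨(d, O), hOlt⟩ := by
    rw [move a u hu (by simpa [hda] using hu) hda.symm rfl,
      move b _ _ (by simpa [hda, hdb] using hu) hdb.symm (by simp [hda, hτ])]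
    congr 2
    rw [hO]
  have hcell : IsCellEdge c ⟨τ, hτ2⟩ O d := by
    refine ⟨fun k => ?_, by rw [hOd], hOlt⟩
    change (lowCoord c τ k (u k)).val = 0 ∨ edgeType c k (lowCoord c τ k (u k)).val = τ
    by_cases hk : (u k).val ≠ 0 ∧ edgeType c k (u k).val ≠ τ
    · right
      rw [lowCoord, if_pos hk]
      have h₁ := hk.1
      have h₂ := hk.2
      simp only [edgeType] at h₂ ⊢
      omega
    · rw [lowCoord, if_neg hk]
      by_contra hcon
      exact hk ⟨fun e => hcon (Or.inl e), fun e => hcon (Or.inr e)⟩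
  rw [hz1, ← cellValues_of_isCellEdge hcell z, h]
  rfl

/-- The operator that acts with `P` on one qubit. -/
def singleOp {Q : Type*} [Fintype Q] [DecidableEq Q] (q : Q) (P : Matrix (Fin 2) (Fin 2) ℂ) :
    QubitOp Q :=
  tensorOp fun q' => if q' = q then P else 1

theorem singleOp_sq {Q : Type*} [Fintype Q] [DecidableEq Q] (q : Q)
    {P : Matrix (Fin 2) (Fin 2) ℂ} (h : P * P = 1) : singleOp q P * singleOp q P = 1 := by
  rw [singleOp, tensorOp_mul]
  refine tensorOp_eq_one fun q' => ?_
  split_ifs <;> simp [h]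

theorem signChar_zero : signChar (Multiplicative.ofAdd 0) = 1 := by
  simp [signChar]

theorem signChar_one : signChar (Multiplicative.ofAdd 1) = -1 := by
  simp [signChar]

theorem tensorOp_mul_singleOp {Q : Type*} [Fintype Q] [DecidableEq Q]
    {M : Q → Matrix (Fin 2) (Fin 2) ℂ} {q : Q} {P : Matrix (Fin 2) (Fin 2) ℂ} {a : ZMod 2}
    (h₀ : a = 0 → M q * P = P * M q) (h₁ : a = 1 → M q * P = -(P * M q)) :
    tensorOp M * singleOp q P =
      signChar (Multiplicative.ofAdd a) • (singleOp q P * tensorOp M) := by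
  have ha : a = 0 ∨ a = 1 := (by decide : ∀ a : ZMod 2, a = 0 ∨ a = 1) a
  rcases ha with rfl | rfl
  · rw [signChar_zero, one_smul]
    refine tensorOp_commute fun q' => ?_
    split_ifs with hq
    · rw [hq]; exact h₀ rfl
    · simp
  · rw [signChar_one, neg_one_smul]
    refine tensorOp_anticommute q ?_ fun q' hq => ?_
    · simpa using h₁ rfl
    · simp [hq]

/-- Edges of type `τ` point to `O` and act there with `Y` if `τ` is the parity of `O`, and otherwise
leave `O` and act with `X`. The Pauli operator at `O` that anticommutes with theirs commutes with
all other edges, so commutation with it says that the edges of type `τ` at `O` occur an even number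
of times in total. -/
theorem sum_cellValues_eq_zero (ho : IsCompactOrientation o) (hc : IsTypedBy o c)
    {pick : Face n → Vertex n × Vertex n} {σ : MG (lattice n) →* QubitOp (Qubit o)}
    (hσ : IsCubicEncoding o pick σ) {x : MG (lattice n)} (hx : x ∈ cycleGroup (lattice n))
    (hcomm : ∀ T, σ x * T = T * σ x) (p : Fin 2 × Vertex n) :
    ∑ d, cellValues c (Multiplicative.toAdd (edgeHom (latticeLabelling n) x)) p d = 0 := by
  classical
  obtain ⟨τ, O⟩ := p
  by_cases hlow : ∀ k, (O k).val = 0 ∨ edgeType c k (O k).val = τ.val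
  swap
  · exact Finset.sum_eq_zero fun d _ =>
      cellValues_of_not_isCellEdge (fun h => hlow h.low) _
  let f : (LatticeEdge n → ZMod 2) →ₗ[ZMod 2] ZMod 2 :=
    (Fintype.linearCombination (ZMod 2) fun _ : Fin 3 => (1 : ZMod 2)).comp
      ((LinearMap.proj (τ, O)).comp (cellValues c))
  have hf : ∀ z, f z = ∑ d, cellValues c z (τ, O) d := fun z => by
    simp [f, Fintype.linearCombination_apply]
  rw [← hf]
  have hfs : ∀ e : LatticeEdge n, f (Pi.single e 1) =
      if e.1.2 = O ∧ edgeType c e.1.1 (e.1.2 e.1.1).val = τ.val then 1 else 0 := by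
    rintro ⟨⟨d, w⟩, hw⟩
    rw [hf, Finset.sum_eq_single d]
    · by_cases hcell : IsCellEdge c τ O d
      · rw [cellValues_of_isCellEdge hcell, Pi.single_apply]
        by_cases hw : w = O
        · subst hw
          simp [hcell.type_eq]
        · simp [hw, Ne.symm hw]
      · rw [cellValues_of_not_isCellEdge hcell, if_neg]
        rintro ⟨rfl, ht⟩
        exact hcell ⟨hlow, ht, hw⟩
    · intro d' _ hd'
      by_cases hcell : IsCellEdge c τ O d'
      · rw [cellValues_of_isCellEdge hcell, Pi.single_apply, if_neg]
        intro e
        exact hd' (congrArg (fun e => e.1.1) e)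
      · rw [cellValues_of_not_isCellEdge hcell]
    · simp
  refine functional_eq_zero_of_commute ho.toIsOrientation hσ
    (T := singleOp (Sum.inl O) (if τ.val = coordSum O % 2 then pauliX else pauliY))
    (singleOp_sq _ (by split_ifs <;> simp [pauliX_sq, pauliY_sq])) f ?_ hx (hcomm _)
  intro i j hij
  have h := ho.adj i j hij
  have t := (hc.iff_dartType ho.toIsOrientation h).mp hij
  have hs := coordSum_of_adj h
  have hlt := dartType_lt c i j
  have hτ := τ.isLt
  -- Because `O` is lowest in its cell of type `τ`, no edge of type `τ` goes down from it; its edges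
  -- of type `τ` are exactly those having it as lower end.
  have hiff : ((edgeOfAdj h).1.2 = O ∧
      edgeType c (edgeOfAdj h).1.1 ((edgeOfAdj h).1.2 (edgeOfAdj h).1.1).val = τ.val) ↔
      (O = i ∨ O = j) ∧ dartType c i j = τ.val := by
    have key : ∀ {i j : Vertex n} {d : Fin 3} (hs : IsStep d i j),
        ((edgeOfAdj hs.adj).1.2 = O ∧ edgeType c (edgeOfAdj hs.adj).1.1
          ((edgeOfAdj hs.adj).1.2 (edgeOfAdj hs.adj).1.1).val = τ.val) ↔
        (O = i ∨ O = j) ∧ dartType c i j = τ.val := by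
      intro i j d hs
      rw [hs.edgeOfAdj_eq, dartType, hs.edgeAxis_eq, hs.edgeLow_eq]
      change i = O ∧ edgeType c d (i d).val = τ.val ↔ _
      constructor
      · rintro ⟨rfl, h⟩
        exact ⟨Or.inl rfl, h⟩
      · rintro ⟨rfl | rfl, h⟩
        · exact ⟨rfl, h⟩
        · exfalso
          have h₁ := hs.val_add_one
          have h₂ := hlow d
          rw [edgeType] at h h₂
          omega
    rcases isStep_or_isStep h with h' | h'
    · exact key h'
    · rw [← edgeOfAdj_comm h, dartType_comm, or_comm]
      exact key h'
  rw [unsignedEdgeOp_eq]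
  have hne : i ≠ j := h.ne
  refine tensorOp_mul_singleOp ?_ ?_
  · rw [hfs, ite_eq_right_iff]
    intro h0
    have h0 : ¬ ((O = i ∨ O = j) ∧ dartType c i j = τ.val) := fun hh =>
      one_ne_zero (h0 (hiff.mpr hh))
    simp only [edgePauli]
    by_cases hi : O = i
    · have : τ.val = coordSum O % 2 := by
        have : dartType c i j ≠ τ.val := fun e => h0 ⟨Or.inl hi, e⟩
        rw [hi]; omega
      rw [if_pos hi, if_pos this]
    · by_cases hj : O = j
      · have : ¬ τ.val = coordSum O % 2 := by
          have : dartType c i j ≠ τ.val := fun e => h0 ⟨Or.inr hj, e⟩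
          rw [hj]; omega
        rw [if_neg hi, if_pos hj, if_neg this]
      · simp [hi, hj]
  · rw [hfs, ite_eq_left_iff]
    intro h1
    have h1 : (O = i ∨ O = j) ∧ dartType c i j = τ.val := by
      by_contra hh
      exact zero_ne_one (h1 (fun h2 => hh (hiff.mp h2)))
    simp only [edgePauli]
    rcases h1 with ⟨rfl | rfl, h1⟩
    · have : ¬ τ.val = coordSum O % 2 := by omega
      simp [this, pauliX_mul_pauliY]
    · have : τ.val = coordSum O % 2 := by omega
      simp [this, hne.symm, pauliX_mul_pauliY]

/-- The two parallel edges are opposite sides of an odd face. On its qubit, the Pauli matrix of the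
axis `k` anticommutes with exactly these two sides, so commutation makes their values sum to zero.
-/
theorem parallel_edges_eq (ho : IsCompactOrientation o) (hc : IsTypedBy o c)
    {pick : Face n → Vertex n × Vertex n} {σ : MG (lattice n) →* QubitOp (Qubit o)}
    (hσ : IsCubicEncoding o pick σ) {x : MG (lattice n)} (hx : x ∈ cycleGroup (lattice n))
    (hcomm : ∀ T, σ x * T = T * σ x) {d k : Fin 3} {u v u' v' : Vertex n} (huv : IsStep d u v)
    (huu' : IsStep k u u') (huv' : IsStep d u' v') (hdk : d ≠ k)
    (ht : edgeType c d (u d).val = edgeType c k (u k).val) :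
    Multiplicative.toAdd (edgeHom (latticeLabelling n) x) (edgeOfAdj huv.adj) =
      Multiplicative.toAdd (edgeHom (latticeLabelling n) x) (edgeOfAdj huv'.adj) := by
  classical
  obtain ⟨m, hmd, hmk, hm⟩ := exists_third_axis hdk
  let g : Face n := ⟨(m, u), fun y hy => by
    rcases hm y with rfl | rfl | rfl
    · exact huv.lt
    · exact huu'.lt
    · exact absurd rfl hy⟩
  have hg : IsOddFace o g := by
    rw [isOddFace_iff ho hc]
    have key : ∀ y, y ≠ m → edgeType c y (u y).val = edgeType c d (u d).val := by
      intro y hy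
      rcases hm y with rfl | rfl | rfl
      · rfl
      · exact ht.symm
      · exact absurd rfl hy
    intro a b ha hb
    exact (key a ha).trans (key b hb).symm
  have gu : u ∈ g.verts := g.base_mem_verts
  have gv : v ∈ g.verts := Face.mem_verts_of_isStep huv hmd.symm gu rfl
  have gu' : u' ∈ g.verts := Face.mem_verts_of_isStep huu' hmk.symm gu rfl
  have gv' : v' ∈ g.verts := Face.mem_verts_of_isStep huv' hmd.symm gu' (huu'.val_eq hdk)
  have hne : edgeOfAdj huv.adj ≠ edgeOfAdj huv'.adj := by
    rw [huv.edgeOfAdj_eq, huv'.edgeOfAdj_eq]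
    intro e
    have : u = u' := congrArg (fun e => e.1.2) e
    subst this
    have := huu'.val_add_one
    omega
  let f : (LatticeEdge n → ZMod 2) →ₗ[ZMod 2] ZMod 2 :=
    LinearMap.proj (R := ZMod 2) (φ := fun _ => ZMod 2) (edgeOfAdj huv.adj) +
      LinearMap.proj (R := ZMod 2) (φ := fun _ => ZMod 2) (edgeOfAdj huv'.adj)
  suffices hf : f (Multiplicative.toAdd (edgeHom (latticeLabelling n) x)) = 0 by
    exact CharTwo.add_eq_zero.mp hf
  refine functional_eq_zero_of_commute ho.toIsOrientation hσ
    (T := singleOp (Sum.inr ⟨g, hg⟩) (axisPauli k)) (singleOp_sq _ (axisPauli_sq k)) f ?_ hx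
    (hcomm _)
  intro i j hij
  have h := ho.adj i j hij
  have hiff : (i ∈ g.verts ∧ j ∈ g.verts ∧ edgeAxis i j = d) ↔
      edgeOfAdj h = edgeOfAdj huv.adj ∨ edgeOfAdj h = edgeOfAdj huv'.adj := by
    constructor
    · rintro ⟨gi, gj, hax⟩
      have h₁ := Face.edgeLow_eq h gi gj
      have h₂ := val_axis_of_adj h
      rw [hax] at h₁ h₂
      change edgeLow i j = (u d).val at h₁
      have h₃ := gi.2 k hmk.symm
      change (i k).val = (u k).val ∨ (i k).val = (u k).val + 1 at h₃
      have h₄ : (i m).val = (u m).val := congrArg Fin.val gi.1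
      have h₅ := val_eq_of_adj h (d := k) (by rw [hax]; exact hdk.symm)
      have h₆ := val_eq_of_adj h (d := m) (by rw [hax]; exact hmd)
      have inf_eq : ∀ w : Vertex n, (w d).val = (u d).val → (w k).val = (i k).val →
          (w m).val = (u m).val → i ⊓ j = w := by
        intro w hw₁ hw₂ hw₃
        refine vertex_ext fun y => ?_
        simp only [Pi.inf_apply, Fin.coe_min]
        rcases hm y with rfl | rfl | rfl <;> omega
      rw [huv.edgeOfAdj_eq, huv'.edgeOfAdj_eq]
      rcases h₃ with h₃ | h₃
      · left
        exact Subtype.ext (Prod.ext hax (inf_eq u rfl h₃.symm rfl))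
      · right
        refine Subtype.ext (Prod.ext hax (inf_eq u' (huu'.val_eq hdk) ?_ (huu'.val_eq hmk)))
        rw [huu'.val_add_one, h₃]
    · rintro (e | e)
      · have hax : edgeAxis i j = edgeAxis u v := congrArg (fun e => e.1.1) e
        rw [huv.edgeAxis_eq] at hax
        rcases (edgeOfAdj_eq_iff _ _).mp e with ⟨rfl, rfl⟩ | ⟨rfl, rfl⟩
        · exact ⟨gu, gv, hax⟩
        · exact ⟨gv, gu, hax⟩
      · have hax : edgeAxis i j = edgeAxis u' v' := congrArg (fun e => e.1.1) e
        rw [huv'.edgeAxis_eq] at hax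
        rcases (edgeOfAdj_eq_iff _ _).mp e with ⟨rfl, rfl⟩ | ⟨rfl, rfl⟩
        · exact ⟨gu', gv', hax⟩
        · exact ⟨gv', gu', hax⟩
  have hfs : f (Pi.single (edgeOfAdj h) 1) =
      if i ∈ g.verts ∧ j ∈ g.verts ∧ edgeAxis i j = d then 1 else 0 := by
    simp only [f, LinearMap.add_apply, LinearMap.proj_apply, Pi.single_apply, hiff]
    by_cases e₁ : edgeOfAdj h = edgeOfAdj huv.adj
    · rw [e₁]; simp [hne.symm]
    · by_cases e₂ : edgeOfAdj h = edgeOfAdj huv'.adj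
      · rw [e₂]; simp [hne]
      · simp [e₁, e₂, Ne.symm e₁, Ne.symm e₂]
  rw [unsignedEdgeOp_eq]
  refine tensorOp_mul_singleOp ?_ ?_
  · rw [hfs, ite_eq_right_iff]
    intro h0
    simp only [edgePauli]
    split_ifs with hg'
    · have hax : edgeAxis i j = k := by
        rcases hm (edgeAxis i j) with e | e | e
        · exact absurd (h0 ⟨hg'.1, hg'.2, e⟩) one_ne_zero
        · exact e
        · exact absurd e (Face.axis_ne_normal h hg'.1 hg'.2)
      rw [hax]
    · simp
  · rw [hfs, ite_eq_left_iff]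
    intro h1
    have h1 : i ∈ g.verts ∧ j ∈ g.verts ∧ edgeAxis i j = d := by
      by_contra hh
      exact zero_ne_one (h1 hh)
    simp only [edgePauli]
    rw [if_pos ⟨h1.1, h1.2.1⟩, h1.2.2, axisPauli_anticomm hdk]

/-- The edges of a cycle whose operator is a scalar form a balanced vector. -/
theorem mem_balanced_of_commute (ho : IsCompactOrientation o) (hc : IsTypedBy o c)
    {pick : Face n → Vertex n × Vertex n} {σ : MG (lattice n) →* QubitOp (Qubit o)}
    (hσ : IsCubicEncoding o pick σ) {x : MG (lattice n)} (hx : x ∈ cycleGroup (lattice n))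
    (hcomm : ∀ T, σ x * T = T * σ x) :
    Multiplicative.toAdd (edgeHom (latticeLabelling n) x) ∈ balanced c := by
  refine ⟨sum_cellValues_eq_zero ho hc hσ hx hcomm, fun d k u u' h hdk hd ht => ?_⟩
  have huv := isStep_shift u d hd
  obtain ⟨v', -, huv'⟩ := huv.exists_square h hdk
  have := parallel_edges_eq ho hc hσ hx hcomm huv h huv' hdk ht
  rwa [huv.edgeOfAdj_eq, huv'.edgeOfAdj_eq] at this

end Balanced

section Loops

variable {n : Fin 3 → ℕ} {o : Vertex n → Vertex n → Prop} {c : Fin 3 → ℕ}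
variable {i j : Vertex n}

/-! ### Odd cells and isolated odd faces -/

theorem Face.base_val_of_subset {f : Face n} {p : Cell n} (h : f.verts ⊆ p.verts) {d : Fin 3}
    (hd : d ≠ f.normal) : (f.base d).val = (p.1 d).val := by
  have h₁ := h f.base_mem_verts d
  have hs := isStep_shift f.base d (f.lt hd)
  have h₂ := h (Face.mem_verts_of_isStep hs hd f.base_mem_verts rfl) d
  rw [hs.val_add_one] at h₂
  omega

/-- Any two axes are compared by the face of the cell at its base vertex, and every other face of
the cell has the same base coordinates along its own axes. -/
theorem isOddCell_iff (ho : IsCompactOrientation o) (hc : IsTypedBy o c) (p : Cell n) :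
    IsOddCell o p ↔ ∀ a b, edgeType c a (p.1 a).val = edgeType c b (p.1 b).val := by
  constructor
  · intro h a b
    by_cases hab : a = b
    · rw [hab]
    obtain ⟨k, hka, hkb, hk⟩ := exists_third_axis hab
    let f : Face n := ⟨(k, p.1), fun d _ => p.2 d⟩
    have hf : f.verts ⊆ p.verts := by
      intro v hv d
      by_cases hd : d = k
      · subst hd; exact Or.inl (congrArg Fin.val hv.1)
      · exact hv.2 d hd
    exact (isOddFace_iff ho hc f).mp (h f hf) a b hka.symm hkb.symm
  · intro h f hf
    rw [isOddFace_iff ho hc]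
    intro a b ha hb
    rw [Face.base_val_of_subset hf ha, Face.base_val_of_subset hf hb]
    exact h a b

/-- Two faces share an edge along the axis `d`. -/
def ShareEdge (d : Fin 3) (f g : Face n) : Prop :=
  ∃ i j, (lattice n).Adj i j ∧ edgeAxis i j = d ∧
    i ∈ f.verts ∧ j ∈ f.verts ∧ i ∈ g.verts ∧ j ∈ g.verts

/-- The edges of two odd faces with a common edge have the same type. -/
theorem edgeType_eq_of_shareEdge (ho : IsCompactOrientation o) (hc : IsTypedBy o c) {f g : Face n}
    (hf : IsOddFace o f) (hg : IsOddFace o g) {d : Fin 3} (h : ShareEdge d f g) {a b : Fin 3}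
    (ha : a ≠ f.normal) (hb : b ≠ g.normal) :
    edgeType c a (f.base a).val = edgeType c b (g.base b).val := by
  obtain ⟨i, j, hij, rfl, fi, fj, gi, gj⟩ := h
  rw [(isOddFace_iff ho hc f).mp hf a _ ha (Face.axis_ne_normal hij fi fj),
    (isOddFace_iff ho hc g).mp hg b _ hb (Face.axis_ne_normal hij gi gj),
    ← Face.edgeLow_eq hij fi fj, ← Face.edgeLow_eq hij gi gj]

/-- Parallel odd faces with a common edge are equal. -/
theorem eq_of_shareEdge_of_normal_eq (ho : IsCompactOrientation o) (hc : IsTypedBy o c)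
    {f g : Face n} (hf : IsOddFace o f) (hg : IsOddFace o g) {d : Fin 3} (h : ShareEdge d f g)
    (hn : f.normal = g.normal) : f = g := by
  have ht := fun a => edgeType_eq_of_shareEdge ho hc hf hg h (a := a) (b := a)
  obtain ⟨i, j, hij, -, fi, fj, gi, gj⟩ := h
  refine face_ext hn fun a => ?_
  by_cases ha : a = f.normal
  · have h₁ := fi.1
    have h₂ := gi.1
    rw [← hn] at h₂
    rw [ha, ← h₁, ← h₂]
  · have ha' : a ≠ g.normal := hn ▸ ha
    -- A common vertex puts the base coordinates of both faces within distance one, and equal types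
    -- give them the same parity.
    have h₁ := fi.2 a ha
    have h₂ := gi.2 a ha'
    have h₃ := ht a ha ha'
    rw [edgeType, edgeType] at h₃
    omega

/-- An isolated odd face shares its edges with no other odd face. -/
theorem IsIsolatedOddFace.eq_of_shareEdge (ho : IsCompactOrientation o) (hc : IsTypedBy o c)
    {f g : Face n} (hf : IsIsolatedOddFace o f) (hg : IsOddFace o g) {d : Fin 3}
    (h : ShareEdge d f g) : f = g := by
  by_contra hne
  have hn : f.normal ≠ g.normal := fun e =>
    hne (eq_of_shareEdge_of_normal_eq ho hc hf.odd hg h e)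
  have ht := fun a b => edgeType_eq_of_shareEdge ho hc hf.odd hg h (a := a) (b := b)
  have hf' := (isOddFace_iff ho hc f).mp hf.odd
  have hg' := (isOddFace_iff ho hc g).mp hg
  obtain ⟨i, j, hij, -, fi, fj, gi, gj⟩ := h
  -- Two perpendicular odd faces with a common edge span a cell. The common edge forces all its
  -- edges to have one type, so the cell is odd and contains `f`, contrary to isolation.
  let p : Cell n := ⟨Function.update f.base f.normal (g.base f.normal), fun a => by
    by_cases ha : a = f.normal
    · subst ha; simpa using g.lt hn
    · simpa [ha] using f.lt ha⟩
  refine hf.isolated p ((isOddCell_iff ho hc p).mpr ?_) ?_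
  · have key : ∀ a, edgeType c a (p.1 a).val = edgeType c f.normal (g.base f.normal).val := by
      intro a
      by_cases ha : a = f.normal
      · subst ha; simp [p]
      · rw [← ht a f.normal ha hn]; simp [p, ha]
    intro a b
    rw [key a, key b]
  · intro v hv a
    by_cases ha : a = f.normal
    · subst ha
      have h₁ := gi.2 f.normal hn
      rw [fi.1, ← hv.1] at h₁
      simpa [p] using h₁
    · simpa [p, ha] using hv.2 a ha

/-! ### The loop around an odd face -/

/-- An odd face has two sources `p`, `q` and two sinks `r`, `t`. -/
structure IsOddSquare (o : Vertex n → Vertex n → Prop) (f : Face n) (p q r t : Vertex n) :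
    Prop where
  mem_p : p ∈ f.verts
  mem_q : q ∈ f.verts
  mem_r : r ∈ f.verts
  mem_t : t ∈ f.verts
  cover : ∀ x ∈ f.verts, x = p ∨ x = q ∨ x = r ∨ x = t
  pr : o p r
  qr : o q r
  qt : o q t
  pt : o p t
  axis_eq₁ : edgeAxis q t = edgeAxis p r
  axis_eq₂ : edgeAxis p t = edgeAxis q r
  axis_ne : edgeAxis p r ≠ edgeAxis q r

/-- All four edges have one type while the parity alternates around the face, so the corners of one
parity are sources and those of the other are sinks. -/
theorem exists_isOddSquare (ho : IsCompactOrientation o) (hc : IsTypedBy o c) {f : Face n}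
    (hf : IsOddFace o f) : ∃ p q r t, IsOddSquare o f p q r t := by
  obtain ⟨a, b, hab, hka, hkb, hall⟩ := exists_other_axes f.normal
  have mu := f.base_mem_verts
  have hu := isStep_shift f.base a (f.lt hka.symm)
  have hu' := isStep_shift f.base b (f.lt hkb.symm)
  generalize hua : shift f.base a (f.lt hka.symm) = ua at hu
  generalize hub : shift f.base b (f.lt hkb.symm) = ub at hu'
  obtain ⟨w, hv, hw⟩ := hu.exists_square hu' hab
  have mv : ua ∈ f.verts := Face.mem_verts_of_isStep hu hka.symm mu rfl
  have mu' : ub ∈ f.verts := Face.mem_verts_of_isStep hu' hkb.symm mu rfl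
  have mw : w ∈ f.verts := Face.mem_verts_of_isStep hv hkb.symm mv (hu.val_eq hab.symm)
  have cover : ∀ x ∈ f.verts, x = f.base ∨ x = w ∨ x = ua ∨ x = ub := by
    intro x hx
    have key : ∀ y ∈ f.verts, (x a).val = (y a).val → (x b).val = (y b).val → x = y := by
      intro y hy h₁ h₂
      refine vertex_ext fun d => ?_
      rcases hall d with rfl | rfl | rfl
      · exact h₁
      · exact h₂
      · rw [hx.1, hy.1]
    have ha := hx.2 a hka.symm
    have hb := hx.2 b hkb.symm
    have e₁ := hu.val_add_one
    have e₂ := hu.val_eq hab.symm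
    have e₃ := hu'.val_add_one
    have e₄ := hu'.val_eq hab
    have e₅ := hw.val_add_one
    have e₆ := hw.val_eq hab.symm
    rcases ha with ha | ha <;> rcases hb with hb | hb
    · exact Or.inl (key _ mu ha hb)
    · exact Or.inr (Or.inr (Or.inr (key _ mu' (by omega) (by omega))))
    · exact Or.inr (Or.inr (Or.inl (key _ mv (by omega) (by omega))))
    · exact Or.inr (Or.inl (key _ mw (by omega) (by omega)))
  have s₁ := hu.coordSum_eq
  have s₂ := hu'.coordSum_eq
  have s₃ := hw.coordSum_eq
  have t₁ := dartType_eq_of_isOddFace ho hc hf hu.adj hu'.adj mu mv mu mu'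
  have t₂ := dartType_eq_of_isOddFace ho hc hf hu.adj hv.adj mu mv mv mw
  have t₃ := dartType_eq_of_isOddFace ho hc hf hu.adj hw.adj mu mv mu' mw
  have lt := dartType_lt c f.base ua
  have ho' := ho.toIsOrientation
  have c₁ := edgeAxis_comm ua f.base
  have c₂ := edgeAxis_comm ub f.base
  have c₃ := edgeAxis_comm w ua
  have c₄ := edgeAxis_comm w ub
  have x₁ := hu.edgeAxis_eq
  have x₂ := hu'.edgeAxis_eq
  have x₃ := hv.edgeAxis_eq
  have x₄ := hw.edgeAxis_eq
  -- If the type of the edges is the parity of the base vertex, the base is a sink, otherwise a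
  -- source.
  by_cases hs : dartType c f.base ua = coordSum f.base % 2
  · refine ⟨ua, ub, f.base, w, mv, mu', mu, mw, fun x hx => by have := cover x hx; tauto,
      ?_, ?_, ?_, ?_, ?_, ?_, ?_⟩
    · rw [hc.iff_dartType ho' hu.adj.symm, dartType_comm]; omega
    · rw [hc.iff_dartType ho' hu'.adj.symm, dartType_comm]; omega
    · rw [hc.iff_dartType ho' hw.adj]; omega
    · rw [hc.iff_dartType ho' hv.adj]; omega
    · rw [x₄, c₁, x₁]
    · rw [x₃, c₂, x₂]
    · rw [c₁, c₂, x₁, x₂]; exact hab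
  · refine ⟨f.base, w, ua, ub, mu, mw, mv, mu', cover, ?_, ?_, ?_, ?_, ?_, ?_, ?_⟩
    · rw [hc.iff_dartType ho' hu.adj]; omega
    · rw [hc.iff_dartType ho' hv.adj.symm, dartType_comm]; omega
    · rw [hc.iff_dartType ho' hw.adj.symm, dartType_comm]; omega
    · rw [hc.iff_dartType ho' hu'.adj]; omega
    · rw [c₄, x₄, x₁]
    · rw [x₂, c₃, x₃]
    · rw [c₃, x₁, x₃]; exact hab

/-! ### The edges of the loop around an odd face -/

namespace IsOddSquare

variable {f : Face n} {p q r t : Vertex n}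

theorem p_ne_q (h : IsOddSquare o f p q r t) : p ≠ q := by
  rintro rfl; exact h.axis_ne rfl

theorem r_ne_t (h : IsOddSquare o f p q r t) : r ≠ t := by
  rintro rfl; exact h.axis_ne h.axis_eq₂

/-- The oriented edges of an odd face. -/
theorem edge_cases (h : IsOddSquare o f p q r t) (ho : IsOrientation o) (hi : i ∈ f.verts)
    (hj : j ∈ f.verts) (hij : o i j) :
    (i = p ∧ j = r) ∨ (i = q ∧ j = r) ∨ (i = q ∧ j = t) ∨ (i = p ∧ j = t) := by
  have a₁ := coordSum_of_adj (ho.adj _ _ h.pr)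
  have a₂ := coordSum_of_adj (ho.adj _ _ h.qr)
  have a₃ := coordSum_of_adj (ho.adj _ _ h.qt)
  have a₄ := coordSum_of_adj (ho.adj _ _ hij)
  have b₁ := (ho.xor _ _ (ho.adj _ _ h.pr)).mp h.pr
  have b₂ := (ho.xor _ _ (ho.adj _ _ h.qr)).mp h.qr
  have b₃ := (ho.xor _ _ (ho.adj _ _ h.qt)).mp h.qt
  have b₄ := (ho.xor _ _ (ho.adj _ _ h.pt)).mp h.pt
  rcases h.cover i hi with rfl | rfl | rfl | rfl <;>
    rcases h.cover j hj with rfl | rfl | rfl | rfl <;> first | (exfalso; omega) | tauto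

/-- The walk around an odd face. -/
def walk (h : IsOddSquare o f p q r t) (ho : IsOrientation o) : (lattice n).Walk p p :=
  .cons (ho.adj _ _ h.pr) (.cons (ho.adj _ _ h.qr).symm (.cons (ho.adj _ _ h.qt)
    (.cons (ho.adj _ _ h.pt).symm .nil)))

open Classical in
-- The four edges of the loop are distinct, so nothing cancels modulo two; they are exactly the
-- edges of the face, described by axis and lower end.
theorem edgeVec_walk (h : IsOddSquare o f p q r t) (ho : IsOrientation o) (d : Fin 3)
    (w : Vertex n) (hw : (w d).val + 1 < n d) :
    edgeVec (latticeLabelling n) (h.walk ho) ⟨(d, w), hw⟩ =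
      if d ≠ f.normal ∧ w ∈ f.verts ∧ (w d).val = (f.base d).val then 1 else 0 := by
  have hs := isStep_shift w d hw
  have hiff : (d ≠ f.normal ∧ w ∈ f.verts ∧ (w d).val = (f.base d).val) ↔
      edgeOfAdj hs.adj = edgeOfAdj (ho.adj _ _ h.pr) ∨
      edgeOfAdj hs.adj = edgeOfAdj (ho.adj _ _ h.qr) ∨
      edgeOfAdj hs.adj = edgeOfAdj (ho.adj _ _ h.qt) ∨
      edgeOfAdj hs.adj = edgeOfAdj (ho.adj _ _ h.pt) := by
    constructor
    · rintro ⟨hd, hwf, hb⟩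
      have hwf' := Face.mem_verts_of_isStep hs hd hwf hb
      simp only [edgeOfAdj_eq_iff]
      by_cases hor : o w (shift w d hw)
      · have := h.edge_cases ho hwf hwf' hor
        tauto
      · have := h.edge_cases ho hwf' hwf ((ho.not_iff hs.adj).mp hor)
        tauto
    · intro hh
      have key : ∀ {i j : Vertex n} (hij : (lattice n).Adj i j), i ∈ f.verts → j ∈ f.verts →
          edgeOfAdj hs.adj = edgeOfAdj hij →
          d ≠ f.normal ∧ w ∈ f.verts ∧ (w d).val = (f.base d).val := by
        intro i j hij hi hj e
        have : w ∈ f.verts ∧ shift w d hw ∈ f.verts := by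
          rcases (edgeOfAdj_eq_iff _ _).mp e with ⟨h₁, h₂⟩ | ⟨h₁, h₂⟩
          · exact ⟨by rwa [h₁], by rwa [h₂]⟩
          · exact ⟨by rwa [h₁], by rwa [h₂]⟩
        have h₁ := Face.axis_ne_normal hs.adj this.1 this.2
        have h₂ := Face.edgeLow_eq hs.adj this.1 this.2
        rw [hs.edgeAxis_eq] at h₁ h₂
        rw [hs.edgeLow_eq] at h₂
        exact ⟨h₁, this.1, h₂⟩
      rcases hh with hh | hh | hh | hh
      · exact key _ h.mem_p h.mem_r hh
      · exact key _ h.mem_q h.mem_r hh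
      · exact key _ h.mem_q h.mem_t hh
      · exact key _ h.mem_p h.mem_t hh
  have hpq := h.p_ne_q
  have hrt := h.r_ne_t
  have hpr := (ho.adj _ _ h.pr).ne
  have hqr := (ho.adj _ _ h.qr).ne
  have hqt := (ho.adj _ _ h.qt).ne
  have hpt := (ho.adj _ _ h.pt).ne
  have n₁ : edgeOfAdj (ho.adj _ _ h.pr) ≠ edgeOfAdj (ho.adj _ _ h.qr) := by
    rw [Ne, edgeOfAdj_eq_iff]; tauto
  have n₂ : edgeOfAdj (ho.adj _ _ h.pr) ≠ edgeOfAdj (ho.adj _ _ h.qt) := by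
    rw [Ne, edgeOfAdj_eq_iff]; tauto
  have n₃ : edgeOfAdj (ho.adj _ _ h.pr) ≠ edgeOfAdj (ho.adj _ _ h.pt) := by
    rw [Ne, edgeOfAdj_eq_iff]; tauto
  have n₄ : edgeOfAdj (ho.adj _ _ h.qr) ≠ edgeOfAdj (ho.adj _ _ h.qt) := by
    rw [Ne, edgeOfAdj_eq_iff]; tauto
  have n₅ : edgeOfAdj (ho.adj _ _ h.qr) ≠ edgeOfAdj (ho.adj _ _ h.pt) := by
    rw [Ne, edgeOfAdj_eq_iff]; tauto
  have n₆ : edgeOfAdj (ho.adj _ _ h.qt) ≠ edgeOfAdj (ho.adj _ _ h.pt) := by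
    rw [Ne, edgeOfAdj_eq_iff]; tauto
  have e₂ := edgeOfAdj_comm (ho.adj _ _ h.qr)
  have e₄ := edgeOfAdj_comm (ho.adj _ _ h.pt)
  rw [← hs.edgeOfAdj_eq, if_congr hiff rfl rfl]
  simp only [walk, edgeVec_cons, latticeLabelling, e₂, e₄]
  simp only [edgeVec, SimpleGraph.Walk.darts_nil, List.map_nil, List.sum_nil, Pi.add_apply,
    Pi.single_apply, add_zero]
  by_cases c₁ : edgeOfAdj hs.adj = edgeOfAdj (ho.adj _ _ h.pr)
  · simp only [c₁, n₁, n₂, n₃, if_true, if_false, true_or, add_zero]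
  by_cases c₂ : edgeOfAdj hs.adj = edgeOfAdj (ho.adj _ _ h.qr)
  · simp only [c₂, n₁.symm, n₄, n₅, if_true, if_false, true_or, or_true, add_zero, zero_add]
  by_cases c₃ : edgeOfAdj hs.adj = edgeOfAdj (ho.adj _ _ h.qt)
  · simp only [c₃, n₂.symm, n₄.symm, n₆, if_true, if_false, true_or, or_true, add_zero, zero_add]
  simp only [c₁, c₂, c₃, if_false, false_or, zero_add]

end IsOddSquare

end Loops

section LoopOperators

variable {n : Fin 3 → ℕ} {o : Vertex n → Vertex n → Prop} {c : Fin 3 → ℕ}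
variable {i j : Vertex n}

/-! ### The operator of the loop around an odd face -/

open Classical in
/-- The Pauli matrix with which the loop around `f` acts on the qubit of another face `g`. -/
def sidePauli (f g : Face n) : Matrix (Fin 2) (Fin 2) ℂ :=
  if h : ∃ d, g ≠ f ∧ ShareEdge d f g then axisPauli h.choose else 1

/-- The operator of the loop around `f`, up to a sign. -/
def sideOp (o : Vertex n → Vertex n → Prop) (f : Face n) : QubitOp (Qubit o) :=
  tensorOp fun
    | Sum.inl _ => 1
    | Sum.inr g => sidePauli f g.1

theorem sidePauli_sq (f g : Face n) : sidePauli f g * sidePauli f g = 1 := by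
  rw [sidePauli]
  split_ifs
  · exact axisPauli_sq _
  · simp

theorem sideOp_sq (f : Face n) : sideOp o f * sideOp o f = 1 := by
  rw [sideOp, tensorOp_mul]
  refine tensorOp_eq_one fun q => ?_
  rcases q with u | g
  · simp
  · exact sidePauli_sq f g.1

theorem sidePauli_self (f : Face n) : sidePauli f f = 1 := by
  rw [sidePauli, dif_neg]
  rintro ⟨d, h, -⟩
  exact h rfl

theorem sidePauli_of_not {f g : Face n} (h : ∀ d, ¬ ShareEdge d f g) : sidePauli f g = 1 := by
  rw [sidePauli, dif_neg]
  rintro ⟨d, -, hd⟩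
  exact h d hd

/-- Different faces cannot share edges along two axes, since perpendicular edges determine a face.
So the axis chosen in `sidePauli` is the only possible one. -/
theorem sidePauli_of_shareEdge {f g : Face n} {d : Fin 3} (hne : g ≠ f) (h : ShareEdge d f g) :
    sidePauli f g = axisPauli d := by
  have hex : ∃ d, g ≠ f ∧ ShareEdge d f g := ⟨d, hne, h⟩
  rw [sidePauli, dif_pos hex]
  congr 1
  obtain ⟨-, h'⟩ := hex.choose_spec
  by_contra hd
  obtain ⟨i, j, hij, hax, fi, fj, gi, gj⟩ := h
  obtain ⟨k, l, hkl, hax', fk, fl, gk, gl⟩ := h'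
  exact hne (Face.eq_of_perpendicular hij hkl (by rw [hax, hax']; exact Ne.symm hd)
    gi gj gk gl fi fj fk fl)

theorem axisPauli_loop {a b : Fin 3} (h : a ≠ b) :
    axisPauli a * axisPauli b * axisPauli a * axisPauli b = -1 := by
  rw [axisPauli_anticomm h, neg_mul, mul_assoc, axisPauli_sq, mul_one, neg_mul, axisPauli_sq]

/-- Each source receives `X * X` and each sink `Y * Y`. On the qubit of `f` the two axes alternate,
which gives `-1`. Any other odd face contains at most one edge of the loop. -/
theorem IsOddSquare.unsigned_loop {f : Face n} {p q r t : Vertex n}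
    (h : IsOddSquare o f p q r t) (ho : IsOrientation o) (hf : IsOddFace o f) :
    unsignedEdgeOp o p r * unsignedEdgeOp o q r * unsignedEdgeOp o q t * unsignedEdgeOp o p t =
      -sideOp o f := by
  have apr := ho.adj _ _ h.pr
  have aqr := ho.adj _ _ h.qr
  have aqt := ho.adj _ _ h.qt
  have apt := ho.adj _ _ h.pt
  simp only [unsignedEdgeOp_eq, tensorOp_mul, sideOp]
  refine tensorOp_eq_neg (Sum.inr ⟨f, hf⟩) ?_ fun x hx => ?_
  · simp only [edgePauli, h.mem_p, h.mem_q, h.mem_r, h.mem_t, and_self, if_true, h.axis_eq₁,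
      h.axis_eq₂, sidePauli_self]
    exact axisPauli_loop h.axis_ne
  · rcases x with u | ⟨g, hg⟩
    · have hpq := h.p_ne_q
      have hrt := h.r_ne_t
      have npr := apr.ne
      have nqr := aqr.ne
      have nqt := aqt.ne
      have npt := apt.ne
      simp only [edgePauli]
      by_cases hp : u = p
      · subst hp; simp [hpq, npr, npt, pauliX_sq]
      by_cases hq : u = q
      · subst hq; simp [hp, nqr, nqt, pauliX_sq]
      by_cases hr : u = r
      · subst hr; simp [hp, hq, hrt, pauliY_sq]
      by_cases ht : u = t
      · subst ht; simp [hp, hq, hr, pauliY_sq]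
      simp [hp, hq, hr, ht]
    · have hgf : g ≠ f := fun e => hx (by subst e; rfl)
      have perp : ∀ {i j k l : Vertex n}, (lattice n).Adj i j → (lattice n).Adj k l →
          edgeAxis i j ≠ edgeAxis k l → i ∈ f.verts → j ∈ f.verts → k ∈ f.verts → l ∈ f.verts →
          i ∈ g.verts → j ∈ g.verts → ¬ (k ∈ g.verts ∧ l ∈ g.verts) :=
        fun h₁ h₂ h₃ fi fj fk fl gi gj gkl =>
          hgf (Face.eq_of_perpendicular h₁ h₂ h₃ gi gj gkl.1 gkl.2 fi fj fk fl)
      have ax₁ : edgeAxis p r ≠ edgeAxis p t := by rw [h.axis_eq₂]; exact h.axis_ne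
      have ax₂ : edgeAxis q t ≠ edgeAxis p t := by rw [h.axis_eq₁]; exact ax₁
      have ax₃ : edgeAxis q t ≠ edgeAxis q r := by rw [h.axis_eq₁]; exact h.axis_ne
      simp only [edgePauli]
      by_cases c₁ : p ∈ g.verts ∧ r ∈ g.verts
      · have n₂ := perp apr aqr h.axis_ne h.mem_p h.mem_r h.mem_q h.mem_r c₁.1 c₁.2
        have n₄ := perp apr apt ax₁ h.mem_p h.mem_r h.mem_p h.mem_t c₁.1 c₁.2
        have n₃ : ¬ (q ∈ g.verts ∧ t ∈ g.verts) := fun hh => n₂ ⟨hh.1, c₁.2⟩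
        rw [if_pos c₁, if_neg n₂, if_neg n₃, if_neg n₄, sidePauli_of_shareEdge hgf
          ⟨p, r, apr, rfl, h.mem_p, h.mem_r, c₁.1, c₁.2⟩]
        simp
      by_cases c₂ : q ∈ g.verts ∧ r ∈ g.verts
      · have n₃ := perp aqr aqt ax₃.symm h.mem_q h.mem_r h.mem_q h.mem_t c₂.1 c₂.2
        have n₄ : ¬ (p ∈ g.verts ∧ t ∈ g.verts) := fun hh => n₃ ⟨c₂.1, hh.2⟩
        rw [if_neg c₁, if_pos c₂, if_neg n₃, if_neg n₄, sidePauli_of_shareEdge hgf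
          ⟨q, r, aqr, rfl, h.mem_q, h.mem_r, c₂.1, c₂.2⟩]
        simp
      by_cases c₃ : q ∈ g.verts ∧ t ∈ g.verts
      · have n₄ := perp aqt apt ax₂ h.mem_q h.mem_t h.mem_p h.mem_t c₃.1 c₃.2
        rw [if_neg c₁, if_neg c₂, if_pos c₃, if_neg n₄, sidePauli_of_shareEdge hgf
          ⟨q, t, aqt, rfl, h.mem_q, h.mem_t, c₃.1, c₃.2⟩]
        simp
      by_cases c₄ : p ∈ g.verts ∧ t ∈ g.verts
      · rw [if_neg c₁, if_neg c₂, if_neg c₃, if_pos c₄, sidePauli_of_shareEdge hgf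
          ⟨p, t, apt, rfl, h.mem_p, h.mem_t, c₄.1, c₄.2⟩]
        simp
      rw [if_neg c₁, if_neg c₂, if_neg c₃, if_neg c₄, sidePauli_of_not]
      · simp
      · rintro d ⟨i, j, hij, -, fi, fj, gi, gj⟩
        by_cases hor : o i j
        · rcases h.edge_cases ho fi fj hor with ⟨rfl, rfl⟩ | ⟨rfl, rfl⟩ | ⟨rfl, rfl⟩ | ⟨rfl, rfl⟩
            <;> tauto
        · rcases h.edge_cases ho fj fi ((ho.not_iff hij).mp hor) with
            ⟨rfl, rfl⟩ | ⟨rfl, rfl⟩ | ⟨rfl, rfl⟩ | ⟨rfl, rfl⟩ <;> tauto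

open Classical in
/-- The sign of an edge of an odd face. -/
theorem pickSign_eq (ho : IsCompactOrientation o) (hc : IsTypedBy o c)
    {pick : Face n → Vertex n × Vertex n} (hpick : IsEdgeChoice o pick) {f : Face n}
    (hf : IsOddFace o f) (hij : o i j) (hi : i ∈ f.verts) (hj : j ∈ f.verts) :
    pickSign o pick i j = if IsIsolatedOddFace o f ∧ pick f = (i, j) then -1 else 1 := by
  rw [pickSign]
  refine if_congr ⟨?_, fun h => ⟨f, h⟩⟩ rfl rfl
  rintro ⟨g, hg, hgp⟩
  have hm := hpick g hg
  rw [hgp] at hm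
  -- An isolated face whose chosen edge belongs to the odd face `f` shares that edge with `f`, hence
  -- is `f`.
  have : g = f := hg.eq_of_shareEdge ho hc hf
    ⟨i, j, ho.adj _ _ hij, rfl, hm.1, hm.2.1, hi, hj⟩
  subst this
  exact ⟨hg, hgp⟩

open Classical in
/-- The operator of the loop around an odd face. -/
theorem IsOddSquare.map_loop {f : Face n} {p q r t : Vertex n}
    (h : IsOddSquare o f p q r t) (ho : IsCompactOrientation o) (hc : IsTypedBy o c)
    {pick : Face n → Vertex n × Vertex n} (hpick : IsEdgeChoice o pick) (hf : IsOddFace o f)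
    {σ : MG (lattice n) →* QubitOp (Qubit o)} (hσ : IsCubicEncoding o pick σ) :
    σ (cycleElement (h.walk ho.toIsOrientation)) =
      if IsIsolatedOddFace o f then sideOp o f else -sideOp o f := by
  have ho' := ho.toIsOrientation
  have nrq := (ho'.xor _ _ (ho.adj _ _ h.qr)).mp h.qr
  have ntp := (ho'.xor _ _ (ho.adj _ _ h.pt)).mp h.pt
  -- Exactly one of the four distinct edges of an isolated face is the chosen one; no edge of any
  -- other odd face carries a sign.
  have hsign : pickSign o pick p r * pickSign o pick q r * pickSign o pick q t *
      pickSign o pick p t = if IsIsolatedOddFace o f then -1 else 1 := by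
    rw [pickSign_eq ho hc hpick hf h.pr h.mem_p h.mem_r,
      pickSign_eq ho hc hpick hf h.qr h.mem_q h.mem_r,
      pickSign_eq ho hc hpick hf h.qt h.mem_q h.mem_t,
      pickSign_eq ho hc hpick hf h.pt h.mem_p h.mem_t]
    by_cases hi : IsIsolatedOddFace o f
    · have hpq := h.p_ne_q
      have hrt := h.r_ne_t
      have hm := hpick f hi
      rcases hpf : pick f with ⟨i, j⟩
      rw [hpf] at hm
      rcases h.edge_cases ho' hm.1 hm.2.1 hm.2.2 with
        ⟨rfl, rfl⟩ | ⟨rfl, rfl⟩ | ⟨rfl, rfl⟩ | ⟨rfl, rfl⟩ <;>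
      simp [hi, hpq, hpq.symm, hrt, hrt.symm]
    · simp [hi]
  have hlen : (h.walk ho').length = 4 := rfl
  -- The phase is `i ^ 4 = 1`, and the loop runs against two of its edges, so those two signs
  -- cancel.
  have hprod : σ (cycleElement (h.walk ho')) =
      (pickSign o pick p r * pickSign o pick q r * pickSign o pick q t * pickSign o pick p t) •
      (unsignedEdgeOp o p r * unsignedEdgeOp o q r * unsignedEdgeOp o q t *
        unsignedEdgeOp o p t) := by
    rw [cycleElement, hlen, show ((4 : ℕ) : ZMod 4) = 0 from rfl, gen_phase_zero, one_mul]
    have e₁ : σ (gen (.edge ⟨(p, r), ho.adj _ _ h.pr⟩)) =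
        pickSign o pick p r • unsignedEdgeOp o p r := by
      rw [hσ, generatorOp, if_pos h.pr, orientedEdgeOp_eq]
    have e₂ : σ (gen (.edge ⟨(r, q), (ho.adj _ _ h.qr).symm⟩)) =
        (-pickSign o pick q r) • unsignedEdgeOp o q r := by
      rw [hσ, generatorOp, if_neg nrq, orientedEdgeOp_eq, neg_smul]
    have e₃ : σ (gen (.edge ⟨(q, t), ho.adj _ _ h.qt⟩)) =
        pickSign o pick q t • unsignedEdgeOp o q t := by
      rw [hσ, generatorOp, if_pos h.qt, orientedEdgeOp_eq]
    have e₄ : σ (gen (.edge ⟨(t, p), (ho.adj _ _ h.pt).symm⟩)) =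
        (-pickSign o pick p t) • unsignedEdgeOp o p t := by
      rw [hσ, generatorOp, if_neg ntp, orientedEdgeOp_eq, neg_smul]
    simp only [IsOddSquare.walk, SimpleGraph.Walk.darts_cons, SimpleGraph.Walk.darts_nil,
      List.map_cons, List.map_nil, List.prod_cons, List.prod_nil, map_mul, mul_one]
    rw [e₁, e₂, e₃, e₄, smul_mul_smul_comm, smul_mul_smul_comm, smul_mul_smul_comm,
      show pickSign o pick p r * (-pickSign o pick q r * (pickSign o pick q t *
        -pickSign o pick p t)) = pickSign o pick p r * pickSign o pick q r * pickSign o pick q t *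
        pickSign o pick p t by ring, mul_assoc (unsignedEdgeOp o p r * _),
      mul_assoc (unsignedEdgeOp o p r)]
  rw [hprod, hsign, h.unsigned_loop ho' hf]
  split_ifs <;> simp

/-- The loop around an isolated odd face acts trivially. -/
theorem sideOp_eq_one_of_isIsolatedOddFace (ho : IsCompactOrientation o) (hc : IsTypedBy o c)
    {f : Face n} (hf : IsIsolatedOddFace o f) : sideOp o f = 1 := by
  refine tensorOp_eq_one fun q => ?_
  rcases q with u | ⟨g, hg⟩
  · rfl
  · change sidePauli f g = 1
    rw [sidePauli, dif_neg]
    rintro ⟨d, hne, hd⟩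
    exact hne (hf.eq_of_shareEdge ho hc hg hd).symm

/-- Opposite faces of an odd cell. -/
structure IsOppositePair (o : Vertex n → Vertex n → Prop) (c : Fin 3 → ℕ) (f f' : Face n) :
    Prop where
  odd : IsOddFace o f
  odd' : IsOddFace o f'
  normal_eq : f'.normal = f.normal
  step : IsStep f.normal f.base f'.base
  type_eq : ∀ a, a ≠ f.normal →
    edgeType c f.normal (f.base f.normal).val = edgeType c a (f.base a).val

/-- An odd face sharing an edge with `f` or with `f'` is perpendicular to them, and its type makes
it a side of the odd cell between the two. It then contains the corresponding parallel edge of the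
other face as well. -/
theorem IsOppositePair.shareEdge_iff (ho : IsCompactOrientation o) (hc : IsTypedBy o c)
    {f f' g : Face n} (h : IsOppositePair o c f f') (hg : IsOddFace o g) (d : Fin 3) :
    (g ≠ f ∧ ShareEdge d f g) ↔ (g ≠ f' ∧ ShareEdge d f' g) := by
  have base_eq : ∀ a, a ≠ f.normal → (f'.base a).val = (f.base a).val := fun a ha =>
    h.step.val_eq ha
  have hs := h.step.val_add_one
  have hnn := h.normal_eq
  obtain ⟨a₀, -, -, ha₀, -, -⟩ := exists_other_axes f.normal
  constructor
  · rintro ⟨hne, hd⟩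
    have hn : g.normal ≠ f.normal := fun e =>
      hne (eq_of_shareEdge_of_normal_eq ho hc h.odd hg hd e.symm).symm
    have ht := edgeType_eq_of_shareEdge ho hc h.odd hg hd ha₀.symm hn.symm
    rw [← h.type_eq a₀ ha₀.symm] at ht
    refine ⟨fun e => hn (by rw [e, hnn]), ?_⟩
    obtain ⟨i, j, hij, hax, fi, fj, gi, gj⟩ := hd
    -- The common edge allows `g` to extend to either side of `f`; equality of types leaves only the
    -- side of `f'`.
    have gk : (g.base f.normal).val = (f.base f.normal).val := by
      have h₁ := gi.2 f.normal hn.symm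
      rw [fi.1] at h₁
      rw [edgeType, edgeType] at ht
      omega
    have up : ∀ x, x ∈ f.verts → x ∈ g.verts → ∃ y, IsStep f.normal x y ∧ y ∈ f'.verts ∧
        y ∈ g.verts := by
      intro x hx hx'
      obtain ⟨y, hy⟩ := exists_isStep (n := n) (u := x) (d := f.normal)
        (by rw [hx.1]; exact h.step.lt)
      refine ⟨y, hy, ⟨Fin.ext ?_, fun a ha => ?_⟩, Face.mem_verts_of_isStep hy hn.symm hx' ?_⟩
      · rw [hnn, hy.val_add_one, hx.1, hs]
      · rw [hnn] at ha
        rw [hy.val_eq ha, base_eq a ha]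
        exact hx.2 a ha
      · rw [hx.1, gk]
    obtain ⟨i', hi, fi', gi'⟩ := up i fi gi
    obtain ⟨j', hj, fj', gj'⟩ := up j fj gj
    have hd : edgeAxis i j ≠ f.normal := Face.axis_ne_normal hij fi fj
    rcases isStep_or_isStep hij with hst | hst
    · have := hst.of_square hi hj hd
      exact ⟨i', j', this.adj, by rw [this.edgeAxis_eq, hax], fi', fj', gi', gj'⟩
    · have := hst.of_square hj hi hd
      exact ⟨j', i', this.adj, by rw [this.edgeAxis_eq, hax], fj', fi', gj', gi'⟩
  · rintro ⟨hne, hd⟩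
    have hn : g.normal ≠ f.normal := fun e =>
      hne (eq_of_shareEdge_of_normal_eq ho hc h.odd' hg hd (hnn.trans e.symm)).symm
    have ht := edgeType_eq_of_shareEdge ho hc h.odd' hg hd
      (show a₀ ≠ f'.normal by rw [hnn]; exact ha₀.symm) hn.symm
    rw [base_eq a₀ ha₀.symm, ← h.type_eq a₀ ha₀.symm] at ht
    refine ⟨fun e => hn (by rw [e]), ?_⟩
    obtain ⟨i, j, hij, hax, fi, fj, gi, gj⟩ := hd
    have fn : ∀ x, x ∈ f'.verts → (x f.normal).val = (f.base f.normal).val + 1 := fun x hx => by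
      rw [← hs, ← hnn, hx.1]
    have gk : (g.base f.normal).val = (f.base f.normal).val := by
      have h₁ := gi.2 f.normal hn.symm
      rw [fn i fi] at h₁
      rw [edgeType, edgeType] at ht
      omega
    have down : ∀ x, x ∈ f'.verts → x ∈ g.verts → ∃ y, IsStep f.normal y x ∧ y ∈ f.verts ∧
        y ∈ g.verts := by
      intro x hx hx'
      obtain ⟨y, hy⟩ := exists_isStep_of_pos (n := n) (v := x) (d := f.normal)
        (by rw [fn x hx]; omega)
      have hv := hy.val_add_one
      rw [fn x hx] at hv
      refine ⟨y, hy, ⟨Fin.ext (by omega), fun a ha => ?_⟩, ⟨?_, fun a ha => ?_⟩⟩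
      · rw [← hy.val_eq ha, ← base_eq a ha]
        exact hx.2 a (by rw [hnn]; exact ha)
      · rw [hy.2 _ hn]; exact hx'.1
      · by_cases hak : a = f.normal
        · subst hak; left; omega
        · rw [← hy.val_eq hak]; exact hx'.2 a ha
    obtain ⟨i', hi, fi', gi'⟩ := down i fi gi
    obtain ⟨j', hj, fj', gj'⟩ := down j fj gj
    have hd : edgeAxis i j ≠ f.normal := by
      rw [← hnn]; exact Face.axis_ne_normal hij fi fj
    rcases isStep_or_isStep hij with hst | hst
    · have := hst.of_square_back hi hj hd
      exact ⟨i', j', this.adj, by rw [this.edgeAxis_eq, hax], fi', fj', gi', gj'⟩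
    · have := hst.of_square_back hj hi hd
      exact ⟨j', i', this.adj, by rw [this.edgeAxis_eq, hax], fj', fi', gj', gi'⟩

/-- The loops around opposite faces of an odd cell act in the same way. -/
theorem IsOppositePair.sideOp_eq (ho : IsCompactOrientation o) (hc : IsTypedBy o c)
    {f f' : Face n} (h : IsOppositePair o c f f') : sideOp o f' = sideOp o f := by
  rw [sideOp, sideOp]
  congr 1
  funext q
  rcases q with u | ⟨g, hg⟩
  · rfl
  · change sidePauli f' g = sidePauli f g
    by_cases hex : ∃ d, g ≠ f ∧ ShareEdge d f g
    · obtain ⟨d, hd⟩ := hex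
      have hd' := (h.shareEdge_iff ho hc hg d).mp hd
      rw [sidePauli_of_shareEdge hd.1 hd.2, sidePauli_of_shareEdge hd'.1 hd'.2]
    · have hex' : ¬ ∃ d, g ≠ f' ∧ ShareEdge d f' g := fun ⟨d, hd⟩ =>
        hex ⟨d, (h.shareEdge_iff ho hc hg d).mpr hd⟩
      rw [sidePauli, dif_neg hex', sidePauli, dif_neg hex]

theorem IsOppositePair.not_isIsolatedOddFace (ho : IsCompactOrientation o) (hc : IsTypedBy o c)
    {f f' : Face n} (h : IsOppositePair o c f f') :
    ¬ IsIsolatedOddFace o f ∧ ¬ IsIsolatedOddFace o f' := by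
  let p : Cell n := ⟨f.base, fun a => by
    by_cases ha : a = f.normal
    · rw [ha]; exact h.step.lt
    · exact f.lt ha⟩
  have hp : IsOddCell o p := by
    rw [isOddCell_iff ho hc]
    have key : ∀ a, edgeType c a (f.base a).val = edgeType c f.normal (f.base f.normal).val := by
      intro a
      by_cases ha : a = f.normal
      · rw [ha]
      · exact (h.type_eq a ha).symm
    intro a b
    exact (key a).trans (key b).symm
  constructor
  · intro hi
    refine hi.isolated p hp fun v hv a => ?_
    by_cases ha : a = f.normal
    · subst ha; exact Or.inl (congrArg Fin.val hv.1)
    · exact hv.2 a ha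
  · intro hi
    refine hi.isolated p hp fun v hv a => ?_
    by_cases ha : a = f.normal
    · subst ha
      right
      have h₁ := hv.1
      rw [h.normal_eq] at h₁
      rw [h₁]
      exact h.step.val_add_one
    · have h₁ := hv.2 a (by rw [h.normal_eq]; exact ha)
      rwa [h.step.val_eq ha] at h₁

end LoopOperators

section Kernel

variable {n : Fin 3 → ℕ} {o : Vertex n → Vertex n → Prop} {c : Fin 3 → ℕ}

/-! ### The cycles that act trivially -/

/-- The cycles that are mapped to the identity. -/
def cycleKernel {Q : Type*} [Fintype Q] [DecidableEq Q] (σ : MG (lattice n) →* QubitOp Q) :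
    Subgroup (MG (lattice n)) :=
  cycleGroup (lattice n) ⊓ σ.toHomUnits.ker

theorem mem_cycleKernel {Q : Type*} [Fintype Q] [DecidableEq Q]
    {σ : MG (lattice n) →* QubitOp Q} {x : MG (lattice n)} :
    x ∈ cycleKernel σ ↔ x ∈ cycleGroup (lattice n) ∧ σ x = 1 := by
  rw [cycleKernel, Subgroup.mem_inf, MonoidHom.mem_ker, Units.ext_iff]
  rfl

/-- The possible values of balanced vectors at the lowest vertices of the odd cells. -/
def cellSpace (c : Fin 3 → ℕ) : Submodule (ZMod 2) (Fin 2 × Vertex n → Fin 3 → ZMod 2) where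
  carrier := {κ | ∀ p, (∀ d, ¬ IsCellEdge c p.1 p.2 d → κ p d = 0) ∧ ∑ d, κ p d = 0}
  zero_mem' := by simp
  add_mem' := by
    intro κ κ' h h' p
    refine ⟨fun d hd => ?_, ?_⟩
    · rw [Pi.add_apply, Pi.add_apply, (h p).1 d hd, (h' p).1 d hd, add_zero]
    · simp only [Pi.add_apply, Finset.sum_add_distrib, (h p).2, (h' p).2, add_zero]
  smul_mem' := by
    intro a κ h p
    refine ⟨fun d hd => ?_, ?_⟩
    · rw [Pi.smul_apply, Pi.smul_apply, (h p).1 d hd, smul_zero]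
    · simp only [Pi.smul_apply, ← Finset.smul_sum, (h p).2, smul_zero]

theorem cellValues_mem_cellSpace {z : LatticeEdge n → ZMod 2} (hz : z ∈ balanced c) :
    cellValues c z ∈ cellSpace c :=
  fun p => ⟨fun _ hd => cellValues_of_not_isCellEdge hd z, hz.1 p⟩

theorem edgeType_succ_ne (d : Fin 3) (x : ℕ) : edgeType c d (x + 1) ≠ edgeType c d x := by
  simp only [edgeType]; omega

/-- All edges of the loop have type `τ`. Among the vertices of the face only the base can be lowest
in a cell of type `τ`, since a raised coordinate is positive and starts an edge of the other type.
-/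
theorem IsOddSquare.cellValues_eq {f : Face n} {p q r t : Vertex n}
    (h : IsOddSquare o f p q r t) (ho : IsOrientation o) {τ : Fin 2} {O : Vertex n}
    (hO : f.base = O) (hcell : ∀ a, a ≠ f.normal → IsCellEdge c τ O a) :
    cellValues c (edgeVec (latticeLabelling n) (h.walk ho)) =
      Pi.single (τ, O) fun d => if d = f.normal then 0 else 1 := by
  classical
  funext ⟨τ', w⟩ d
  rw [Pi.single_apply]
  by_cases hw : (τ', w) = (τ, O)
  · rw [if_pos hw]
    obtain ⟨rfl, rfl⟩ : τ' = τ ∧ w = O := Prod.ext_iff.mp hw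
    by_cases hd : d = f.normal
    · rw [if_pos hd]
      by_cases hcd : IsCellEdge c τ' w d
      · rw [cellValues_of_isCellEdge hcd, h.edgeVec_walk, if_neg]
        exact fun hh => hh.1 hd
      · rw [cellValues_of_not_isCellEdge hcd]
    · rw [if_neg hd, cellValues_of_isCellEdge (hcell d hd), h.edgeVec_walk, if_pos]
      refine ⟨hd, ?_, ?_⟩
      · rw [← hO]; exact f.base_mem_verts
      · rw [hO]
  · rw [if_neg hw, Pi.zero_apply]
    by_cases hcd : IsCellEdge c τ' w d
    · rw [cellValues_of_isCellEdge hcd, h.edgeVec_walk, if_neg]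
      rintro ⟨hd, hwf, hb⟩
      apply hw
      have hτ : τ' = τ := by
        apply Fin.ext
        rw [← hcd.type_eq, hb, hO, (hcell d hd).type_eq]
      refine Prod.ext hτ (vertex_ext fun a => ?_)
      change (w a).val = (O a).val
      by_cases ha : a = f.normal
      · rw [ha, hwf.1, hO]
      · have h₁ := hwf.2 a ha
        rw [hO] at h₁
        have h₂ := hcd.low a
        have h₃ := (hcell a ha).type_eq
        rcases h₁ with h₁ | h₁
        · exact h₁
        · exfalso
          rw [h₁, hτ] at h₂
          have := edgeType_succ_ne (c := c) a (O a).val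
          omega
    · rw [cellValues_of_not_isCellEdge hcd]

/-- The upper face of an odd cell contains no lowest vertex of a cell of its type, because its
coordinate along the normal is the upper end of a segment. -/
theorem IsOddSquare.cellValues_eq_zero {f : Face n} {p q r t : Vertex n}
    (h : IsOddSquare o f p q r t) (ho : IsOrientation o) {τ : Fin 2} {O : Vertex n}
    (hO : IsStep f.normal O f.base) (hcell : ∀ a, IsCellEdge c τ O a) :
    cellValues c (edgeVec (latticeLabelling n) (h.walk ho)) = 0 := by
  funext ⟨τ', w⟩ d
  rw [Pi.zero_apply, Pi.zero_apply]
  by_cases hcd : IsCellEdge c τ' w d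
  · rw [cellValues_of_isCellEdge hcd, h.edgeVec_walk, if_neg]
    rintro ⟨hd, hwf, hb⟩
    have hτ : τ'.val = τ.val := by
      rw [← hcd.type_eq, hb, hO.val_eq hd, (hcell d).type_eq]
    have h₁ : (w f.normal).val = (O f.normal).val + 1 := by
      rw [← hO.val_add_one, hwf.1]
    have h₂ := hcd.low f.normal
    have h₃ := (hcell f.normal).type_eq
    rw [h₁, hτ] at h₂
    have := edgeType_succ_ne (c := c) f.normal (O f.normal).val
    omega
  · rw [cellValues_of_not_isCellEdge hcd]

/-- Every pair of axes of an odd cell is realised by a cycle that acts trivially. -/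
theorem exists_mem_cycleKernel (ho : IsCompactOrientation o) (hc : IsTypedBy o c)
    {pick : Face n → Vertex n × Vertex n} (hpick : IsEdgeChoice o pick)
    {σ : MG (lattice n) →* QubitOp (Qubit o)} (hσ : IsCubicEncoding o pick σ)
    {τ : Fin 2} {O : Vertex n} {k : Fin 3} (hcell : ∀ a, a ≠ k → IsCellEdge c τ O a) :
    ∃ x ∈ cycleKernel σ,
      cellValues c (Multiplicative.toAdd (edgeHom (latticeLabelling n) x)) =
        Pi.single (τ, O) fun d => if d = k then 0 else 1 := by
  have ho' := ho.toIsOrientation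
  let f : Face n := ⟨(k, O), fun a ha => (hcell a ha).lt⟩
  have hf : IsOddFace o f := by
    rw [isOddFace_iff ho hc]
    intro a b ha hb
    exact (hcell a ha).type_eq.trans (hcell b hb).type_eq.symm
  obtain ⟨p, q, r, t, h⟩ := exists_isOddSquare ho hc hf
  have hmem : cycleElement (h.walk ho') ∈ cycleGroup (lattice n) :=
    Subgroup.subset_closure ⟨_, _, rfl⟩
  have hval := h.cellValues_eq ho' (c := c) (τ := τ) (O := O) rfl hcell
  -- If the whole cube lies in the box, the loop around `f` is multiplied by the loop around the
  -- opposite face, which has the same operator and adds nothing to the cell values. If the cube is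
  -- clipped along `k`, then `f` is isolated and its loop alone acts trivially.
  by_cases hk : IsCellEdge c τ O k
  · have hall : ∀ a, IsCellEdge c τ O a := fun a => by
      by_cases ha : a = k
      · rw [ha]; exact hk
      · exact hcell a ha
    have hs := isStep_shift O k hk.lt
    let f' : Face n := ⟨(k, shift O k hk.lt), fun a ha => by
      change (shift O k hk.lt a).val + 1 < n a
      rw [hs.val_eq ha]; exact (hcell a ha).lt⟩
    have hf' : IsOddFace o f' := by
      rw [isOddFace_iff ho hc]
      intro a b ha hb
      change edgeType c a (shift O k hk.lt a).val = edgeType c b (shift O k hk.lt b).val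
      rw [hs.val_eq ha, hs.val_eq hb]
      exact (hcell a ha).type_eq.trans (hcell b hb).type_eq.symm
    have hpair : IsOppositePair o c f f' :=
      ⟨hf, hf', rfl, hs, fun a ha => hk.type_eq.trans (hcell a ha).type_eq.symm⟩
    obtain ⟨hi, hi'⟩ := hpair.not_isIsolatedOddFace ho hc
    obtain ⟨p', q', r', t', h'⟩ := exists_isOddSquare ho hc hf'
    have hmem' : cycleElement (h'.walk ho') ∈ cycleGroup (lattice n) :=
      Subgroup.subset_closure ⟨_, _, rfl⟩
    refine ⟨cycleElement (h.walk ho') * cycleElement (h'.walk ho'),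
      mem_cycleKernel.mpr ⟨mul_mem hmem hmem', ?_⟩, ?_⟩
    · rw [map_mul, h.map_loop ho hc hpick hf hσ, h'.map_loop ho hc hpick hf' hσ, if_neg hi,
        if_neg hi', hpair.sideOp_eq ho hc, neg_mul_neg, sideOp_sq]
    · rw [map_mul, toAdd_mul, map_add, edgeHom_cycleElement, edgeHom_cycleElement, toAdd_ofAdd,
        toAdd_ofAdd, hval, h'.cellValues_eq_zero ho' (O := O) hs hall, add_zero]
      rfl
  · have hi : IsIsolatedOddFace o f := by
      obtain ⟨b, -, -, hkb, -, -⟩ := exists_other_axes k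
      have hlow := (hcell b hkb.symm).low k
      have hO := (O k).isLt
      have hnot : ¬ (edgeType c k (O k).val = τ.val ∧ (O k).val + 1 < n k) := fun hh =>
        hk ⟨(hcell b hkb.symm).low, hh.1, hh.2⟩
      refine ⟨hf, ?_, ?_⟩
      · change (O k).val = 0 ∨ (O k).val + 1 = n k
        by_contra hcon
        exact hnot ⟨by tauto, by omega⟩
      · intro x hx hsub
        have hx' := (isOddCell_iff ho hc x).mp hx k b
        rw [← Face.base_val_of_subset hsub hkb.symm] at hx'
        have hb : edgeType c b (f.base b).val = τ.val := (hcell b hkb.symm).type_eq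
        have hlt := x.2 k
        have hm : (O k).val = (x.1 k).val ∨ (O k).val = (x.1 k).val + 1 :=
          hsub f.base_mem_verts k
        rcases hm with hm | hm
        · exact hnot ⟨by rw [hm, hx', hb], by omega⟩
        · have := edgeType_succ_ne (c := c) k (x.1 k).val
          rw [← hm] at this
          omega
    refine ⟨cycleElement (h.walk ho'), mem_cycleKernel.mpr ⟨hmem, ?_⟩, ?_⟩
    · rw [h.map_loop ho hc hpick hf hσ, if_pos hi, sideOp_eq_one_of_isIsolatedOddFace ho hc hi]
    · rw [edgeHom_cycleElement, toAdd_ofAdd, hval]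
      rfl

theorem eq_zero_or_exists_of_sum_eq_zero : ∀ κ : Fin 3 → ZMod 2, ∑ d, κ d = 0 →
    κ = 0 ∨ ∃ k, κ = fun d => if d = k then 0 else 1 := by
  decide

/-- The conditions are separate for each cell, and a nonzero vector of sum zero in three coordinates
omits exactly one axis. The other two are cell edges by the support condition, so
`exists_mem_cycleKernel` applies. -/
theorem cellSpace_le_map (ho : IsCompactOrientation o) (hc : IsTypedBy o c)
    {pick : Face n → Vertex n × Vertex n} (hpick : IsEdgeChoice o pick)
    {σ : MG (lattice n) →* QubitOp (Qubit o)} (hσ : IsCubicEncoding o pick σ) :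
    cellSpace c ≤ (edgeSpace (latticeLabelling n) (cycleKernel σ)).map (cellValues c) := by
  intro κ hκ
  rw [← Finset.univ_sum_single κ]
  refine Submodule.sum_mem _ fun ⟨τ, O⟩ _ => ?_
  rcases eq_zero_or_exists_of_sum_eq_zero (κ (τ, O)) (hκ (τ, O)).2 with h | ⟨k, h⟩
  · rw [h, Pi.single_zero]
    exact Submodule.zero_mem _
  · obtain ⟨x, hx, hval⟩ := exists_mem_cycleKernel ho hc hpick hσ (τ := τ) (O := O) (k := k) (by
      intro a ha
      by_contra hcon
      have := (hκ (τ, O)).1 a hcon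
      rw [h] at this
      exact one_ne_zero ((if_neg ha).symm.trans this))
    rw [h, ← hval]
    exact ⟨_, ⟨x, hx, rfl⟩, rfl⟩

theorem edgeSpace_cycleKernel_le (ho : IsCompactOrientation o) (hc : IsTypedBy o c)
    {pick : Face n → Vertex n × Vertex n} {σ : MG (lattice n) →* QubitOp (Qubit o)}
    (hσ : IsCubicEncoding o pick σ) :
    edgeSpace (latticeLabelling n) (cycleKernel σ) ≤ balanced c := by
  rintro z ⟨x, hx, hz⟩
  obtain ⟨hx₁, hx₂⟩ := mem_cycleKernel.mp hx
  have := mem_balanced_of_commute ho hc hσ hx₁ (fun T => by rw [hx₂, one_mul, mul_one])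
  rw [hz] at this
  exact this

/-- A cycle whose operator commutes with all operators acts trivially. -/
theorem map_eq_one_of_commute (ho : IsCompactOrientation o) (hc : IsTypedBy o c)
    {pick : Face n → Vertex n × Vertex n} (hpick : IsEdgeChoice o pick)
    {σ : MG (lattice n) →* QubitOp (Qubit o)} (hσ : IsCubicEncoding o pick σ)
    {x : MG (lattice n)} (hx : x ∈ cycleGroup (lattice n)) (hcomm : ∀ T, σ x * T = T * σ x) :
    σ x = 1 := by
  have hb := mem_balanced_of_commute ho hc hσ hx hcomm
  -- Some trivially acting cycle has the same cell values. Both edge vectors are balanced, hence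
  -- equal, so this cycle is `x` itself.
  obtain ⟨z, hz, he⟩ := cellSpace_le_map ho hc hpick hσ (cellValues_mem_cellSpace hb)
  have hzb := edgeSpace_cycleKernel_le ho hc hσ hz
  have h0 := eq_zero_of_cellValues_eq_zero (Submodule.sub_mem _ hzb hb)
    (by rw [map_sub, he, sub_self])
  obtain ⟨y, hy, hyz⟩ := hz
  obtain ⟨hy₁, hy₂⟩ := mem_cycleKernel.mp hy
  have : y = x := edgeHom_injOn (latticeLabelling n) hy₁ hx
    (hyz.trans (congrArg Multiplicative.ofAdd (sub_eq_zero.mp h0)))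
  rw [← this, hy₂]

/-- On the kernel `cellValues` is injective because the edge vectors are balanced, and it reaches
every admissible value by `cellSpace_le_map`. -/
theorem card_cycleKernel (ho : IsCompactOrientation o) (hc : IsTypedBy o c)
    {pick : Face n → Vertex n × Vertex n} (hpick : IsEdgeChoice o pick)
    {σ : MG (lattice n) →* QubitOp (Qubit o)} (hσ : IsCubicEncoding o pick σ) :
    Nat.card (cycleKernel σ) = Nat.card (cellSpace (n := n) c) := by
  have hle₀ : cycleKernel σ ≤ cycleGroup (lattice n) := inf_le_left
  rw [card_subgroup_eq_card_edgeSpace (latticeLabelling n) hle₀]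
  have hle := edgeSpace_cycleKernel_le ho hc hσ
  refine Nat.card_congr (Equiv.ofBijective
    (fun z => ⟨cellValues c z.1, cellValues_mem_cellSpace (hle z.2)⟩) ⟨?_, ?_⟩)
  · intro z z' h
    refine Subtype.ext (sub_eq_zero.mp (eq_zero_of_cellValues_eq_zero
      (Submodule.sub_mem _ (hle z.2) (hle z'.2)) ?_))
    rw [map_sub, sub_eq_zero]
    exact congrArg Subtype.val h
  · rintro ⟨κ, hκ⟩
    obtain ⟨z, hz, he⟩ := cellSpace_le_map ho hc hpick hσ hκ
    exact ⟨⟨z, hz⟩, Subtype.ext he⟩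

/-! ### The size of the stabilizer group and the absence of `-1` -/

theorem card_stabilizerGroup_mul {Q : Type*} [Fintype Q] [DecidableEq Q]
    (σ : MG (lattice n) →* QubitOp Q) :
    Nat.card (stabilizerGroup σ) * Nat.card (cycleKernel σ) =
      Nat.card (cycleGroup (lattice n)) := by
  let φ : cycleGroup (lattice n) →* (QubitOp Q)ˣ := σ.toHomUnits.comp (cycleGroup _).subtype
  have h₁ : stabilizerGroup σ = φ.range := by
    rw [stabilizerGroup, MonoidHom.range_comp, Subgroup.range_subtype]
  have h₂ : Nat.card φ.ker = Nat.card (cycleKernel σ) := by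
    refine Nat.card_congr ⟨fun x => ⟨x.1.1, x.1.2, x.2⟩, fun x => ⟨⟨x.1, x.2.1⟩, x.2.2⟩,
      fun _ => rfl, fun _ => rfl⟩
  rw [h₁, ← h₂, Subgroup.card_eq_card_quotient_mul_card_subgroup φ.ker,
    Nat.card_congr (QuotientGroup.quotientKerEquivRange φ).toEquiv]

/-- The number of generators of the stabilizer group. -/
theorem minGenerators_stabilizerGroup (hn : ∀ d, 2 ≤ n d) (ho : IsCompactOrientation o)
    (hc : IsTypedBy o c) {pick : Face n → Vertex n × Vertex n} (hpick : IsEdgeChoice o pick)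
    {σ : MG (lattice n) →* QubitOp (Qubit o)} (hσ : IsCubicEncoding o pick σ) {m : ℕ}
    (hm : Nat.card (cellSpace (n := n) c) = 2 ^ m) :
    minGenerators (stabilizerGroup σ) + m + Fintype.card (Vertex n) =
      Fintype.card (LatticeEdge n) + 1 := by
  obtain ⟨k, hk, hkE⟩ := card_cycleGroup (latticeLabelling n) (lattice_connected hn)
  have h := card_stabilizerGroup_mul σ
  rw [card_cycleKernel ho hc hpick hσ, hm, hk] at h
  have hmk : m ≤ k := (Nat.pow_dvd_pow_iff_le_right (by norm_num)).mp (Dvd.intro_left _ h)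
  have hcard : Nat.card (stabilizerGroup σ) = 2 ^ (k - m) := by
    apply Nat.eq_of_mul_eq_mul_right (show 0 < 2 ^ m by positivity)
    rw [h, ← pow_add, Nat.sub_add_cancel hmk]
  rw [minGenerators_of_card_eq ?_ hcard]
  · omega
  · rintro ⟨_, x, hx, rfl⟩
    refine Subtype.ext ?_
    change σ.toHomUnits x * σ.toHomUnits x = 1
    rw [← map_mul, mul_self_eq_one_of_mem_cycleGroup (latticeLabelling n) hx, map_one]

/-- A cycle acting as `-1` commutes with every operator and would therefore act as `1`. -/
theorem neg_one_notMem_stabilizerGroup (ho : IsCompactOrientation o) (hc : IsTypedBy o c)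
    {pick : Face n → Vertex n × Vertex n} (hpick : IsEdgeChoice o pick)
    {σ : MG (lattice n) →* QubitOp (Qubit o)} (hσ : IsCubicEncoding o pick σ) :
    (-1 : (QubitOp (Qubit o))ˣ) ∉ stabilizerGroup σ := by
  rintro ⟨x, hx, he⟩
  have hx' : σ x = -1 := congrArg Units.val he
  have h1 := map_eq_one_of_commute ho hc hpick hσ hx (fun T => by rw [hx']; simp)
  rw [hx'] at h1
  have h2 := congrFun (congrFun h1 0) 0
  rw [Matrix.neg_apply, Matrix.one_apply_eq] at h2
  norm_num at h2

end Kernel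

section Counting

variable {n : Fin 3 → ℕ} {o : Vertex n → Vertex n → Prop} {c : Fin 3 → ℕ}

/-! ### Counting along one axis -/

theorem card_fin_subtype (m : ℕ) (p : ℕ → Prop) [DecidablePred p] :
    Nat.card {x : Fin m // p x.val} = Nat.count p m := by
  rw [Nat.count_eq_card_filter_range, ← Fintype.card_coe, ← Nat.card_eq_fintype_card]
  exact Nat.card_congr
   ⟨fun x => ⟨x.1.val, Finset.mem_filter.mpr ⟨Finset.mem_range.mpr x.1.isLt, x.2⟩⟩,
    fun x => ⟨⟨x.1, Finset.mem_range.mp (Finset.mem_filter.mp x.2).1⟩,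
      (Finset.mem_filter.mp x.2).2⟩, fun _ => rfl, fun _ => rfl⟩

/-- Of the `m + 1` vertices on a line with `m` edges, each edge of type `τ` covers two. Uncovered
are only end vertices whose edge has the other type. The last edge has coordinate `m - 1`; `m + 1`
has the same parity and avoids truncated subtraction. -/
theorem two_mul_count_edgeType (c : Fin 3 → ℕ) (d : Fin 3) {τ : ℕ} (hτ : τ < 2) (m : ℕ) :
    2 * Nat.count (fun x => edgeType c d x = τ) m + (if c d % 2 = τ then 0 else 1) +
      (if (m + 1 + c d) % 2 = τ then 0 else 1) = m + 1 := by
  induction m with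
  | zero =>
    rw [Nat.count_zero]
    split_ifs <;> omega
  | succ m ih =>
    rw [Nat.count_succ]
    simp only [edgeType] at ih ⊢
    by_cases h₁ : c d % 2 = τ <;> by_cases h₂ : (m + c d) % 2 = τ <;>
      by_cases h₃ : (m + 1 + c d) % 2 = τ <;> by_cases h₄ : (m + 1 + 1 + c d) % 2 = τ <;>
      simp only [h₁, h₂, h₃, h₄, if_true, if_false] at ih ⊢ <;> omega

variable (n) in
/-- The number of segments of type `τ` along the axis `d`. -/
def segmentCount (c : Fin 3 → ℕ) (d : Fin 3) (τ : ℕ) : ℕ :=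
  Nat.count (fun x => edgeType c d x = τ) (n d - 1)

theorem card_segment (c : Fin 3 → ℕ) (d : Fin 3) (τ : ℕ) :
    Nat.card {x : Fin (n d) // x.val + 1 < n d ∧ edgeType c d x.val = τ} =
      segmentCount n c d τ := by
  rw [segmentCount, ← card_fin_subtype]
  exact Nat.card_congr ⟨fun x => ⟨⟨x.1.val, by have := x.2.1; omega⟩, x.2.2⟩,
    fun x => ⟨⟨x.1.val, by have := x.1.isLt; omega⟩, by have := x.1.isLt; simp only; omega, x.2⟩,
    fun _ => rfl, fun _ => rfl⟩

theorem segmentCount_add (hn : ∀ d, 2 ≤ n d) (c : Fin 3 → ℕ) (d : Fin 3) :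
    segmentCount n c d 0 + segmentCount n c d 1 + 1 = n d := by
  have h₀ := two_mul_count_edgeType c d (show 0 < 2 by norm_num) (n d - 1)
  have h₁ := two_mul_count_edgeType c d (show 1 < 2 by norm_num) (n d - 1)
  have := hn d
  rw [segmentCount, segmentCount]
  split_ifs at h₀ h₁ <;> omega

theorem card_lt (d : Fin 3) : Nat.card {x : Fin (n d) // x.val + 1 < n d} = n d - 1 := by
  rw [← Nat.card_fin (n d - 1)]
  exact Nat.card_congr ⟨fun x => ⟨x.1.val, by have := x.2; omega⟩,
    fun x => ⟨⟨x.val, by have := x.isLt; omega⟩, by have := x.isLt; simp only; omega⟩,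
    fun _ => rfl, fun _ => rfl⟩

/-- A coordinate that fails the condition is the upper end of exactly one segment of type `τ` inside
the box. -/
theorem card_low_add (hn : ∀ d, 2 ≤ n d) (c : Fin 3 → ℕ) (d : Fin 3) {τ : ℕ} (hτ : τ < 2) :
    Nat.card {x : Fin (n d) // x.val = 0 ∨ edgeType c d x.val = τ} + segmentCount n c d τ =
      n d := by
  have h := two_mul_count_edgeType c d hτ (n d - 1)
  have hn' := hn d
  have key : ∀ m, Nat.count (fun x => x = 0 ∨ edgeType c d x = τ) (m + 1) =
      Nat.count (fun x => edgeType c d x = τ) (m + 1) + (if c d % 2 = τ then 0 else 1) := by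
    intro m
    induction m with
    | zero => by_cases h₁ : c d % 2 = τ <;> simp [Nat.count_succ, edgeType, h₁]
    | succ m ih =>
      rw [Nat.count_succ, ih, Nat.count_succ (fun x => edgeType c d x = τ) (m + 1)]
      simp only [Nat.add_eq_zero_iff, one_ne_zero, and_false, false_or]
      omega
  rw [card_fin_subtype (n d) fun x => x = 0 ∨ edgeType c d x = τ, segmentCount]
  obtain ⟨m, hm⟩ : ∃ m, n d = m + 1 := ⟨n d - 1, by omega⟩
  rw [hm] at h ⊢
  rw [key, Nat.count_succ]
  have e : edgeType c d m = τ ↔ (m + c d) % 2 = τ := Iff.rfl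
  simp only [Nat.add_sub_cancel] at h ⊢
  by_cases h₁ : c d % 2 = τ <;> by_cases h₂ : (m + c d) % 2 = τ <;>
    by_cases h₃ : (m + 1 + c d) % 2 = τ <;>
    simp only [e, h₁, h₂, h₃, if_true, if_false] at h ⊢ <;> omega

/-- The end points of the box along the axis `d` whose edge along this axis has the type `τ`. -/
def IsEnd (c : Fin 3 → ℕ) (τ : ℕ) (d : Fin 3) (x : Fin (n d)) : Prop :=
  (x.val = 0 ∧ edgeType c d 0 = τ) ∨ (x.val + 1 = n d ∧ edgeType c d (n d - 2) = τ)

/-- The vertices on a line not covered by the disjoint segments of the other type `τ'` are exactly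
the ends whose edge has type `τ`. -/
theorem card_isEnd_add (hn : ∀ d, 2 ≤ n d) (c : Fin 3 → ℕ) (d : Fin 3) {τ τ' : ℕ}
    (hτ : τ + τ' = 1) :
    Nat.card {x : Fin (n d) // IsEnd c τ d x} + 2 * segmentCount n c d τ' = n d := by
  classical
  have h := two_mul_count_edgeType c d (show τ' < 2 by omega) (n d - 1)
  have hn' := hn d
  have hcard : Nat.card {x : Fin (n d) // IsEnd c τ d x} =
      (if edgeType c d 0 = τ then 1 else 0) + (if edgeType c d (n d - 2) = τ then 1 else 0) := by
    rw [Nat.card_eq_fintype_card, Fintype.card_subtype, Finset.card_filter]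
    have hsplit : ∀ x : Fin (n d), (if IsEnd c τ d x then 1 else 0) =
        (if x = ⟨0, by omega⟩ then (if edgeType c d 0 = τ then 1 else 0) else 0) +
        (if x = ⟨n d - 1, by omega⟩ then (if edgeType c d (n d - 2) = τ then 1 else 0) else 0) := by
      intro x
      have e₁ : x = ⟨0, by omega⟩ ↔ x.val = 0 := Fin.ext_iff
      have e₂ : x = ⟨n d - 1, by omega⟩ ↔ x.val + 1 = n d := by
        rw [Fin.ext_iff]; simp only; omega
      simp only [IsEnd, e₁, e₂]
      by_cases h₁ : x.val = 0
      · have h₂ : ¬ 0 + 1 = n d := by omega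
        simp only [h₁, h₂, true_and, false_and, or_false, if_true, if_false, add_zero]
      · simp [h₁, ite_and]
    simp only [hsplit, Finset.sum_add_distrib, Finset.sum_ite_eq', Finset.mem_univ, if_true]
  rw [hcard, segmentCount]
  have e₁ : edgeType c d 0 = τ ↔ ¬ c d % 2 = τ' := by rw [edgeType]; omega
  have e₂ : edgeType c d (n d - 2) = τ ↔ ¬ (n d - 1 + 1 + c d) % 2 = τ' := by
    rw [edgeType]; omega
  by_cases h₁ : c d % 2 = τ' <;> by_cases h₂ : (n d - 1 + 1 + c d) % 2 = τ' <;>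
    simp only [e₁, e₂, h₁, h₂, if_true, if_false, not_true, not_false_iff] at h ⊢ <;> omega

/-! ### Counting vertices, edges, faces and corners -/

theorem card_pi_subtype (p : ∀ d, Fin (n d) → Prop) :
    Nat.card {u : Vertex n // ∀ d, p d (u d)} =
      Nat.card {x // p 0 x} * Nat.card {x // p 1 x} * Nat.card {x // p 2 x} := by
  rw [Nat.card_congr (Equiv.subtypePiEquivPi (p := fun d => p d)), Nat.card_pi,
    Fin.prod_univ_three]

theorem card_vertex : Fintype.card (Vertex n) = n 0 * n 1 * n 2 := by
  rw [Fintype.card_pi, Fin.prod_univ_three]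
  simp

theorem card_latticeEdge : Fintype.card (LatticeEdge n) =
    (n 0 - 1) * n 1 * n 2 + n 0 * (n 1 - 1) * n 2 + n 0 * n 1 * (n 2 - 1) := by
  rw [← Nat.card_eq_fintype_card]
  have e : LatticeEdge n ≃ Σ d : Fin 3, {u : Vertex n // ∀ k, k = d → (u k).val + 1 < n k} :=
    ⟨fun x => ⟨x.1.1, x.1.2, fun k hk => by subst hk; exact x.2⟩,
      fun x => ⟨(x.1, x.2.1), x.2.2 _ rfl⟩, fun _ => rfl, fun _ => rfl⟩
  rw [Nat.card_congr e, Nat.card_sigma, Fin.sum_univ_three]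
  have key : ∀ d, Nat.card {u : Vertex n // ∀ k, k = d → (u k).val + 1 < n k} = _ := fun d =>
    card_pi_subtype fun k x => k = d → x.val + 1 < n k
  rw [key, key, key]
  simp [-Nat.card_eq_fintype_card, card_lt, Nat.card_fin]

/-- The number of odd faces. -/
theorem card_oddFace (ho : IsCompactOrientation o) (hc : IsTypedBy o c) :
    Nat.card {f : Face n // IsOddFace o f} = ∑ τ : Fin 2,
      (n 0 * segmentCount n c 1 τ * segmentCount n c 2 τ +
        segmentCount n c 0 τ * n 1 * segmentCount n c 2 τ +
        segmentCount n c 0 τ * segmentCount n c 1 τ * n 2) := by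
  let p : Fin 2 → Fin 3 → ∀ d, Fin (n d) → Prop := fun τ k d x =>
    d ≠ k → x.val + 1 < n d ∧ edgeType c d x.val = τ.val
  have e : (Σ τ : Fin 2, Σ k : Fin 3, {u : Vertex n // ∀ d, p τ k d (u d)}) ≃
      {f : Face n // IsOddFace o f} := by
    refine Equiv.ofBijective (fun x => ⟨⟨(x.2.1, x.2.2.1), fun d hd => (x.2.2.2 d hd).1⟩,
      (isOddFace_iff ho hc _).mpr fun a b ha hb =>
        (x.2.2.2 a ha).2.trans (x.2.2.2 b hb).2.symm⟩) ⟨?_, ?_⟩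
    · rintro ⟨τ, k, u, hu⟩ ⟨τ', k', u', hu'⟩ h
      have h₁ : (k, u) = (k', u') := congrArg (fun f => f.1.1) h
      obtain ⟨rfl, rfl⟩ : k = k' ∧ u = u' := Prod.ext_iff.mp h₁
      obtain ⟨a, -, -, ha, -, -⟩ := exists_other_axes k
      have : τ = τ' := Fin.ext ((hu a ha.symm).2.symm.trans (hu' a ha.symm).2)
      subst this
      rfl
    · rintro ⟨f, hf⟩
      obtain ⟨a, -, -, ha, -, -⟩ := exists_other_axes f.normal
      refine ⟨⟨⟨edgeType c a (f.base a).val, edgeType_lt _ _ _⟩, f.normal, f.base, fun d hd =>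
        ⟨f.lt hd, (isOddFace_iff ho hc f).mp hf d a hd ha.symm⟩⟩, rfl⟩
  rw [← Nat.card_congr e, Nat.card_sigma]
  refine Finset.sum_congr rfl fun τ _ => ?_
  rw [Nat.card_sigma, Fin.sum_univ_three]
  have key : ∀ k, Nat.card {u : Vertex n // ∀ d, p τ k d (u d)} = _ := fun k =>
    card_pi_subtype (p τ k)
  rw [key, key, key]
  simp [-Nat.card_eq_fintype_card, p, card_segment, Nat.card_fin]

/-- The number of odd corner vertices. -/
theorem oddCornerCount_eq (hn : ∀ d, 2 ≤ n d) (ho : IsCompactOrientation o)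
    (hc : IsTypedBy o c) :
    oddCornerCount o = ∑ τ : Fin 2, Nat.card {x : Fin (n 0) // IsEnd c τ 0 x} *
      Nat.card {x : Fin (n 1) // IsEnd c τ 1 x} * Nat.card {x : Fin (n 2) // IsEnd c τ 2 x} := by
  -- The cell at a corner has base coordinate `0` or `n d - 2` on each axis, and it is odd when the
  -- three edges there have a common type.
  have hodd : ∀ v : Vertex n, IsOddCorner o v ↔ ∃ τ : Fin 2, ∀ d, IsEnd c τ d (v d) := by
    intro v
    constructor
    · rintro ⟨hv, x, hx, hodd⟩
      rw [isOddCell_iff ho hc] at hodd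
      refine ⟨⟨edgeType c 0 (x.1 0).val, edgeType_lt _ _ _⟩, fun d => ?_⟩
      have h₁ := hv d
      have h₂ := hx d
      have h₃ := x.2 d
      have h₄ := hodd d 0
      have h₅ := hn d
      rcases h₁ with h₁ | h₁
      · exact Or.inl ⟨h₁, (congrArg _ (by omega)).trans h₄⟩
      · exact Or.inr ⟨h₁, (congrArg _ (by omega)).trans h₄⟩
    · rintro ⟨τ, h⟩
      refine ⟨fun d => (h d).imp And.left And.left, ?_⟩
      let x : Cell n := ⟨fun d => ⟨if (v d).val = 0 then 0 else n d - 2, by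
        have := hn d; split_ifs <;> omega⟩, fun d => by
        have := hn d; simp only; split_ifs <;> omega⟩
      refine ⟨x, fun d => ?_, (isOddCell_iff ho hc x).mpr ?_⟩
      · have h₁ := h d
        have h₂ := hn d
        change (v d).val = (if (v d).val = 0 then 0 else n d - 2) ∨
          (v d).val = (if (v d).val = 0 then 0 else n d - 2) + 1
        rcases h₁ with h₁ | h₁
        · simp [h₁.1]
        · have h₃ := h₁.1
          rw [if_neg (by omega)]
          omega
      · have key : ∀ d, edgeType c d (x.1 d).val = τ.val := by
          intro d
          have h₁ := h d
          have h₂ := hn d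
          change edgeType c d (if (v d).val = 0 then 0 else n d - 2) = τ.val
          rcases h₁ with h₁ | h₁
          · rw [if_pos h₁.1, h₁.2]
          · have h₃ := h₁.1
            rw [if_neg (by omega), h₁.2]
        intro a b
        rw [key a, key b]
  have e : (Σ τ : Fin 2, {v : Vertex n // ∀ d, IsEnd c τ d (v d)}) ≃
      {v : Vertex n // IsOddCorner o v} := by
    refine Equiv.ofBijective (fun x => ⟨x.2.1, (hodd _).mpr ⟨x.1, x.2.2⟩⟩) ⟨?_, ?_⟩
    · rintro ⟨τ, u, hu⟩ ⟨τ', u', hu'⟩ h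
      obtain rfl : u = u' := congrArg Subtype.val h
      have : τ = τ' := by
        apply Fin.ext
        have h₁ := hu 0
        have h₂ := hu' 0
        have h₃ := hn 0
        rcases h₁ with h₁ | h₁ <;> rcases h₂ with h₂ | h₂ <;> omega
      subst this
      rfl
    · rintro ⟨v, hv⟩
      obtain ⟨τ, hτ⟩ := (hodd v).mp hv
      exact ⟨⟨τ, v, hτ⟩, rfl⟩
  rw [oddCornerCount, ← Nat.card_congr e, Nat.card_sigma]
  exact Finset.sum_congr rfl fun τ _ => card_pi_subtype fun d => IsEnd c τ d

/-! ### The dimension of the space of trivial cycles -/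

/-- The dimension of the space of vectors with sum zero that are supported on `b`. -/
def supportedRank (b : Fin 3 → Bool) : ℕ :=
  (if b 0 && b 1 then 1 else 0) + (if b 2 && (b 0 || b 1) then 1 else 0)

theorem card_supported : ∀ b : Fin 3 → Bool,
    Fintype.card {κ : Fin 3 → ZMod 2 // (∀ d, b d = false → κ d = 0) ∧ ∑ d, κ d = 0} =
      2 ^ supportedRank b := by
  decide

open Classical in
-- The conditions defining `cellSpace` do not mix different cells, so the space is a product of the
-- local spaces counted by `card_supported`.
theorem card_cellSpace : Nat.card (cellSpace (n := n) c) =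
    2 ^ ∑ p : Fin 2 × Vertex n, supportedRank fun d => decide (IsCellEdge c p.1 p.2 d) := by
  have e : cellSpace (n := n) c ≃ ∀ p : Fin 2 × Vertex n, {κ : Fin 3 → ZMod 2 //
      (∀ d, decide (IsCellEdge c p.1 p.2 d) = false → κ d = 0) ∧ ∑ d, κ d = 0} :=
    ⟨fun κ p => ⟨κ.1 p, by simpa using κ.2 p⟩,
      fun κ => ⟨fun p => (κ p).1, fun p => by simpa using (κ p).2⟩, fun _ => rfl, fun _ => rfl⟩
  rw [Nat.card_congr e, Nat.card_pi, ← Finset.prod_pow_eq_pow_sum]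
  refine Finset.prod_congr rfl fun p _ => ?_
  rw [← card_supported, Nat.card_eq_fintype_card]

end Counting

/-! ### Comparison of the dimension count with the odd corners -/

section Disparity

variable {n : Fin 3 → ℕ} {o : Vertex n → Vertex n → Prop} {c : Fin 3 → ℕ}

/-- With `k` admissible axes the rank is the number of pairs minus the number of triples: 0, 0, 1, 2
for `k = 0, 1, 2, 3`. Pairs and triples can be counted axis by axis. -/
theorem supportedRank_add : ∀ b : Fin 3 → Bool,
    supportedRank b + (if ∀ d ∈ (Finset.univ : Finset (Fin 3)), b d = true then 1 else 0) =
      (if ∀ d ∈ ({0, 1} : Finset (Fin 3)), b d = true then 1 else 0) +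
      (if ∀ d ∈ ({0, 2} : Finset (Fin 3)), b d = true then 1 else 0) +
      (if ∀ d ∈ ({1, 2} : Finset (Fin 3)), b d = true then 1 else 0) := by
  decide

variable (n) in
/-- The number of possible coordinates along the axis `d` of the lowest vertex of an odd cell of
type `τ`. -/
def lowCount (c : Fin 3 → ℕ) (d : Fin 3) (τ : ℕ) : ℕ :=
  Nat.card {x : Fin (n d) // x.val = 0 ∨ edgeType c d x.val = τ}

open Classical in
-- The condition factors over the axes: segment starts on the axes in `s`, lowest coordinates on the
-- others. The latter condition enters only through `IsCellEdge`, so `s` must not be empty.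
theorem sum_isCellEdge (c : Fin 3 → ℕ) (τ : Fin 2) {s : Finset (Fin 3)} (hs : s.Nonempty) :
    (∑ O : Vertex n, if ∀ d ∈ s, decide (IsCellEdge c τ O d) = true then 1 else 0) =
      ∏ d, if d ∈ s then segmentCount n c d τ else lowCount n c d τ := by
  let p : ∀ d, Fin (n d) → Prop := fun d x => if d ∈ s then
    x.val + 1 < n d ∧ edgeType c d x.val = τ else x.val = 0 ∨ edgeType c d x.val = τ
  have hp : ∀ O : Vertex n, (∀ d ∈ s, decide (IsCellEdge c τ O d) = true) ↔ ∀ d, p d (O d) := by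
    intro O
    simp only [decide_eq_true_eq]
    constructor
    · intro h d
      obtain ⟨a, ha⟩ := hs
      by_cases hd : d ∈ s
      · simp only [p, if_pos hd]
        exact ⟨(h d hd).lt, (h d hd).type_eq⟩
      · simp only [p, if_neg hd]
        exact (h a ha).low d
    · intro h d hd
      have hd' := h d
      simp only [p, if_pos hd] at hd'
      refine ⟨fun k => ?_, hd'.2, hd'.1⟩
      have hk := h k
      by_cases hks : k ∈ s
      · simp only [p, if_pos hks] at hk
        exact Or.inr hk.2
      · simp only [p, if_neg hks] at hk
        exact hk
  simp only [hp]
  rw [← Finset.card_filter, ← Fintype.card_subtype, ← Nat.card_eq_fintype_card, card_pi_subtype,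
    Fin.prod_univ_three]
  have key : ∀ d, Nat.card {x // p d x} =
      if d ∈ s then segmentCount n c d τ else lowCount n c d τ := by
    intro d
    by_cases hd : d ∈ s
    · simp only [p, if_pos hd]
      exact card_segment c d τ
    · simp only [p, if_neg hd]
      rfl
  rw [key, key, key]

open Classical in
theorem sum_supportedRank (c : Fin 3 → ℕ) :
    (∑ p : Fin 2 × Vertex n, supportedRank fun d => decide (IsCellEdge c p.1 p.2 d)) +
      ∑ τ : Fin 2, segmentCount n c 0 τ * segmentCount n c 1 τ * segmentCount n c 2 τ =
    ∑ τ : Fin 2, (segmentCount n c 0 τ * segmentCount n c 1 τ * lowCount n c 2 τ +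
      segmentCount n c 0 τ * lowCount n c 1 τ * segmentCount n c 2 τ +
      lowCount n c 0 τ * segmentCount n c 1 τ * segmentCount n c 2 τ) := by
  rw [Fintype.sum_prod_type, ← Finset.sum_add_distrib]
  refine Finset.sum_congr rfl fun τ _ => ?_
  have h := Finset.sum_congr (rfl : (Finset.univ : Finset (Vertex n)) = Finset.univ)
    fun O _ => supportedRank_add fun d => decide (IsCellEdge c τ O d)
  simp only [Finset.sum_add_distrib] at h
  rw [sum_isCellEdge c τ (by simp), sum_isCellEdge c τ (by simp), sum_isCellEdge c τ (by simp),
    sum_isCellEdge c τ (by simp)] at h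
  simpa [Fin.prod_univ_three] using h

theorem card_qubit (o : Vertex n → Vertex n → Prop) :
    Fintype.card (Qubit o) = Fintype.card (Vertex n) + Nat.card {f : Face n // IsOddFace o f} := by
  rw [← Nat.card_eq_fintype_card, ← Nat.card_eq_fintype_card, ← Nat.card_sum]

/-- Twice the disparity, in terms of the number of odd corner vertices. -/
theorem two_mul_disparity_add_one (hn : ∀ d, 2 ≤ n d) (ho : IsCompactOrientation o)
    (hc : IsTypedBy o c) {pick : Face n → Vertex n × Vertex n} (hpick : IsEdgeChoice o pick)
    {σ : MG (lattice n) →* QubitOp (Qubit o)} (hσ : IsCubicEncoding o pick σ) :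
    2 * (disparity σ + 1) = oddCornerCount o := by
  classical
  have hD := minGenerators_stabilizerGroup hn ho hc hpick hσ card_cellSpace
  have hm := sum_supportedRank (n := n) c
  have hF := card_oddFace ho hc
  have hO := oddCornerCount_eq hn ho hc
  rw [disparity, card_qubit]
  rw [card_vertex, card_latticeEdge] at hD
  rw [hF, hO]
  generalize (∑ p : Fin 2 × Vertex n, supportedRank fun d => decide (IsCellEdge c p.1 p.2 d)) = m
    at hD hm
  generalize minGenerators (stabilizerGroup σ) = D at hD ⊢
  have hA := segmentCount_add hn c
  have hL := fun d => card_low_add hn c d (show 0 < 2 by norm_num)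
  have hL' := fun d => card_low_add hn c d (show 1 < 2 by norm_num)
  have hI := fun d => card_isEnd_add hn c d (show 0 + 1 = 1 by norm_num)
  have hI' := fun d => card_isEnd_add hn c d (show 1 + 0 = 1 by norm_num)
  change ∀ d, lowCount n c d 0 + _ = _ at hL
  change ∀ d, lowCount n c d 1 + _ = _ at hL'
  simp only [Fin.sum_univ_two, Fin.val_zero, Fin.val_one] at hm ⊢
  have hE : ∀ d, ((n d - 1 : ℕ) : ℤ) = n d - 1 := fun d => by
    have := hn d
    omega
  zify at hD hm hA hL hL' hI hI'
  simp only [hE] at hD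
  push_cast
  have eL := fun d => eq_sub_of_add_eq (hL d)
  have eL' := fun d => eq_sub_of_add_eq (hL' d)
  have eI := fun d => eq_sub_of_add_eq (hI d)
  have eI' := fun d => eq_sub_of_add_eq (hI' d)
  simp only [eL, eL'] at hm
  simp only [eI, eI']
  simp only [← hA] at hD hm ⊢
  -- Let `A_d` be the segment counts of a type, `F` the number of odd faces, `V` and `E` those of
  -- vertices and edges. By `hm`, `m = F - 4 ∑ A₀A₁A₂`, so with `hD` the left side is `2 (2F - 4 ∑
  -- A₀A₁A₂ + V - E)`, the sums being over the two types. Expanding `∑ ∏ (n d - 2 A_d)` on the right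
  -- gives the same, as the two values of `A_d` add up to `n d - 1`.
  linear_combination 2 * hm - 2 * hD

/-- Each axis has two ends, whose types are distributed as `0 + 2`, `1 + 1` or `2 + 0`; the count is
the sum of the two products over the axes. -/
theorem oddCornerCount_mem (hn : ∀ d, 2 ≤ n d) (ho : IsCompactOrientation o)
    (hc : IsTypedBy o c) : oddCornerCount o ∈ ({0, 2, 4, 8} : Set ℕ) := by
  have hA := segmentCount_add hn c
  have hI := fun d => card_isEnd_add hn c d (show 0 + 1 = 1 by norm_num)
  have hI' := fun d => card_isEnd_add hn c d (show 1 + 0 = 1 by norm_num)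
  have key : ∀ d, (Nat.card {x : Fin (n d) // IsEnd c 0 d x} = 0 ∧
        Nat.card {x : Fin (n d) // IsEnd c 1 d x} = 2) ∨
      (Nat.card {x : Fin (n d) // IsEnd c 0 d x} = 1 ∧
        Nat.card {x : Fin (n d) // IsEnd c 1 d x} = 1) ∨
      (Nat.card {x : Fin (n d) // IsEnd c 0 d x} = 2 ∧
        Nat.card {x : Fin (n d) // IsEnd c 1 d x} = 0) := by
    intro d
    have h₁ := hA d
    have h₂ := hI d
    have h₃ := hI' d
    omega
  rw [oddCornerCount_eq hn ho hc]
  simp only [Fin.sum_univ_two, Fin.val_zero, Fin.val_one]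
  rcases key 0 with h₀ | h₀ | h₀ <;> rcases key 1 with h₁ | h₁ | h₁ <;>
    rcases key 2 with h₂ | h₂ | h₂ <;>
    rw [h₀.1, h₀.2, h₁.1, h₁.2, h₂.1, h₂.2] <;> simp

end Disparity

end

end CompactEncoding

/-- On a box-shaped cubic lattice with at least two vertices along each axis, for every admissible
edge orientation and every choice of edges for the isolated odd faces, the cubic compact encoding
exists, no cycle is mapped to `-1`, and its disparity is `OCV / 2 - 1 ∈ {-1, 0, 1, 3}`. -/
theorem mainTheorem1 (n : Fin 3 → ℕ) (hn : ∀ d, 2 ≤ n d)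
    (o : Vertex n → Vertex n → Prop) (ho : IsCompactOrientation o)
    (pick : Face n → Vertex n × Vertex n) (hpick : IsEdgeChoice o pick) :
    (∃ σ : MG (lattice n) →* QubitOp (Qubit o), IsCubicEncoding o pick σ) ∧
    ∀ σ : MG (lattice n) →* QubitOp (Qubit o), IsCubicEncoding o pick σ →
      (-1 : (QubitOp (Qubit o))ˣ) ∉ stabilizerGroup σ ∧
      (disparity σ : ℚ) = (oddCornerCount o : ℚ) / 2 - 1 ∧
      disparity σ ∈ ({-1, 0, 1, 3} : Set ℤ) := by
  obtain ⟨c, hc⟩ := ho.exists_isTypedBy hn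
  refine ⟨exists_isCubicEncoding ho hc pick, fun σ hσ =>
    ⟨neg_one_notMem_stabilizerGroup ho hc hpick hσ, ?_, ?_⟩⟩
  · have h : 2 * ((disparity σ : ℚ) + 1) = oddCornerCount o := by
      exact_mod_cast two_mul_disparity_add_one hn ho hc hpick hσ
    linarith
  · have h := two_mul_disparity_add_one hn ho hc hpick hσ
    have h' := oddCornerCount_mem hn ho hc
    simp only [Set.mem_insert_iff, Set.mem_singleton_iff] at h' ⊢
    omega
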